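/- Let $n\ge 1$, let $\Omega\subset\mathbb R^n$ be a bounded open set with $\mathcal C^1$ boundary, let $p\ge 1$, $\lambda\in\mathbb R$ and $H\in L^\infty(\Omega)$ (for instance $H$ Lipschitz on $\Omega$). Put $f(s)=|s|^{p-1}s$, $F(s)=\frac{1}{p+1}|s|^{p+1}$ and $G(s,t)=F(t)-F(s)-f(s)(t-s)$. For $u\in \mathrm{BV}(\Omega)$ let $$\mathscr A(u)=\int_\Omega\sqrt{1+|\nabla u|^2}:=\sup\Big\{\int_\Omega \big(g_0+u\,\mathrm{div}\,g\big)\,dx:\ g_0\in \mathcal C^1_c(\Omega),\ g\in \mathcal C^1_c(\Omega)^n,\ g_0^2+|g|^2\le 1\Big\},$$ $$\mathcal L(u)(\varphi)=\lim_{t\downarrow 0}\frac{\mathscr A(u+t\varphi)-\mathscr A(u)}{t}\quad(\varphi\in \mathrm{BV}(\Omega)),$$ and, for $u\in L^{p+1}\cap\mathrm{BV}(\Omega)$, $$\mathscr J_\lambda(u)=\mathscr A(u)-\int_\Omega \big(Hu+\lambda F(u)\big)\,dx .$$ Boundary values of $v\in\mathrm{BV}(\Omega)$ are understood in the sense of traces: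 the trace of $v$ is the ($\mathscr H^{n-1}$-a.e. unique) function $Tv\in L^1(\partial\Omega)$ such that $r^{-n}\int_{B(x,r)\cap\Omega}|v(y)-Tv(x)|\,dy\to0$ as $r\downarrow0$ for $\mathscr H^{n-1}$-a.e. $x\in\partial\Omega$; we write $v$ for $Tv$ on $\partial\Omega$. A function $u\in L^{p+1}\cap\mathrm{BV}(\Omega)$ is called a weak solution of $-\mathrm{div}\big(\nabla u/\sqrt{1+|\nabla u|^2}\big)=H+\lambda f(u)$ in $\Omega$, $u=0$ on $\partial\Omega$, if $u\ge0$ a.e. in $\Omega$, $u=0$ on $\partial\Omega$, and for every $\varphi\in L^{p+1}\cap \mathrm{BV}(\Omega)$ with $\varphi=0$ on $\partial\Omega$ the limit $\mathcal L(u)(\varphi)$ exists and $\mathcal L(u)(\varphi)\ge\int_\Omega (H+\lambda f(u))\varphi\,dx$. Then $G(s,t)\ge 0$ for all $s,t\in\mathbb R$, and for every non-negative $u\in L^{p+1}\cap\mathrm{BV}(\Omega)$ the following are equivalent: (i) $u$ is a weak solution; (ii) $u=0$ on $\partial\Omega$, and every $v\in L^{p+1}\cap\mathrm{BV}(\Omega)$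 has a trace on $\partial\Omega$ and satisfies $$\mathscr A(u)-\int_\Omega (H+\lambda f(u))\,u\,dx\le\mathscr A(v)-\int_\Omega (H+\lambda f(u))\,v\,dx+\int_{\partial\Omega}|v|\,d\mathscr H^{n-1};$$ (iii) $u=0$ on $\partial\Omega$, and every $v\in L^{p+1}\cap\mathrm{BV}(\Omega)$ has a trace on $\partial\Omega$ and satisfies $$\mathscr J_\lambda(u)\le\mathscr J_\lambda(v)+\int_\Omega\lambda\, G(u,v)\,dx+\int_{\partial\Omega}|v|\,d\mathscr H^{n-1}.$$ -/

import Mathlib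

open MeasureTheory Filter Topology
open scoped ENNReal

noncomputable section

namespace MeanCurvature

variable {n : ℕ}

/-- The divergence `∑ i, ∂ᵢ gᵢ (x)` of a vector field on `ℝⁿ`. -/
def divergence (g : EuclideanSpace ℝ (Fin n) → EuclideanSpace ℝ (Fin n))
    (x : EuclideanSpace ℝ (Fin n)) : ℝ :=
  ∑ i : Fin n, (fderiv ℝ g x (EuclideanSpace.single i 1)) i

/-- `g` is of class `C¹` with compact support contained in `Ω`. -/
def IsTest {F : Type*} [NormedAddCommGroup F] [NormedSpace ℝ F]
    (Ω : Set (EuclideanSpace ℝ (Fin n))) (g : EuclideanSpace ℝ (Fin n) → F) : Prop :=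
  ContDiff ℝ 1 g ∧ HasCompactSupport g ∧ tsupport g ⊆ Ω

/-- The numbers `∫_Ω u div g` whose supremum is the total variation `∫_Ω |Du|`. -/
def variationSet (Ω : Set (EuclideanSpace ℝ (Fin n))) (u : EuclideanSpace ℝ (Fin n) → ℝ) :
    Set ℝ :=
  {s | ∃ g : EuclideanSpace ℝ (Fin n) → EuclideanSpace ℝ (Fin n),
    IsTest Ω g ∧ (∀ x, ‖g x‖ ≤ 1) ∧ s = ∫ x in Ω, u x * divergence g x}

/-- `u ∈ BV(Ω)`: `u` is integrable on `Ω` and has finite total variation in `Ω`. -/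
def IsBV (Ω : Set (EuclideanSpace ℝ (Fin n))) (u : EuclideanSpace ℝ (Fin n) → ℝ) : Prop :=
  IntegrableOn u Ω ∧ BddAbove (variationSet Ω u)

/-- `u ∈ L^{p+1}(Ω) ∩ BV(Ω)`. -/
def IsAdmissible (Ω : Set (EuclideanSpace ℝ (Fin n))) (p : ℝ)
    (u : EuclideanSpace ℝ (Fin n) → ℝ) : Prop :=
  MemLp u (ENNReal.ofReal (p + 1)) (volume.restrict Ω) ∧ IsBV Ω u

/-- The numbers `∫_Ω g₀ + u div g` whose supremum is the area of the graph of `u`; the pair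
`(g₀, g)` takes its values in the closed Euclidean unit ball of `ℝ × ℝⁿ = ℝⁿ⁺¹`. -/
def areaSet (Ω : Set (EuclideanSpace ℝ (Fin n))) (u : EuclideanSpace ℝ (Fin n) → ℝ) : Set ℝ :=
  {s | ∃ (g₀ : EuclideanSpace ℝ (Fin n) → ℝ)
      (g : EuclideanSpace ℝ (Fin n) → EuclideanSpace ℝ (Fin n)),
    IsTest Ω g₀ ∧ IsTest Ω g ∧ (∀ x, g₀ x ^ 2 + ‖g x‖ ^ 2 ≤ 1) ∧
      s = ∫ x in Ω, (g₀ x + u x * divergence g x)}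

/-- The area functional `𝒜(u) = ∫_Ω √(1 + |∇u|²)`, for `u ∈ BV(Ω)` and `Ω` bounded. -/
def area (Ω : Set (EuclideanSpace ℝ (Fin n))) (u : EuclideanSpace ℝ (Fin n) → ℝ) : ℝ :=
  sSup (areaSet Ω u)

/-- `ℓ` is the one-sided directional derivative `lim_{t ↓ 0} (𝒜(u + t φ) - 𝒜(u)) / t`. -/
def HasAreaDeriv (Ω : Set (EuclideanSpace ℝ (Fin n))) (u φ : EuclideanSpace ℝ (Fin n) → ℝ)
    (ℓ : ℝ) : Prop :=
  Tendsto (fun t : ℝ => (area Ω (fun x => u x + t * φ x) - area Ω u) / t) (𝓝[>] 0) (𝓝 ℓ)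

/-- The surface measure `ℋⁿ⁻¹` on `∂Ω`, normalized so that it agrees with Lebesgue measure
on hyperplanes. -/
def surfaceMeasure (Ω : Set (EuclideanSpace ℝ (Fin n))) : Measure (EuclideanSpace ℝ (Fin n)) :=
  (Measure.euclideanHausdorffMeasure (n - 1)).restrict (frontier Ω)

/-- `∂Ω` is of class `C¹`: near each boundary point, `Ω` is the set of points strictly above the
graph, in the direction of a unit vector `e`, of a `C¹` function `ψ` of the variables orthogonal
to `e`. -/
def HasC1Boundary (Ω : Set (EuclideanSpace ℝ (Fin n))) : Prop :=
  ∀ x ∈ frontier Ω, ∃ (e : EuclideanSpace ℝ (Fin n)) (ψ : EuclideanSpace ℝ (Fin n) → ℝ) (r : ℝ),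
    ‖e‖ = 1 ∧ ContDiff ℝ 1 ψ ∧ (∀ (y : EuclideanSpace ℝ (Fin n)) (t : ℝ), ψ (y + t • e) = ψ y) ∧
      0 < r ∧ ∀ y ∈ Metric.ball x r, y ∈ Ω ↔ ψ y < inner ℝ y e

/-- `T ∈ L¹(∂Ω)` is the trace of `u` on `∂Ω`: for `ℋⁿ⁻¹`-almost every `x ∈ ∂Ω`,
`r⁻ⁿ ∫_{B(x,r) ∩ Ω} |u(y) - T(x)| dy → 0` as `r ↓ 0`. -/
def HasTrace (Ω : Set (EuclideanSpace ℝ (Fin n))) (u T : EuclideanSpace ℝ (Fin n) → ℝ) : Prop :=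
  Integrable T (surfaceMeasure Ω) ∧
    ∀ᵐ x ∂(surfaceMeasure Ω),
      Tendsto (fun r : ℝ => (∫ y in Metric.ball x r ∩ Ω, |u y - T x|) / r ^ n) (𝓝[>] 0) (𝓝 0)

/-- `u = 0` on `∂Ω`, in the sense of traces. -/
def VanishesOnBoundary (Ω : Set (EuclideanSpace ℝ (Fin n)))
    (u : EuclideanSpace ℝ (Fin n) → ℝ) : Prop :=
  HasTrace Ω u (fun _ => 0)

/-- The nonlinearity `f(s) = |s|^{p-1} s`. -/
def f (p s : ℝ) : ℝ := |s| ^ (p - 1) * s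

/-- The primitive `F(s) = |s|^{p+1} / (p+1)` of `f`. -/
def F (p s : ℝ) : ℝ := |s| ^ (p + 1) / (p + 1)

/-- `G(s,t) = F(t) - F(s) - f(s)(t - s)`. -/
def G (p s t : ℝ) : ℝ := F p t - F p s - f p s * (t - s)

/-- `𝒥_λ(u) = 𝒜(u) - ∫_Ω (H u + λ F(u))`. -/
def energy (Ω : Set (EuclideanSpace ℝ (Fin n))) (H : EuclideanSpace ℝ (Fin n) → ℝ) (p lam : ℝ)
    (u : EuclideanSpace ℝ (Fin n) → ℝ) : ℝ :=
  area Ω u - ∫ x in Ω, (H x * u x + lam * F p (u x))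

/-- `u` is a weak solution of `-div (∇u / √(1 + |∇u|²)) = H + λ f(u)` in `Ω`, `u = 0` on `∂Ω`. -/
def IsWeakSolution (Ω : Set (EuclideanSpace ℝ (Fin n))) (H : EuclideanSpace ℝ (Fin n) → ℝ)
    (p lam : ℝ) (u : EuclideanSpace ℝ (Fin n) → ℝ) : Prop :=
  IsAdmissible Ω p u ∧
    (∀ φ : EuclideanSpace ℝ (Fin n) → ℝ, IsAdmissible Ω p φ → VanishesOnBoundary Ω φ →
      ∃ ℓ : ℝ, HasAreaDeriv Ω u φ ℓ ∧ ∫ x in Ω, (H x + lam * f p (u x)) * φ x ≤ ℓ) ∧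
    (∀ᵐ x ∂(volume.restrict Ω), 0 ≤ u x) ∧
    VanishesOnBoundary Ω u

end MeanCurvature

end

/-! The functional `area` is a supremum of affine functionals of `u`, hence convex. Its difference
quotient at `u` in a direction `φ` is therefore nondecreasing in `t > 0`: it converges as `t ↓ 0`
once it is bounded below, and its limit is at most the increment at `t = 1`. So the weak inequality,
tested with `φ = v - u`, says that `u` minimises the linearised functional `v ↦ area v - ∫ (H + λ
f(u)) v` among `v` with zero trace (`IsWeakSolution.le_of_vanishesOnBoundary`). Conversely,
comparing `u` with `u + t φ` gives the lower bound on the quotients (`isWeakSolution_of_forall_le`);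
there the boundary term drops out because traces are unique.

The substance is the passage from zero trace to arbitrary `v` at the price `∫_{∂Ω} |v|`
(`exists_hasTrace_and_le`). Multiply `v` by cut-offs `η_k ∈ C¹_c(Ω)` tending to `1`. By the product
rule the area grows by at most `∫ |v| |∇η_k|` (`area_cutoff_le`), and it remains to show that this
cost is asymptotically at most `∫_{∂Ω} |Tv|`
(`ChartPartition.eventually_lintegral_fderiv_cutoff_le`).

Both this bound and the existence of the trace come from the fibres of boundary charts. In the
coordinates (base, height above the graph), which preserve volume, the `L¹` norms of difference
quotients of a `BV` function along the fibres are controlled by its total variation. On almost every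
fibre `v` then has an essential limit `T` at height `0`, with an oscillation bound integrable over
the base. Lebesgue differentiation on the base turns `T` into the trace defined by averages over
balls. For the cost, `|∇η_k|` in a chart is essentially an approximate identity in the height times
`√(1 + |∇ψ|²)`; the reverse Fatou lemma bounds the limit by `∫ |T| √(1 + |∇ψ|²)`. Of the area
formula only the inequality "slope integral at most Hausdorff measure" is needed
(`GraphFrame.withDensity_slope_le`).

Finally, `G(s,t) ≥ 0` is Young's inequality, and adding `∫ λ G(u,v)` to the energy of `v` yields the
linearised functional plus a constant depending on `u` alone, so the last two conditions are the
same inequality. -/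

namespace MeanCurvature

variable {n : ℕ}

/-! ### Test functions, test fields and their divergence -/

section Tests

variable {F : Type*} [NormedAddCommGroup F] [NormedSpace ℝ F]
  {Ω : Set (EuclideanSpace ℝ (Fin n))}

lemma IsTest.continuous {g : EuclideanSpace ℝ (Fin n) → F} (hg : IsTest Ω g) : Continuous g :=
  hg.1.continuous

lemma IsTest.exists_bound {g : EuclideanSpace ℝ (Fin n) → F} (hg : IsTest Ω g) :
    ∃ C, ∀ x, ‖g x‖ ≤ C :=
  hg.continuous.bounded_above_of_compact_support hg.2.1

lemma IsTest.continuous_divergence {g : EuclideanSpace ℝ (Fin n) → EuclideanSpace ℝ (Fin n)}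
    (hg : IsTest Ω g) : Continuous (divergence g) := by
  unfold divergence
  have h := hg.1.continuous_fderiv (by norm_num)
  refine continuous_finsetSum _ fun i _ => ?_
  have : Continuous fun x => fderiv ℝ g x (EuclideanSpace.single i 1) := h.clm_apply continuous_const
  fun_prop

lemma divergence_eq_zero {g : EuclideanSpace ℝ (Fin n) → EuclideanSpace ℝ (Fin n)}
    {x : EuclideanSpace ℝ (Fin n)} (hx : x ∉ tsupport g) : divergence g x = 0 := by
  have : fderiv ℝ g x = 0 := by
    by_contra h
    exact hx (support_fderiv_subset ℝ h)
  simp [divergence, this]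

lemma IsTest.exists_bound_divergence
    {g : EuclideanSpace ℝ (Fin n) → EuclideanSpace ℝ (Fin n)} (hg : IsTest Ω g) :
    ∃ C, ∀ x, ‖divergence g x‖ ≤ C :=
  hg.continuous_divergence.bounded_above_of_compact_support
    (HasCompactSupport.intro hg.2.1 fun _ hx => divergence_eq_zero hx)

lemma IsTest.integrable [MeasurableSpace F] [BorelSpace F] {g : EuclideanSpace ℝ (Fin n) → F}
    (hg : IsTest Ω g) : Integrable g :=
  hg.continuous.integrable_of_hasCompactSupport hg.2.1

lemma IsTest.integrableOn_mul_divergence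
    {g : EuclideanSpace ℝ (Fin n) → EuclideanSpace ℝ (Fin n)} (hg : IsTest Ω g)
    {u : EuclideanSpace ℝ (Fin n) → ℝ} (hu : IntegrableOn u Ω) :
    IntegrableOn (fun x => u x * divergence g x) Ω := by
  obtain ⟨C, hC⟩ := hg.exists_bound_divergence
  exact Integrable.mul_bdd hu hg.continuous_divergence.aestronglyMeasurable
    (Eventually.of_forall hC)

lemma isTest_zero : IsTest Ω (fun _ => (0 : F)) := by
  refine ⟨contDiff_const, HasCompactSupport.zero, ?_⟩
  have : tsupport (fun _ : EuclideanSpace ℝ (Fin n) => (0 : F)) = ∅ :=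
    tsupport_eq_empty_iff.2 rfl
  simp [this]

lemma IsTest.smul {η : EuclideanSpace ℝ (Fin n) → ℝ} (hη : IsTest Ω η)
    {g : EuclideanSpace ℝ (Fin n) → F} (hg : ContDiff ℝ 1 g) : IsTest Ω (fun x => η x • g x) :=
  ⟨hη.1.smul hg, hη.2.1.smul_right, (tsupport_smul_subset_left η g).trans hη.2.2⟩

lemma divergence_smul {η : EuclideanSpace ℝ (Fin n) → ℝ}
    {g : EuclideanSpace ℝ (Fin n) → EuclideanSpace ℝ (Fin n)} (hη : ContDiff ℝ 1 η)
    (hg : ContDiff ℝ 1 g) (x : EuclideanSpace ℝ (Fin n)) :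
    divergence (fun y => η y • g y) x = η x * divergence g x + fderiv ℝ η x (g x) := by
  have h1 : fderiv ℝ (fun y => η y • g y) x
      = η x • fderiv ℝ g x + (fderiv ℝ η x).smulRight (g x) :=
    fderiv_fun_smul (hη.differentiable (by norm_num) x) (hg.differentiable (by norm_num) x)
  have h2 : g x = ∑ i, g x i • EuclideanSpace.single i (1 : ℝ) := by
    have := (EuclideanSpace.basisFun (Fin n) ℝ).sum_repr (g x)
    simpa using this.symm
  have h3 : fderiv ℝ η x (g x) = ∑ i, fderiv ℝ η x (EuclideanSpace.single i 1) * g x i := by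
    conv_lhs => rw [h2]
    simp [map_sum, mul_comm]
  simp only [divergence, h1, h3, Finset.mul_sum, ← Finset.sum_add_distrib]
  simp

lemma divergence_smul_const {η : EuclideanSpace ℝ (Fin n) → ℝ} (hη : ContDiff ℝ 1 η)
    (e x : EuclideanSpace ℝ (Fin n)) : divergence (fun y => η y • e) x = fderiv ℝ η x e := by
  rw [divergence_smul hη contDiff_const]
  simp [divergence]

end Tests

/-! ### The area functional: convexity, directional derivatives, cut-offs -/

section Area

variable {Ω : Set (EuclideanSpace ℝ (Fin n))} {u v φ : EuclideanSpace ℝ (Fin n) → ℝ} {p : ℝ}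

lemma zero_mem_areaSet : (0 : ℝ) ∈ areaSet Ω u :=
  ⟨fun _ => 0, fun _ => 0, isTest_zero, isTest_zero, by simp, by simp [divergence]⟩

lemma zero_mem_variationSet : (0 : ℝ) ∈ variationSet Ω u :=
  ⟨fun _ => 0, isTest_zero, by simp, by simp [divergence]⟩

lemma norm_le_one_of_sq_add_sq_le {a b : ℝ} (hb : 0 ≤ b) (h : a ^ 2 + b ^ 2 ≤ 1) :
    |a| ≤ 1 ∧ b ≤ 1 := by
  constructor
  · exact abs_le_one_iff_mul_self_le_one.2 (by nlinarith)
  · nlinarith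

lemma integral_add_mul_divergence {g₀ : EuclideanSpace ℝ (Fin n) → ℝ}
    {g : EuclideanSpace ℝ (Fin n) → EuclideanSpace ℝ (Fin n)} (h₀ : IsTest Ω g₀)
    (hg : IsTest Ω g) (hu : IntegrableOn u Ω) :
    ∫ x in Ω, (g₀ x + u x * divergence g x)
      = (∫ x in Ω, g₀ x) + ∫ x in Ω, u x * divergence g x :=
  integral_add h₀.integrable.integrableOn (hg.integrableOn_mul_divergence hu)

/-- Both `g₀` and `g` are bounded by one, so volume plus total variation is an upper bound.
Finiteness matters: the real `sSup` of an unbounded set is `0`, and `area` would lose its meaning.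
-/
lemma IsBV.bddAbove_areaSet (hΩ : Bornology.IsBounded Ω) (hu : IsBV Ω u) :
    BddAbove (areaSet Ω u) := by
  obtain ⟨M, hM⟩ := hu.2
  refine ⟨volume.real Ω + M, ?_⟩
  rintro s ⟨g₀, g, h₀, hg, hle, rfl⟩
  rw [integral_add_mul_divergence h₀ hg hu.1]
  refine add_le_add ?_ (hM ⟨g, hg, fun x =>
    (norm_le_one_of_sq_add_sq_le (norm_nonneg _) (hle x)).2, rfl⟩)
  have := norm_setIntegral_le_of_norm_le_const (μ := volume) (f := g₀) (C := 1) hΩ.measure_lt_top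
    (fun x _ => (norm_le_one_of_sq_add_sq_le (norm_nonneg _) (hle x)).1)
  rw [one_mul] at this
  exact (le_abs_self _).trans this

lemma IsBV.le_area (hΩ : Bornology.IsBounded Ω) (hu : IsBV Ω u)
    {g₀ : EuclideanSpace ℝ (Fin n) → ℝ}
    {g : EuclideanSpace ℝ (Fin n) → EuclideanSpace ℝ (Fin n)} (h₀ : IsTest Ω g₀)
    (hg : IsTest Ω g) (hle : ∀ x, g₀ x ^ 2 + ‖g x‖ ^ 2 ≤ 1) :
    ∫ x in Ω, (g₀ x + u x * divergence g x) ≤ area Ω u :=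
  le_csSup (hu.bddAbove_areaSet hΩ) ⟨g₀, g, h₀, hg, hle, rfl⟩

lemma area_le {c : ℝ} (h : ∀ (g₀ : EuclideanSpace ℝ (Fin n) → ℝ)
      (g : EuclideanSpace ℝ (Fin n) → EuclideanSpace ℝ (Fin n)), IsTest Ω g₀ → IsTest Ω g →
      (∀ x, g₀ x ^ 2 + ‖g x‖ ^ 2 ≤ 1) → ∫ x in Ω, (g₀ x + u x * divergence g x) ≤ c) :
    area Ω u ≤ c := by
  refine csSup_le ⟨0, zero_mem_areaSet⟩ ?_
  rintro s ⟨g₀, g, h₀, hg, hle, rfl⟩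
  exact h g₀ g h₀ hg hle

lemma variationSet_congr (h : u =ᵐ[volume.restrict Ω] v) :
    variationSet Ω u = variationSet Ω v := by
  have : ∀ g : EuclideanSpace ℝ (Fin n) → EuclideanSpace ℝ (Fin n),
      ∫ x in Ω, u x * divergence g x = ∫ x in Ω, v x * divergence g x := fun g =>
    integral_congr_ae (h.mono fun x hx => by simp only [hx])
  simp only [variationSet, this]

lemma area_congr (h : u =ᵐ[volume.restrict Ω] v) : area Ω u = area Ω v := by
  have : ∀ (g₀ : EuclideanSpace ℝ (Fin n) → ℝ)
      (g : EuclideanSpace ℝ (Fin n) → EuclideanSpace ℝ (Fin n)),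
      ∫ x in Ω, (g₀ x + u x * divergence g x) = ∫ x in Ω, (g₀ x + v x * divergence g x) :=
    fun g₀ g => integral_congr_ae (h.mono fun x hx => by simp only [hx])
  simp only [area, areaSet, this]

lemma IsBV.congr (hu : IsBV Ω u) (h : u =ᵐ[volume.restrict Ω] v) : IsBV Ω v :=
  ⟨hu.1.congr_fun_ae h, variationSet_congr h ▸ hu.2⟩

lemma IsBV.add (hu : IsBV Ω u) (hv : IsBV Ω v) : IsBV Ω (fun x => u x + v x) := by
  obtain ⟨A, hA⟩ := hu.2
  obtain ⟨B, hB⟩ := hv.2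
  refine ⟨hu.1.add hv.1, A + B, ?_⟩
  rintro s ⟨g, hg, hle, rfl⟩
  simp only [add_mul]
  rw [integral_add (hg.integrableOn_mul_divergence hu.1) (hg.integrableOn_mul_divergence hv.1)]
  exact add_le_add (hA ⟨g, hg, hle, rfl⟩) (hB ⟨g, hg, hle, rfl⟩)

lemma divergence_neg (g : EuclideanSpace ℝ (Fin n) → EuclideanSpace ℝ (Fin n))
    (x : EuclideanSpace ℝ (Fin n)) : divergence (fun y => -g y) x = -divergence g x := by
  have : fderiv ℝ (fun y => -g y) x = -fderiv ℝ g x := fderiv_neg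
  simp [divergence, this]

lemma IsTest.neg {F : Type*} [NormedAddCommGroup F] [NormedSpace ℝ F]
    {g : EuclideanSpace ℝ (Fin n) → F} (hg : IsTest Ω g) : IsTest Ω (fun x => -g x) := by
  have ht : tsupport (fun x => -g x) = tsupport g := by
    simp only [tsupport]; congr 1; ext x; simp
  refine ⟨hg.1.neg, ?_, ht ▸ hg.2.2⟩
  have := hg.2.1
  rw [HasCompactSupport, ht]
  exact this

/-- The admissible fields are symmetric under `g ↦ -g`, which makes the one-sided bound two-sided.
-/
lemma IsBV.exists_abs_le (hu : IsBV Ω u) :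
    ∃ M, 0 ≤ M ∧ ∀ g : EuclideanSpace ℝ (Fin n) → EuclideanSpace ℝ (Fin n), IsTest Ω g →
      (∀ x, ‖g x‖ ≤ 1) → |∫ x in Ω, u x * divergence g x| ≤ M := by
  obtain ⟨M, hM⟩ := hu.2
  refine ⟨M, hM zero_mem_variationSet, fun g hg hle => abs_le.2 ⟨?_, hM ⟨g, hg, hle, rfl⟩⟩⟩
  have := hM ⟨fun x => -g x, hg.neg, by simpa using hle, rfl⟩
  simp only [divergence_neg, mul_neg, integral_neg] at this
  linarith

lemma IsBV.const_mul (hu : IsBV Ω u) (c : ℝ) : IsBV Ω (fun x => c * u x) := by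
  obtain ⟨M, hM0, hM⟩ := hu.exists_abs_le
  refine ⟨hu.1.const_mul c, |c| * M, ?_⟩
  rintro s ⟨g, hg, hle, rfl⟩
  simp only [mul_assoc]
  rw [integral_const_mul]
  refine (le_abs_self _).trans ?_
  rw [abs_mul]
  exact mul_le_mul_of_nonneg_left (hM g hg hle) (abs_nonneg c)

lemma IsAdmissible.add (hu : IsAdmissible Ω p u) (hv : IsAdmissible Ω p v) :
    IsAdmissible Ω p (fun x => u x + v x) :=
  ⟨hu.1.add hv.1, hu.2.add hv.2⟩

lemma IsAdmissible.const_mul (hu : IsAdmissible Ω p u) (c : ℝ) :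
    IsAdmissible Ω p (fun x => c * u x) :=
  ⟨hu.1.const_mul c, hu.2.const_mul c⟩

lemma IsAdmissible.congr (hu : IsAdmissible Ω p u) (h : u =ᵐ[volume.restrict Ω] v) :
    IsAdmissible Ω p v :=
  ⟨hu.1.ae_eq h, hu.2.congr h⟩

/-- The area functional is convex. -/
lemma area_convex (hΩ : Bornology.IsBounded Ω) (hu : IsBV Ω u) (hv : IsBV Ω v) {s : ℝ}
    (hs : 0 ≤ s) (hs1 : s ≤ 1) :
    area Ω (fun x => (1 - s) * u x + s * v x) ≤ (1 - s) * area Ω u + s * area Ω v := by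
  refine area_le fun g₀ g h₀ hg hle => ?_
  have e : ∀ x, g₀ x + ((1 - s) * u x + s * v x) * divergence g x
      = (1 - s) * (g₀ x + u x * divergence g x) + s * (g₀ x + v x * divergence g x) := by
    intro x; ring
  simp only [e]
  have i1 : IntegrableOn (fun x => g₀ x + u x * divergence g x) Ω :=
    h₀.integrable.integrableOn.add (hg.integrableOn_mul_divergence hu.1)
  have i2 : IntegrableOn (fun x => g₀ x + v x * divergence g x) Ω :=
    h₀.integrable.integrableOn.add (hg.integrableOn_mul_divergence hv.1)
  rw [integral_add (i1.const_mul _) (i2.const_mul _), integral_const_mul, integral_const_mul]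
  gcongr
  · exact hu.le_area hΩ h₀ hg hle
  · exact hv.le_area hΩ h₀ hg hle

/-- Convexity on the segment from `u` to `u + t φ`, where `u + s φ` is the point with parameter `s /
t`. -/
lemma area_quotient_mono (hΩ : Bornology.IsBounded Ω) (hu : IsBV Ω u) (hφ : IsBV Ω φ) :
    MonotoneOn (fun t : ℝ => (area Ω (fun x => u x + t * φ x) - area Ω u) / t) (Set.Ioi 0) := by
  intro s hs t ht hst
  have hs' : 0 < s := hs
  have ht' : 0 < t := ht
  have h := area_convex hΩ hu (hu.add (hφ.const_mul t)) (s := s / t) (by positivity)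
    ((div_le_one ht').2 hst)
  have e : (fun x => (1 - s / t) * u x + s / t * (u x + t * φ x)) = fun x => u x + s * φ x := by
    funext x; field_simp; ring
  rw [e] at h
  change _ / s ≤ _ / t
  rw [div_le_div_iff₀ hs' ht']
  have h2 : (area Ω (fun x => u x + s * φ x) - area Ω u) * t
      ≤ (s / t * (area Ω (fun x => u x + t * φ x) - area Ω u)) * t := by
    gcongr; linarith
  refine h2.trans (le_of_eq ?_)
  field_simp

/-- A monotone quotient which is bounded below converges to its infimum as `t ↓ 0`; the minimality
of `u` supplies the bound `c`. -/
lemma exists_hasAreaDeriv (hΩ : Bornology.IsBounded Ω) (hu : IsBV Ω u) (hφ : IsBV Ω φ) {c : ℝ}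
    (hc : ∀ t : ℝ, 0 < t → t * c ≤ area Ω (fun x => u x + t * φ x) - area Ω u) :
    ∃ ℓ, HasAreaDeriv Ω u φ ℓ ∧ c ≤ ℓ := by
  have hc' : ∀ t ∈ Set.Ioi (0 : ℝ), c ≤ (area Ω (fun x => u x + t * φ x) - area Ω u) / t := by
    intro t ht
    rw [le_div_iff₀ ht, mul_comm]
    exact hc t ht
  have hlim := (area_quotient_mono hΩ hu hφ).tendsto_nhdsGT (x := 0) ⟨c, by
    rintro _ ⟨t, ht, rfl⟩
    exact hc' t ht⟩
  exact ⟨_, hlim, ge_of_tendsto hlim (eventually_nhdsWithin_of_forall hc')⟩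

lemma HasAreaDeriv.le (hΩ : Bornology.IsBounded Ω) (hu : IsBV Ω u) (hφ : IsBV Ω φ) {ℓ : ℝ}
    (h : HasAreaDeriv Ω u φ ℓ) : ℓ ≤ area Ω (fun x => u x + φ x) - area Ω u := by
  refine le_of_tendsto h ?_
  filter_upwards [Ioo_mem_nhdsGT (zero_lt_one (α := ℝ))] with t ht
  have := area_quotient_mono hΩ hu hφ (Set.mem_Ioi.2 ht.1) (Set.mem_Ioi.2 one_pos) ht.2.le
  simpa using this

/-- Product rule: `η div g = div (η g) - ∇η · g`, and `|g| ≤ 1`. It moves a cut-off from the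
function onto the test field. -/
lemma integral_mul_smul_divergence {η : EuclideanSpace ℝ (Fin n) → ℝ} (hη : IsTest Ω η)
    {g : EuclideanSpace ℝ (Fin n) → EuclideanSpace ℝ (Fin n)} (hg : IsTest Ω g)
    (hle : ∀ x, ‖g x‖ ≤ 1) (hv : IntegrableOn v Ω) :
    ∫ x in Ω, η x * v x * divergence g x ≤
      (∫ x in Ω, v x * divergence (fun y => η y • g y) x)
        + ∫ x in Ω, |v x| * ‖fderiv ℝ η x‖ := by
  obtain ⟨C, hC⟩ := (hη.1.continuous_fderiv (by norm_num)).bounded_above_of_compact_support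
    (hη.2.1.fderiv ℝ)
  obtain ⟨C', hC'⟩ := hη.exists_bound
  have i1 := (hη.smul hg.1).integrableOn_mul_divergence hv
  have i2 : IntegrableOn (fun x => |v x| * ‖fderiv ℝ η x‖) Ω :=
    Integrable.mul_bdd (c := C) hv.abs
      (hη.1.continuous_fderiv (by norm_num)).norm.aestronglyMeasurable
      (Eventually.of_forall fun x => by simpa using hC x)
  rw [← integral_add i1 i2]
  refine integral_mono ?_ (i1.add i2) fun x => ?_
  · have : IntegrableOn (fun x => η x * (v x * divergence g x)) Ω :=
      Integrable.bdd_mul (c := C') (hg.integrableOn_mul_divergence hv)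
        hη.continuous.aestronglyMeasurable (Eventually.of_forall hC')
    simpa only [mul_assoc, IntegrableOn] using this
  · simp only
    rw [divergence_smul hη.1 hg.1]
    have h1 : |fderiv ℝ η x (g x)| ≤ ‖fderiv ℝ η x‖ :=
      ((fderiv ℝ η x).le_opNorm _).trans (mul_le_of_le_one_right (norm_nonneg _) (hle x))
    have h2 : -(v x * fderiv ℝ η x (g x)) ≤ |v x| * ‖fderiv ℝ η x‖ := by
      refine (neg_le_abs _).trans ?_
      rw [abs_mul]
      gcongr
    linarith

lemma norm_smul_le_of_mem_Icc {a : ℝ} (ha : a ∈ Set.Icc (0 : ℝ) 1)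
    (y : EuclideanSpace ℝ (Fin n)) : ‖a • y‖ ≤ ‖y‖ := by
  rw [norm_smul, Real.norm_of_nonneg ha.1]
  exact mul_le_of_le_one_left (norm_nonneg _) ha.2

/-- Multiplying by a cut-off function `η` increases the area by at most `∫_Ω |v| |∇η|`. -/
lemma area_cutoff_le (hΩ : Bornology.IsBounded Ω) (hv : IsBV Ω v)
    {η : EuclideanSpace ℝ (Fin n) → ℝ} (hη : IsTest Ω η) (h01 : ∀ x, η x ∈ Set.Icc (0 : ℝ) 1) :
    area Ω (fun x => η x * v x) ≤ area Ω v + ∫ x in Ω, |v x| * ‖fderiv ℝ η x‖ := by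
  obtain ⟨C', hC'⟩ := hη.exists_bound
  have hi : IntegrableOn (fun x => η x * v x) Ω :=
    Integrable.bdd_mul (c := C') hv.1 hη.continuous.aestronglyMeasurable (Eventually.of_forall hC')
  refine area_le fun g₀ g h₀ hg hle => ?_
  rw [integral_add_mul_divergence h₀ hg hi]
  have hle' : ∀ x, ‖g x‖ ≤ 1 := fun x => (norm_le_one_of_sq_add_sq_le (norm_nonneg _) (hle x)).2
  have h1 := integral_mul_smul_divergence hη hg hle' hv.1
  -- The pair `(g₀, η g)` is again admissible since `0 ≤ η ≤ 1`; `g₀` is left untouched, so its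
  -- integral is the same on both sides.
  have h2 := hv.le_area hΩ h₀ (hη.smul hg.1) fun x => by
    have := norm_smul_le_of_mem_Icc (h01 x) (g x)
    have := pow_le_pow_left₀ (norm_nonneg _) this 2
    linarith [hle x]
  rw [integral_add_mul_divergence h₀ (hη.smul hg.1) hv.1] at h2
  linarith

lemma IsBV.cutoff (hv : IsBV Ω v)
    {η : EuclideanSpace ℝ (Fin n) → ℝ} (hη : IsTest Ω η) (h01 : ∀ x, η x ∈ Set.Icc (0 : ℝ) 1) :
    IsBV Ω (fun x => η x * v x) := by
  obtain ⟨C', hC'⟩ := hη.exists_bound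
  obtain ⟨M, hM⟩ := hv.2
  refine ⟨Integrable.bdd_mul (c := C') hv.1 hη.continuous.aestronglyMeasurable
    (Eventually.of_forall hC'), M + ∫ x in Ω, |v x| * ‖fderiv ℝ η x‖, ?_⟩
  rintro s ⟨g, hg, hle, rfl⟩
  refine (integral_mul_smul_divergence hη hg hle hv.1).trans ?_
  gcongr
  exact hM ⟨_, hη.smul hg.1, fun x => (norm_smul_le_of_mem_Icc (h01 x) _).trans (hle x), rfl⟩

lemma IsAdmissible.cutoff (hv : IsAdmissible Ω p v)
    {η : EuclideanSpace ℝ (Fin n) → ℝ} (hη : IsTest Ω η) (h01 : ∀ x, η x ∈ Set.Icc (0 : ℝ) 1) :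
    IsAdmissible Ω p (fun x => η x * v x) := by
  refine ⟨MemLp.of_le hv.1 (hη.continuous.aestronglyMeasurable.mul hv.1.1)
    (Eventually.of_forall fun x => ?_), hv.2.cutoff hη h01⟩
  rw [norm_mul, Real.norm_of_nonneg (h01 x).1]
  exact mul_le_of_le_one_left (norm_nonneg _) (h01 x).2

end Area

end MeanCurvature

namespace MeanCurvature

/-! ### The nonlinearity and the linearised functional -/

section Nonlinearity

variable {p : ℝ}

lemma abs_f (hp : 1 ≤ p) (s : ℝ) : |f p s| = |s| ^ p := by
  rcases eq_or_ne s 0 with rfl | hs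
  · simp [f, Real.zero_rpow (by linarith : p ≠ 0)]
  · have h : 0 < |s| := abs_pos.2 hs
    rw [f, abs_mul, abs_of_nonneg (Real.rpow_nonneg h.le _), ← Real.rpow_add_one h.ne']
    simp

lemma f_mul_self (hp : 1 ≤ p) (s : ℝ) : f p s * s = |s| ^ (p + 1) := by
  rcases eq_or_ne s 0 with rfl | hs
  · simp [f, Real.zero_rpow (by linarith : p + 1 ≠ 0)]
  · have h : 0 < |s| := abs_pos.2 hs
    have e : p + 1 = p - 1 + 1 + 1 := by ring
    rw [f, mul_assoc, ← abs_mul_abs_self s, e, Real.rpow_add_one h.ne', Real.rpow_add_one h.ne']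
    ring

/-- Young's inequality for the conjugate exponents `p + 1` and `(p + 1) / p`. It serves twice: for
the sign of `G` and for the integrability of `f(u) v`. -/
lemma rpow_mul_le (hp : 1 ≤ p) (s t : ℝ) :
    |s| ^ p * |t| ≤ p / (p + 1) * |s| ^ (p + 1) + |t| ^ (p + 1) / (p + 1) := by
  have hpos : 0 < p := by linarith
  have hc : (p + 1).HolderConjugate ((p + 1) / p) := by
    rw [Real.holderConjugate_iff]
    refine ⟨by linarith, ?_⟩
    field_simp
    ring
  have := Real.young_inequality_of_nonneg (abs_nonneg t) (Real.rpow_nonneg (abs_nonneg s) p) hc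
  rw [← Real.rpow_mul (abs_nonneg s), mul_div_cancel₀ _ hpos.ne'] at this
  calc |s| ^ p * |t| = |t| * |s| ^ p := mul_comm _ _
    _ ≤ _ := this
    _ = _ := by field_simp; ring

/-- Since `f(s) s = |s|^{p+1}`, the quantity `G` is exactly the defect in Young's inequality with
`|s|^p |t|` replaced by `f(s) t`, which is no larger. -/
lemma G_nonneg (hp : 1 ≤ p) (s t : ℝ) : 0 ≤ G p s t := by
  have hpos : 0 < p + 1 := by linarith
  have h1 := rpow_mul_le hp s t
  have h2 : f p s * t ≤ |s| ^ p * |t| := by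
    rw [← abs_f hp, ← abs_mul]; exact le_abs_self _
  have h3 := f_mul_self hp s
  have h4 : G p s t = |t| ^ (p + 1) / (p + 1) + p / (p + 1) * |s| ^ (p + 1) - f p s * t := by
    rw [G, F, F, mul_sub, h3]; field_simp; ring
  linarith

lemma measurable_f : Measurable (f p) := by
  unfold f; fun_prop

end Nonlinearity

variable {n : ℕ} {Ω : Set (EuclideanSpace ℝ (Fin n))} {H u v : EuclideanSpace ℝ (Fin n) → ℝ}
  {p lam : ℝ}

lemma IsAdmissible.integrable_rpow (hp : 1 ≤ p) (hu : IsAdmissible Ω p u) :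
    IntegrableOn (fun x => |u x| ^ (p + 1)) Ω := by
  have h := hu.1.integrable_norm_rpow (by simp; linarith) ENNReal.ofReal_ne_top
  rw [ENNReal.toReal_ofReal (by linarith)] at h
  exact h

lemma IsAdmissible.integrable_F (hp : 1 ≤ p) (hu : IsAdmissible Ω p u) :
    IntegrableOn (fun x => F p (u x)) Ω :=
  (hu.integrable_rpow hp).div_const _

lemma IsAdmissible.integrable_f_mul (hp : 1 ≤ p) (hu : IsAdmissible Ω p u)
    (hv : IsAdmissible Ω p v) : IntegrableOn (fun x => f p (u x) * v x) Ω := by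
  refine Integrable.mono' (((hu.integrable_rpow hp).const_mul (p / (p + 1))).add
    ((hv.integrable_rpow hp).div_const (p + 1)))
    ((measurable_f.comp_aemeasurable hu.1.1.aemeasurable).aestronglyMeasurable.mul hv.1.1)
    (Eventually.of_forall fun x => ?_)
  rw [Real.norm_eq_abs, abs_mul, abs_f hp]
  exact rpow_mul_le hp _ _

lemma IsBV.integrable_bounded_mul (hH : MemLp H ∞ (volume.restrict Ω)) (hv : IsBV Ω v) :
    IntegrableOn (fun x => H x * v x) Ω :=
  hH.integrable_mul (memLp_one_iff_integrable.2 hv.1)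

lemma IsAdmissible.integrable_source_mul (hp : 1 ≤ p) (hH : MemLp H ∞ (volume.restrict Ω))
    (hu : IsAdmissible Ω p u) (hv : IsAdmissible Ω p v) :
    IntegrableOn (fun x => (H x + lam * f p (u x)) * v x) Ω := by
  have := (hv.2.integrable_bounded_mul hH).add ((hu.integrable_f_mul hp hv).const_mul lam)
  refine this.congr (Eventually.of_forall fun x => ?_)
  simp only [Pi.add_apply]; ring

/-- The energy with the correction term `λ G(u, v)` is the linearised functional, up to a
constant which depends on `u` only. -/
lemma energy_add_integral_G (hp : 1 ≤ p) (hH : MemLp H ∞ (volume.restrict Ω))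
    (hu : IsAdmissible Ω p u) (hv : IsAdmissible Ω p v) :
    energy Ω H p lam v + ∫ x in Ω, lam * G p (u x) (v x)
      = area Ω v - (∫ x in Ω, (H x + lam * f p (u x)) * v x)
        + ∫ x in Ω, lam * (f p (u x) * u x - F p (u x)) := by
  have i1 : IntegrableOn (fun x => H x * v x + lam * F p (v x)) Ω :=
    (hv.2.integrable_bounded_mul hH).add ((hv.integrable_F hp).const_mul lam)
  have i2 : IntegrableOn (fun x => lam * (f p (u x) * u x - F p (u x))) Ω :=
    ((hu.integrable_f_mul hp hu).sub (hu.integrable_F hp)).const_mul lam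
  have i3 : IntegrableOn (fun x => (H x + lam * f p (u x)) * v x) Ω :=
    hu.integrable_source_mul hp hH hv
  have e : ∀ x, lam * G p (u x) (v x) = (H x * v x + lam * F p (v x))
      - (H x + lam * f p (u x)) * v x + lam * (f p (u x) * u x - F p (u x)) := by
    intro x; rw [G]; ring
  simp only [e]
  have h1 := integral_add (i1.sub i3) i2
  have h2 := integral_sub i1 i3
  simp only [Pi.sub_apply] at h1 h2
  rw [h1, h2, energy]
  ring

lemma energy_self (hp : 1 ≤ p) (hH : MemLp H ∞ (volume.restrict Ω)) (hu : IsAdmissible Ω p u) :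
    energy Ω H p lam u = area Ω u - (∫ x in Ω, (H x + lam * f p (u x)) * u x)
        + ∫ x in Ω, lam * (f p (u x) * u x - F p (u x)) := by
  rw [← energy_add_integral_G hp hH hu hu]
  simp [G]

end MeanCurvature

namespace MeanCurvature

variable {n : ℕ}

/-! ### Duality of `L¹` with smooth test functions -/

section Duality

open scoped Convolution

/-- Mollification of a function which is bounded by one and vanishes off a compact subset of an
open set yields admissible test functions. -/
lemma isTest_convolution_bump {U K : Set (EuclideanSpace ℝ (Fin n))} {ε : ℝ}
    (hKU : Metric.cthickening ε K ⊆ U) (hK : IsCompact K)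
    (φ : ContDiffBump (0 : EuclideanSpace ℝ (Fin n)))
    (hφ : φ.rOut ≤ ε) {s : EuclideanSpace ℝ (Fin n) → ℝ} (hs : Integrable s)
    (hsK : Function.support s ⊆ K) (hs1 : ∀ x, |s x| ≤ 1) :
    IsTest U (φ.normed volume ⋆[ContinuousLinearMap.lsmul ℝ ℝ, volume] s) ∧
      ∀ x, |(φ.normed volume ⋆[ContinuousLinearMap.lsmul ℝ ℝ, volume] s) x| ≤ 1 := by
  have hsub : tsupport (φ.normed volume ⋆[ContinuousLinearMap.lsmul ℝ ℝ, volume] s)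
      ⊆ Metric.cthickening ε K := by
    refine closure_minimal ((support_convolution_subset _).trans ?_) Metric.isClosed_cthickening
    rintro _ ⟨a, ha, b, hb, rfl⟩
    rw [φ.support_normed_eq, mem_ball_zero_iff] at ha
    refine Metric.mem_cthickening_of_dist_le _ b _ _ (hsK hb) ?_
    rw [dist_eq_norm, add_sub_cancel_right]
    exact ha.le.trans hφ
  refine ⟨⟨?_, ?_, hsub.trans hKU⟩, fun x => ?_⟩
  · exact (φ.hasCompactSupport_normed (μ := volume)).contDiff_convolution_left _ φ.contDiff_normed
      hs.locallyIntegrable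
  · exact HasCompactSupport.of_support_subset_isCompact (hK.cthickening)
      (subset_closure.trans hsub)
  · rw [convolution_def]
    calc |∫ t, (ContinuousLinearMap.lsmul ℝ ℝ) (φ.normed volume t) (s (x - t))|
        ≤ ∫ t, φ.normed volume t := by
          rw [← Real.norm_eq_abs]
          refine norm_integral_le_of_norm_le (φ.integrable_normed (μ := volume))
            (Eventually.of_forall fun t => ?_)
          simp only [ContinuousLinearMap.lsmul_apply, smul_eq_mul, norm_mul]
          rw [Real.norm_of_nonneg (φ.nonneg_normed t)]
          exact mul_le_of_le_one_right (φ.nonneg_normed t) (hs1 _)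
      _ = 1 := φ.integral_normed

/-- Test with mollifications of the sign of `w` on `K`. They are admissible, bounded by one and
converge a.e., so `∫_K |w|` is a limit of admissible integrals by domination with `|w|`. -/
lemma setIntegral_abs_le_of_isCompact {U K : Set (EuclideanSpace ℝ (Fin n))} (hU : IsOpen U)
    (hK : IsCompact K) (hKU : K ⊆ U) {w : EuclideanSpace ℝ (Fin n) → ℝ} (hw : IntegrableOn w U)
    {C : ℝ} (h : ∀ φ : EuclideanSpace ℝ (Fin n) → ℝ, IsTest U φ → (∀ x, |φ x| ≤ 1) →
      ∫ x in U, w x * φ x ≤ C) : ∫ x in K, |w x| ≤ C := by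
  obtain ⟨ε, hε, hεU⟩ := hK.exists_cthickening_subset_open hU hKU
  -- A measurable representative, so that its sign is measurable.
  set g := hw.1.mk w with hg
  have hgw : w =ᵐ[volume.restrict U] g := hw.1.ae_eq_mk
  have hgm : StronglyMeasurable g := hw.1.stronglyMeasurable_mk
  set s : EuclideanSpace ℝ (Fin n) → ℝ := K.indicator (fun x => if 0 ≤ g x then 1 else -1)
    with hs
  have hsm : Measurable s :=
    (Measurable.ite (measurableSet_le measurable_const hgm.measurable) measurable_const
      measurable_const).indicator hK.measurableSet
  have hs1 : ∀ x, |s x| ≤ 1 := by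
    intro x
    by_cases hx : x ∈ K
    · by_cases h0 : 0 ≤ g x <;> simp [hs, hx, h0]
    · simp [hs, hx]
  have hsK : Function.support s ⊆ K := Set.support_indicator_subset
  have hsi : Integrable s := by
    refine (integrable_indicator_iff hK.measurableSet).2 ?_
    refine Measure.integrableOn_of_bounded (M := 1) hK.measure_lt_top.ne ?_ ?_
    · exact (Measurable.ite (measurableSet_le measurable_const hgm.measurable) measurable_const
        measurable_const).aestronglyMeasurable
    · refine Eventually.of_forall fun x => ?_
      by_cases h0 : 0 ≤ g x <;> simp [h0]
  -- The a.e. convergence of mollifications requires a bounded ratio of outer to inner radius, here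
  -- `2`; the shift `k + 2` keeps the outer radius at most `ε` from `k = 0` on.
  let φ : ℕ → ContDiffBump (0 : EuclideanSpace ℝ (Fin n)) := fun k =>
    ⟨ε / (k + 2), 2 * (ε / (k + 2)), by positivity, by
      have : 0 < ε / ((k : ℝ) + 2) := by positivity
      linarith⟩
  have hφ0 : Tendsto (fun k => (φ k).rOut) atTop (𝓝 0) := by
    have h1 : Tendsto (fun k : ℕ => (k : ℝ) + 2) atTop atTop :=
      tendsto_atTop_add_const_right _ _ tendsto_natCast_atTop_atTop
    simpa using (h1.const_div_atTop ε).const_mul 2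
  have hφε : ∀ k, (φ k).rOut ≤ ε := by
    intro k
    change 2 * (ε / ((k : ℝ) + 2)) ≤ ε
    have : (0 : ℝ) ≤ k := k.cast_nonneg
    rw [← mul_div_assoc, div_le_iff₀ (by positivity)]
    nlinarith
  have hconv := ContDiffBump.ae_convolution_tendsto_right_of_locallyIntegrable (μ := volume)
    (φ := φ) (l := atTop) (K := 2) hφ0 (Eventually.of_forall fun k => le_rfl)
    hsi.locallyIntegrable
  have hlim : Tendsto (fun k => ∫ x in U, w x *
      ((φ k).normed volume ⋆[ContinuousLinearMap.lsmul ℝ ℝ, volume] s) x) atTop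
      (𝓝 (∫ x in U, w x * s x)) := by
    refine tendsto_integral_of_dominated_convergence (fun x => |w x|) (fun k => ?_) hw.abs
      (fun k => Eventually.of_forall fun x => ?_) ?_
    · exact hw.1.mul (isTest_convolution_bump hεU hK (φ k) (hφε k) hsi hsK
        hs1).1.continuous.aestronglyMeasurable
    · rw [norm_mul]
      exact mul_le_of_le_one_right (norm_nonneg _)
        ((isTest_convolution_bump hεU hK (φ k) (hφε k) hsi hsK hs1).2 x)
    · filter_upwards [ae_restrict_of_ae hconv] with x hx
      exact hx.const_mul (w x)
  have hle : ∫ x in U, w x * s x ≤ C := le_of_tendsto' hlim fun k =>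
    h _ (isTest_convolution_bump hεU hK (φ k) (hφε k) hsi hsK hs1).1
      (isTest_convolution_bump hεU hK (φ k) (hφε k) hsi hsK hs1).2
  refine le_trans (le_of_eq ?_) hle
  have e1 : ∀ᵐ x ∂(volume.restrict U), w x * s x = K.indicator (fun x => |w x|) x := by
    filter_upwards [hgw] with x hx
    by_cases hxK : x ∈ K
    · by_cases h0 : 0 ≤ g x
      · simp [hs, hxK, h0, hx, abs_of_nonneg h0]
      · simp [hs, hxK, h0, hx, abs_of_neg (not_le.1 h0)]
    · simp [hs, hxK]
  rw [integral_congr_ae e1, setIntegral_indicator hK.measurableSet, Set.inter_eq_right.2 hKU]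

/-- The `L¹` norm on an open set is attained by duality with test functions. -/
lemma setIntegral_abs_le_of_isTest {U : Set (EuclideanSpace ℝ (Fin n))} (hU : IsOpen U)
    {w : EuclideanSpace ℝ (Fin n) → ℝ} (hw : IntegrableOn w U)
    {C : ℝ} (h : ∀ φ : EuclideanSpace ℝ (Fin n) → ℝ, IsTest U φ → (∀ x, |φ x| ≤ 1) →
      ∫ x in U, w x * φ x ≤ C) : ∫ x in U, |w x| ≤ C := by
  obtain ⟨A, hA, hAU, hAe, hAm⟩ := hU.exists_iUnion_isClosed
  let K : ℕ → Set (EuclideanSpace ℝ (Fin n)) := fun k => A k ∩ Metric.closedBall 0 k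
  have hK : ∀ k, IsCompact (K k) := fun k => (isCompact_closedBall _ _).inter_left (hA k)
  have hKU : ⋃ k, K k = U := by
    refine Set.Subset.antisymm (Set.iUnion_subset fun k => Set.inter_subset_left.trans (hAU k)) ?_
    intro x hx
    rw [← hAe] at hx
    obtain ⟨i, hi⟩ := Set.mem_iUnion.1 hx
    obtain ⟨j, hj⟩ := exists_nat_ge ‖x‖
    refine Set.mem_iUnion.2 ⟨max i j, hAm (le_max_left _ _) hi, ?_⟩
    rw [mem_closedBall_zero_iff]
    exact hj.trans (by exact_mod_cast le_max_right i j)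
  have hKm : Monotone K := fun i j hij =>
    Set.inter_subset_inter (hAm hij) (Metric.closedBall_subset_closedBall (by exact_mod_cast hij))
  have hlim := tendsto_setIntegral_of_monotone (μ := volume) (f := fun x => |w x|)
    (fun k => (hK k).measurableSet) hKm (by rw [hKU]; exact hw.abs)
  rw [hKU] at hlim
  exact le_of_tendsto' hlim fun k => setIntegral_abs_le_of_isCompact hU (hK k)
    (Set.inter_subset_left.trans (hAU k)) hw h

end Duality

/-! ### Difference quotients of `BV` functions -/

section Translation

variable {Ω U : Set (EuclideanSpace ℝ (Fin n))} {v : EuclideanSpace ℝ (Fin n) → ℝ}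

lemma IsTest.translate {φ : EuclideanSpace ℝ (Fin n) → ℝ} (hφ : IsTest U φ)
    (y : EuclideanSpace ℝ (Fin n)) (hy : ∀ x ∈ U, x + y ∈ Ω) :
    IsTest Ω (fun x => φ (x - y)) := by
  have hts : tsupport (fun x => φ (x - y)) = (fun x => x - y) ⁻¹' tsupport φ := by
    have := tsupport_comp_eq_preimage φ (Homeomorph.subRight y)
    exact this
  refine ⟨hφ.1.comp (contDiff_id.sub contDiff_const), ?_, ?_⟩
  · exact hφ.2.1.comp_homeomorph (Homeomorph.subRight y)
  · rw [hts]
    intro x hx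
    simpa using hy _ (hφ.2.2 hx)

lemma fderiv_comp_sub_const (φ : EuclideanSpace ℝ (Fin n) → ℝ) (y x : EuclideanSpace ℝ (Fin n)) :
    fderiv ℝ (fun x => φ (x - y)) x = fderiv ℝ φ (x - y) := by
  simpa using fderiv_comp_sub (𝕜 := ℝ) (f := φ) (x := x) y

lemma IsTest.smul_const {φ : EuclideanSpace ℝ (Fin n) → ℝ} (hφ : IsTest U φ)
    (e : EuclideanSpace ℝ (Fin n)) : IsTest U (fun x => φ x • e) :=
  hφ.smul contDiff_const

/-- Difference quotients of a `BV` function in the direction of a unit vector are bounded by its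
total variation. -/
lemma setIntegral_abs_translate_sub_le (hU : IsOpen U)
    (hv : Integrable v) {M : ℝ}
    (hM : ∀ g : EuclideanSpace ℝ (Fin n) → EuclideanSpace ℝ (Fin n), IsTest Ω g →
      (∀ x, ‖g x‖ ≤ 1) → |∫ x in Ω, v x * divergence g x| ≤ M)
    {e : EuclideanSpace ℝ (Fin n)} (he : ‖e‖ = 1) {h : ℝ} (hh : 0 ≤ h)
    (hUΩ : ∀ x ∈ U, ∀ s ∈ Set.Icc 0 h, x + s • e ∈ Ω) :
    ∫ x in U, |v (x + h • e) - v x| ≤ M * h := by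
  have hvt : Integrable (fun x => v (x + h • e)) := hv.comp_add_right (h • e)
  refine setIntegral_abs_le_of_isTest hU (w := fun x => v (x + h • e) - v x)
    (hvt.sub hv).integrableOn fun φ hφ hφ1 => ?_
  obtain ⟨C, hC⟩ := hφ.exists_bound
  obtain ⟨C', hC'⟩ := (hφ.1.continuous_fderiv (by norm_num)).bounded_above_of_compact_support
    (hφ.2.1.fderiv ℝ)
  have hcont : ∀ s : ℝ, Continuous fun x => φ (x - s • e) := fun s =>
    hφ.continuous.comp (continuous_id.sub continuous_const)
  have hi : ∀ s : ℝ, Integrable fun x => v x * φ (x - s • e) := fun s =>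
    hv.mul_bdd (hcont s).aestronglyMeasurable (Eventually.of_forall fun x => hC _)
  -- The pairing of `v` with the translated test function. Its derivative is minus the pairing of
  -- `v` with the divergence of `φ(· - s e) e`. That field is a test field in `Ω` for `0 ≤ s ≤ h`,
  -- so `|Θ'| ≤ M` and the mean value inequality gives `|Θ h - Θ 0| ≤ M h`.
  let Θ : ℝ → ℝ := fun s => ∫ x, v x * φ (x - s • e)
  have hφd : ∀ x (s : ℝ), HasDerivAt (fun s : ℝ => φ (x - s • e))
      (-(fderiv ℝ φ (x - s • e) e)) s := by
    intro x s
    have h1 : HasDerivAt (fun s : ℝ => x - s • e) (-((1 : ℝ) • e)) s :=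
      ((hasDerivAt_id s).smul_const e).const_sub x
    have h2 := (hφ.1.differentiable (by norm_num) (x - s • e)).hasFDerivAt.comp_hasDerivAt s h1
    have h3 : fderiv ℝ φ (x - s • e) (-((1 : ℝ) • e)) = -(fderiv ℝ φ (x - s • e) e) := by simp
    rw [h3] at h2
    exact h2
  have hΘ : ∀ s : ℝ, HasDerivAt Θ (∫ x, v x * -(fderiv ℝ φ (x - s • e) e)) s := by
    intro s
    refine (hasDerivAt_integral_of_dominated_loc_of_deriv_le (μ := volume)
      (F := fun s x => v x * φ (x - s • e))
      (F' := fun s x => v x * -(fderiv ℝ φ (x - s • e) e)) (s := Set.univ) (bound := fun x => |v x| * C') univ_mem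
      (Eventually.of_forall fun s => (hi s).1) (hi s) ?_ ?_ (hv.abs.mul_const C') ?_).2
    · refine hv.1.mul (Continuous.aestronglyMeasurable ?_)
      exact ((((hφ.1.continuous_fderiv (by norm_num)).comp
        (continuous_id.sub continuous_const)).clm_apply continuous_const).neg)
    · refine Eventually.of_forall fun x t _ => ?_
      rw [norm_mul, norm_neg]
      have h3 := (fderiv ℝ φ (x - t • e)).le_opNorm e
      rw [he, mul_one] at h3
      exact mul_le_mul_of_nonneg_left (h3.trans (hC' _)) (norm_nonneg _)
    · exact Eventually.of_forall fun x t _ => (hφd x t).const_mul _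
  have hbound : ∀ s ∈ Set.Ico (0 : ℝ) h, ‖∫ x, v x * -(fderiv ℝ φ (x - s • e) e)‖ ≤ M := by
    intro s hs
    have ht : IsTest Ω (fun x => φ (x - s • e)) :=
      hφ.translate _ fun x hx => hUΩ x hx s ⟨hs.1, hs.2.le⟩
    have h1 := hM _ (ht.smul_const e) fun x => by
      rw [norm_smul, he, mul_one]; exact hφ1 _
    have h2 : ∀ x, divergence (fun y => φ (y - s • e) • e) x = fderiv ℝ φ (x - s • e) e := by
      intro x
      rw [divergence_smul_const ht.1, fderiv_comp_sub_const]
    simp only [h2] at h1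
    have h3 : ∫ x in Ω, v x * fderiv ℝ φ (x - s • e) e
        = ∫ x, v x * fderiv ℝ φ (x - s • e) e := by
      refine setIntegral_eq_integral_of_forall_compl_eq_zero fun x hx => ?_
      rw [← h2, divergence_eq_zero fun hx' => hx ((ht.smul_const e).2.2 hx'), mul_zero]
    simp only [mul_neg, integral_neg, norm_neg, Real.norm_eq_abs]
    rwa [← h3]
  have hmv := norm_image_sub_le_of_norm_deriv_le_segment' (f := Θ)
    (fun s _ => (hΘ s).hasDerivWithinAt) hbound h (Set.right_mem_Icc.2 hh)
  have e1 : ∫ x in U, (v (x + h • e) - v x) * φ x = ∫ x, (v (x + h • e) - v x) * φ x :=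
    setIntegral_eq_integral_of_forall_compl_eq_zero fun x hx => by
      rw [image_eq_zero_of_notMem_tsupport fun hx' => hx (hφ.2.2 hx'), mul_zero]
  have e2 : ∫ x, v (x + h • e) * φ x = Θ h := by
    have := integral_add_right_eq_self (μ := volume) (fun x => v x * φ (x - h • e)) (h • e)
    simpa using this
  have e3 : ∫ x, v x * φ x = Θ 0 := by simp [Θ]
  rw [e1]
  simp only [sub_mul]
  rw [integral_sub, e2, e3]
  · refine (le_abs_self _).trans ?_
    simpa using hmv
  · exact hvt.mul_bdd hφ.continuous.aestronglyMeasurable (Eventually.of_forall hC)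
  · exact hv.mul_bdd hφ.continuous.aestronglyMeasurable (Eventually.of_forall hC)

end Translation

end MeanCurvature

namespace MeanCurvature

/-! ### Functions of one variable: essential limits at an endpoint -/

section Slices

/-- Convergence along this filter is the essential limit from the right. It is nontrivial because
every interval `(0, ε)` has positive measure; inequalities can thus be passed to essential limits.
-/
instance neBot_nhdsGT_inf_ae : (𝓝[>] (0 : ℝ) ⊓ ae volume).NeBot := by
  refine inf_neBot_iff.2 fun {s} hs {t} ht => ?_
  obtain ⟨ε, hε, hsub⟩ := mem_nhdsGT_iff_exists_Ioo_subset.1 hs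
  have hne : volume (Set.Ioo 0 ε ∩ t) ≠ 0 := by
    rw [measure_inter_conull (mem_ae_iff.1 ht)]
    simpa using hε
  obtain ⟨x, hx⟩ := nonempty_of_measure_ne_zero hne
  exact ⟨x, hsub hx.1, hx.2⟩

lemma sum_lintegral_Ioc_le (g : ℝ → ℝ≥0∞) {u : ℕ → ℝ} (hu : Monotone u) (N : ℕ) :
    ∑ i ∈ Finset.range N, ∫⁻ x in Set.Ioc (u i) (u (i + 1)), g x
      ≤ ∫⁻ x in Set.Ioc (u 0) (u N), g x := by
  induction N with
  | zero => simp
  | succ N ih =>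
    rw [Finset.sum_range_succ]
    refine (add_le_add_left ih _).trans (le_of_eq ?_)
    rw [← Set.Ioc_union_Ioc_eq_Ioc (hu (Nat.zero_le N)) (hu (Nat.le_succ N)),
      lintegral_union measurableSet_Ioc]
    exact Set.Ioc_disjoint_Ioc_of_le le_rfl

/-- The difference quotients over the step `1 / (k + 1)`, in `L¹(0, δ)`. -/
noncomputable def quotientNorm (δ : ℝ) (w : ℝ → ℝ) (k : ℕ) : ℝ≥0∞ :=
  ∫⁻ s in Set.Ioo 0 δ, ‖((k : ℝ) + 1) * (w (s + 1 / ((k : ℝ) + 1)) - w s)‖ₑ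

/-- With step `h`, the integral over `(τ, τ + h)` minus that over `(σ, σ + h)` equals `∫_σ^τ (w(s +
h) - w(s)) ds`: increments of forward averages are integrals of difference quotients. -/
lemma edist_average_le {w : ℝ → ℝ} (hw : Integrable w) (k : ℕ) {σ τ : ℝ} (hστ : σ ≤ τ) :
    edist (((k : ℝ) + 1) * ∫ x in τ..(τ + 1 / ((k : ℝ) + 1)), w x)
      (((k : ℝ) + 1) * ∫ x in σ..(σ + 1 / ((k : ℝ) + 1)), w x)
      ≤ ∫⁻ s in Set.Ioc σ τ, ‖((k : ℝ) + 1) * (w (s + 1 / ((k : ℝ) + 1)) - w s)‖ₑ := by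
  set h : ℝ := 1 / ((k : ℝ) + 1)
  have hi : ∀ a b : ℝ, IntervalIntegrable w volume a b := fun a b => hw.intervalIntegrable
  have h1 : (∫ x in τ..(τ + h), w x) - ∫ x in σ..(σ + h), w x
      = ∫ s in σ..τ, (w (s + h) - w s) := by
    have e1 : ∫ s in σ..τ, w (s + h) = ∫ s in (σ + h)..(τ + h), w s :=
      intervalIntegral.integral_comp_add_right _ _
    rw [intervalIntegral.integral_sub (hw.comp_add_right h).intervalIntegrable (hi _ _), e1]
    have e2 := intervalIntegral.integral_add_adjacent_intervals (hi σ τ) (hi τ (τ + h))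
    have e3 := intervalIntegral.integral_add_adjacent_intervals (hi σ (σ + h)) (hi (σ + h) (τ + h))
    linarith
  rw [edist_eq_enorm_sub, ← mul_sub, h1, ← intervalIntegral.integral_const_mul,
    intervalIntegral.integral_of_le hστ]
  exact enorm_integral_le_lintegral_enorm _

lemma tendsto_average {w : ℝ → ℝ} (hw : Integrable w) {σ : ℝ}
    (hσ : HasDerivAt (fun x => ∫ t in (0 : ℝ)..x, w t) (w σ) σ) :
    Tendsto (fun k : ℕ => ((k : ℝ) + 1) * ∫ x in σ..(σ + 1 / ((k : ℝ) + 1)), w x) atTop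
      (𝓝 (w σ)) := by
  have h0 : Tendsto (fun k : ℕ => 1 / ((k : ℝ) + 1)) atTop (𝓝[≠] 0) :=
    tendsto_nhdsWithin_iff.2 ⟨tendsto_one_div_add_atTop_nhds_zero_nat,
      Eventually.of_forall fun k => by
        simp only [Set.mem_compl_iff, Set.mem_singleton_iff]; positivity⟩
  refine (hσ.tendsto_slope_zero.comp h0).congr fun k => ?_
  have hi : ∀ a b : ℝ, IntervalIntegrable w volume a b := fun a b => hw.intervalIntegrable
  have e2 := intervalIntegral.integral_interval_sub_left (hi 0 (σ + 1 / ((k : ℝ) + 1))) (hi 0 σ)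
  simp only [Function.comp, e2]
  simp

/-- On its Lebesgue points, an integrable function whose difference quotients are bounded in
`L¹(0, δ)` has bounded variation. -/
lemma eVariationOn_le_liminf {w : ℝ → ℝ} (hw : Integrable w) {δ : ℝ} :
    eVariationOn w {σ | σ ∈ Set.Ioo 0 δ ∧
        HasDerivAt (fun x => ∫ t in (0 : ℝ)..x, w t) (w σ) σ}
      ≤ liminf (quotientNorm δ w) atTop := by
  refine iSup_le ?_
  rintro ⟨N, u, hu, huG⟩
  -- For a fixed chain of points, the forward averages at scale `1 / (k + 1)` tend to the values of
  -- `w`. The corresponding sums for the averages are bounded by `quotientNorm δ w k`, as the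
  -- intervals between consecutive points are disjoint and lie in `(0, δ)`.
  have hlim : Tendsto (fun k : ℕ => ∑ i ∈ Finset.range N,
      edist (((k : ℝ) + 1) * ∫ x in u (i + 1)..(u (i + 1) + 1 / ((k : ℝ) + 1)), w x)
        (((k : ℝ) + 1) * ∫ x in u i..(u i + 1 / ((k : ℝ) + 1)), w x)) atTop
      (𝓝 (∑ i ∈ Finset.range N, edist (w (u (i + 1))) (w (u i)))) :=
    tendsto_finsetSum _ fun i _ =>
      (tendsto_average hw (huG (i + 1)).2).edist (tendsto_average hw (huG i).2)
  rw [← hlim.liminf_eq]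
  refine liminf_le_liminf (Eventually.of_forall fun k => ?_)
  refine (Finset.sum_le_sum fun i _ => edist_average_le hw k (hu (Nat.le_succ i))).trans ?_
  refine (sum_lintegral_Ioc_le _ hu N).trans (lintegral_mono_set fun x hx => ?_)
  exact ⟨(huG 0).1.1.trans hx.1, hx.2.trans_lt (huG N).1.2⟩

/-- An integrable function of one variable with `L¹`-bounded difference quotients on `(0, δ)` has
an essential limit at `0`, and stays close to it. -/
lemma exists_essLimit {w : ℝ → ℝ} (hw : Integrable w) {δ : ℝ} (hδ : 0 < δ)
    (hV : liminf (quotientNorm δ w) atTop ≠ ∞) :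
    ∃ c, Tendsto w (𝓝[>] 0 ⊓ ae volume) (𝓝 c) ∧
      ∀ᵐ τ ∂(volume.restrict (Set.Ioo 0 δ)),
        ‖w τ - c‖ₑ ≤ liminf (quotientNorm δ w) atTop := by
  set A : Set ℝ := {σ | σ ∈ Set.Ioo 0 δ ∧
    HasDerivAt (fun x => ∫ t in (0 : ℝ)..x, w t) (w σ) σ} with hA
  have hvar := eVariationOn_le_liminf hw (δ := δ)
  have hd : ∀ᵐ τ : ℝ, HasDerivAt (fun x => ∫ t in (0 : ℝ)..x, w t) (w τ) τ := by
    filter_upwards [LocallyIntegrable.ae_hasDerivAt_integral hw.locallyIntegrable] with τ hτ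
    exact hτ 0
  obtain ⟨c, hc⟩ := BoundedVariationOn.exists_tendsto_right
    (s := A) (ne_top_of_le_ne_top hV hvar) 0
  -- The set `A` has full measure in `(0, δ)`, so a limit along `A` is an essential limit. The bound
  -- then follows by letting `σ ↓ 0` in `|w τ - w σ| ≤` variation of `w` on `A`.
  have hle : 𝓝[>] (0 : ℝ) ⊓ ae volume ≤ 𝓝[A ∩ Set.Ioi 0] 0 := by
    refine le_inf (inf_le_left.trans inf_le_left) (le_principal_iff.2 ?_)
    refine mem_inf_of_inter (Ioo_mem_nhdsGT hδ) hd fun x hx => ⟨⟨hx.1, hx.2⟩, hx.1.1⟩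
  refine ⟨c, hc.mono_left hle, ?_⟩
  filter_upwards [ae_restrict_of_ae hd, ae_restrict_mem measurableSet_Ioo] with τ hτ hτm
  have h1 : Tendsto (fun σ => edist (w τ) (w σ)) (𝓝[>] 0 ⊓ ae volume) (𝓝 (edist (w τ) c)) :=
    tendsto_const_nhds.edist (hc.mono_left hle)
  rw [← edist_eq_enorm_sub]
  refine le_of_tendsto h1 ?_
  have hmem : A ∩ Set.Ioi 0 ∈ 𝓝[>] (0 : ℝ) ⊓ ae volume := hle self_mem_nhdsWithin
  filter_upwards [hmem] with σ hσ
  have hτA : τ ∈ A := ⟨hτm, hτ⟩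
  exact (eVariationOn.edist_le w hτA hσ.1).trans hvar

end Slices

end MeanCurvature

/-! ### Coordinates adapted to a graph -/

namespace MeanCurvature

/-- The graph of a `C¹` function `ψ` over the hyperplane orthogonal to a unit vector `e`, the
hyperplane being identified with `ℝᵐ` through the isometry `J`. -/
structure GraphFrame (m : ℕ) where
  J : EuclideanSpace ℝ (Fin m) →ₗᵢ[ℝ] EuclideanSpace ℝ (Fin (m + 1))
  e : EuclideanSpace ℝ (Fin (m + 1))
  norm_e : ‖e‖ = 1
  inner_J : ∀ w, inner ℝ (J w) e = 0
  ψ : EuclideanSpace ℝ (Fin m) → ℝ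
  contDiff_ψ : ContDiff ℝ 1 ψ

lemma exists_isometry_orthogonal {m : ℕ} {e : EuclideanSpace ℝ (Fin (m + 1))} (he : ‖e‖ = 1) :
    ∃ J : EuclideanSpace ℝ (Fin m) →ₗᵢ[ℝ] EuclideanSpace ℝ (Fin (m + 1)),
      ∀ w, inner ℝ (J w) e = 0 := by
  have : Fact (Module.finrank ℝ (EuclideanSpace ℝ (Fin (m + 1))) = m + 1) := ⟨by simp⟩
  have he0 : e ≠ 0 := by
    rintro rfl
    simp at he
  let b := OrthonormalBasis.fromOrthogonalSpanSingleton (𝕜 := ℝ) m he0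
  refine ⟨(Submodule.subtypeₗᵢ _).comp b.repr.symm.toLinearIsometry, fun w => ?_⟩
  rw [real_inner_comm]
  exact (Submodule.mem_orthogonal_singleton_iff_inner_right).1 (b.repr.symm w).2

namespace GraphFrame

variable {m : ℕ} (c : GraphFrame m)

/-- The point at height `τ` above the point of the graph with base `w`. -/
noncomputable def point (w : EuclideanSpace ℝ (Fin m)) (τ : ℝ) : EuclideanSpace ℝ (Fin (m + 1)) :=
  c.J w + (c.ψ w + τ) • c.e

/-- The base of a point. -/
noncomputable def base : EuclideanSpace ℝ (Fin (m + 1)) →L[ℝ] EuclideanSpace ℝ (Fin m) :=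
  c.J.toContinuousLinearMap.adjoint

/-- The height of a point above the graph. -/
noncomputable def height (x : EuclideanSpace ℝ (Fin (m + 1))) : ℝ :=
  inner ℝ x c.e - c.ψ (c.base x)

lemma inner_e_e : inner ℝ c.e c.e = (1 : ℝ) := by
  rw [real_inner_self_eq_norm_sq, c.norm_e]; norm_num

lemma base_J (w : EuclideanSpace ℝ (Fin m)) : c.base (c.J w) = w := by
  refine ext_inner_right ℝ fun y => ?_
  rw [base, ContinuousLinearMap.adjoint_inner_left]
  exact c.J.inner_map_map w y

lemma base_e : c.base c.e = 0 := by
  refine ext_inner_right ℝ fun y => ?_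
  rw [base, ContinuousLinearMap.adjoint_inner_left, real_inner_comm]
  simpa using c.inner_J y

lemma norm_sq_add (w : EuclideanSpace ℝ (Fin m)) (t : ℝ) :
    ‖c.J w + t • c.e‖ ^ 2 = ‖w‖ ^ 2 + t ^ 2 := by
  rw [norm_add_sq_real, inner_smul_right, c.inner_J, norm_smul, c.norm_e, c.J.norm_map]
  simp

/-- The splitting of space into the hyperplane orthogonal to `e` and the line spanned by `e`. -/
noncomputable def splitting :
    WithLp 2 (EuclideanSpace ℝ (Fin m) × ℝ) ≃ₗᵢ[ℝ] EuclideanSpace ℝ (Fin (m + 1)) :=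
  LinearIsometry.toLinearIsometryEquiv
    { toLinearMap := (c.J.toLinearMap.coprod (LinearMap.toSpanSingleton ℝ _ c.e)).comp
        (WithLp.linearEquiv 2 ℝ (EuclideanSpace ℝ (Fin m) × ℝ)).toLinearMap
      norm_map' := fun x => by
        have h := c.norm_sq_add x.fst x.snd
        have h2 := WithLp.prod_norm_sq_eq_of_L2 x
        rw [← abs_of_nonneg (norm_nonneg (_ : EuclideanSpace ℝ (Fin (m + 1)))),
          ← abs_of_nonneg (norm_nonneg x), ← sq_eq_sq_iff_abs_eq_abs, h2]
        simpa using h }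
    (by
      rw [(WithLp.linearEquiv 2 ℝ (EuclideanSpace ℝ (Fin m) × ℝ)).finrank_eq]
      simp)

lemma splitting_apply (w : EuclideanSpace ℝ (Fin m)) (t : ℝ) :
    c.splitting (WithLp.toLp 2 (w, t)) = c.J w + t • c.e := by
  simp [splitting]

lemma J_base_add (x : EuclideanSpace ℝ (Fin (m + 1))) :
    c.J (c.base x) + inner ℝ x c.e • c.e = x := by
  obtain ⟨y, rfl⟩ := c.splitting.surjective x
  obtain ⟨⟨w, t⟩, rfl⟩ := (WithLp.equiv 2 (EuclideanSpace ℝ (Fin m) × ℝ)).symm.surjective y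
  change c.J (c.base (c.splitting (WithLp.toLp 2 (w, t))))
    + inner ℝ (c.splitting (WithLp.toLp 2 (w, t))) c.e • c.e = c.splitting (WithLp.toLp 2 (w, t))
  rw [splitting_apply, map_add, map_smul, base_J, base_e, inner_add_left, inner_smul_left,
    c.inner_J, c.inner_e_e]
  simp

@[simp] lemma base_point (w : EuclideanSpace ℝ (Fin m)) (τ : ℝ) : c.base (c.point w τ) = w := by
  simp [point, base_J, base_e]

@[simp] lemma height_point (w : EuclideanSpace ℝ (Fin m)) (τ : ℝ) :
    c.height (c.point w τ) = τ := by
  rw [height, base_point, point, inner_add_left, inner_smul_left, c.inner_J, c.inner_e_e]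
  simp

@[simp] lemma point_base_height (x : EuclideanSpace ℝ (Fin (m + 1))) :
    c.point (c.base x) (c.height x) = x := by
  rw [point, height, add_sub_cancel, c.J_base_add]

lemma point_add (w : EuclideanSpace ℝ (Fin m)) (τ h : ℝ) :
    c.point w τ + h • c.e = c.point w (τ + h) := by
  rw [point, point, add_assoc, ← add_smul, add_assoc]

lemma continuous_point : Continuous fun x : EuclideanSpace ℝ (Fin m) × ℝ => c.point x.1 x.2 := by
  have h1 : Continuous c.ψ := c.contDiff_ψ.continuous
  have h2 : Continuous c.J := c.J.continuous
  unfold point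
  fun_prop

lemma contDiff_height : ContDiff ℝ 1 c.height := by
  unfold height
  exact (contDiff_id.inner ℝ contDiff_const).sub (c.contDiff_ψ.comp c.base.contDiff)

/-- A shear `(w, τ) ↦ (w, ψ(w) + τ)`, which is a translation on each fibre, followed by a linear
isometry. Hence Fubini in these coordinates carries no Jacobian. -/
lemma measurePreserving_point :
    MeasurePreserving (fun x : EuclideanSpace ℝ (Fin m) × ℝ => c.point x.1 x.2) := by
  have h1 : MeasurePreserving
      (fun x : EuclideanSpace ℝ (Fin m) × ℝ => ((id x.1 : _), c.ψ x.1 + x.2)) := by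
    refine (MeasurePreserving.id volume).skew_product (g := fun w t => c.ψ w + t) ?_ ?_
    · have : Continuous c.ψ := c.contDiff_ψ.continuous
      exact Continuous.measurable (by fun_prop)
    · exact Eventually.of_forall fun w => (measurePreserving_add_left volume (c.ψ w)).map_eq
  have h2 := c.splitting.measurePreserving.comp
    ((WithLp.volume_preserving_toLp (EuclideanSpace ℝ (Fin m)) ℝ).comp h1)
  convert h2 using 1
  funext x
  simp [splitting_apply, point]

/-- Space in the coordinates given by base and height. -/
noncomputable def homeomorph :
    EuclideanSpace ℝ (Fin m) × ℝ ≃ₜ EuclideanSpace ℝ (Fin (m + 1)) where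
  toFun x := c.point x.1 x.2
  invFun x := (c.base x, c.height x)
  left_inv x := by simp
  right_inv x := by simp
  continuous_toFun := c.continuous_point
  continuous_invFun := c.base.continuous.prodMk c.contDiff_height.continuous

lemma measurableEmbedding_point :
    MeasurableEmbedding (fun x : EuclideanSpace ℝ (Fin m) × ℝ => c.point x.1 x.2) :=
  c.homeomorph.measurableEmbedding

lemma norm_base_le (x : EuclideanSpace ℝ (Fin (m + 1))) : ‖c.base x‖ ≤ ‖x‖ := by
  have h := c.norm_sq_add (c.base x) (inner ℝ x c.e)
  rw [c.J_base_add] at h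
  refine le_of_sq_le_sq ?_ (norm_nonneg _)
  nlinarith [sq_nonneg (inner ℝ x c.e : ℝ)]

lemma exists_lipschitzOnWith (w : EuclideanSpace ℝ (Fin m)) (r : ℝ) :
    ∃ L, LipschitzOnWith L c.ψ (Metric.closedBall w r) := by
  have hc : Continuous fun x => ‖fderiv ℝ c.ψ x‖₊ :=
    (c.contDiff_ψ.continuous_fderiv (by norm_num)).nnnorm
  obtain ⟨L, hL⟩ := (isCompact_closedBall w r).bddAbove_image hc.continuousOn
  refine ⟨L, (convex_closedBall w r).lipschitzOnWith_of_nnnorm_fderiv_le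
    (fun x _ => c.contDiff_ψ.differentiable (by norm_num) x) fun x hx => hL ⟨x, hx, rfl⟩⟩

/-- The slope factor `√(1 + |∇ψ|²)`. -/
noncomputable def slope (w : EuclideanSpace ℝ (Fin m)) : ℝ := √(1 + ‖fderiv ℝ c.ψ w‖ ^ 2)

lemma one_le_slope (w : EuclideanSpace ℝ (Fin m)) : 1 ≤ c.slope w :=
  Real.one_le_sqrt.2 (by nlinarith [sq_nonneg ‖fderiv ℝ c.ψ w‖])

lemma continuous_slope : Continuous c.slope := by
  have hc := c.contDiff_ψ.continuous_fderiv (n := 1) (by norm_num)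
  unfold slope
  fun_prop

/-- The derivative is `y ↦ ⟨y, e⟩ - Dψ(base y)`. Cauchy–Schwarz for the pairs `(1, |Dψ|)` and `(|⟨y,
e⟩|, |base y|)` applies, the latter having norm `|y|`. -/
lemma norm_fderiv_height_le (x : EuclideanSpace ℝ (Fin (m + 1))) :
    ‖fderiv ℝ c.height x‖ ≤ c.slope (c.base x) := by
  set a := fderiv ℝ c.ψ (c.base x) with ha
  have h1 : HasFDerivAt c.height
      ((innerSL ℝ c.e : EuclideanSpace ℝ (Fin (m + 1)) →L[ℝ] ℝ) - a.comp c.base) x := by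
    have h2 : HasFDerivAt (fun y => (innerSL ℝ c.e : EuclideanSpace ℝ (Fin (m + 1)) →L[ℝ] ℝ) y)
        (innerSL ℝ c.e : EuclideanSpace ℝ (Fin (m + 1)) →L[ℝ] ℝ) x :=
      (innerSL ℝ c.e).hasFDerivAt
    have h3 := (c.contDiff_ψ.differentiable (by norm_num) (c.base x)).hasFDerivAt.comp x
      c.base.hasFDerivAt
    refine (h2.sub h3).congr_of_eventuallyEq (Eventually.of_forall fun y => ?_)
    simp [height, real_inner_comm]
  rw [h1.fderiv]
  refine ContinuousLinearMap.opNorm_le_bound _ (Real.sqrt_nonneg _) fun y => ?_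
  have h4 := c.norm_sq_add (c.base y) (inner ℝ y c.e)
  rw [c.J_base_add] at h4
  have h5 : |a (c.base y)| ≤ ‖a‖ * ‖c.base y‖ := a.le_opNorm _
  have h6 : ‖((innerSL ℝ c.e : EuclideanSpace ℝ (Fin (m + 1)) →L[ℝ] ℝ) - a.comp c.base) y‖
      ≤ |inner ℝ y c.e| + ‖a‖ * ‖c.base y‖ := by
    have : ((innerSL ℝ c.e : EuclideanSpace ℝ (Fin (m + 1)) →L[ℝ] ℝ) - a.comp c.base) y
        = inner ℝ y c.e - a (c.base y) := by simp [real_inner_comm]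
    rw [this, Real.norm_eq_abs]
    exact (abs_sub _ _).trans (by linarith)
  refine h6.trans ?_
  rw [slope, ← ha, ← Real.sqrt_sq (norm_nonneg y), ← Real.sqrt_mul (by positivity), h4]
  refine Real.le_sqrt_of_sq_le ?_
  nlinarith [sq_nonneg (‖c.base y‖ - ‖a‖ * |inner ℝ y c.e|), sq_abs (inner ℝ y c.e : ℝ)]

end GraphFrame

end MeanCurvature

/-! ### Boundary charts -/

namespace MeanCurvature

/-- A boundary chart of `Ω`: over a ball and up to height `2 δ`, the points of `Ω` are those of
positive height. -/
structure BoundaryChart {m : ℕ} (Ω : Set (EuclideanSpace ℝ (Fin (m + 1)))) extends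
    GraphFrame m where
  center : EuclideanSpace ℝ (Fin m)
  ρ : ℝ
  δ : ℝ
  ρ_pos : 0 < ρ
  δ_pos : 0 < δ
  mem_iff : ∀ w ∈ Metric.ball center ρ, ∀ τ : ℝ, |τ| < 2 * δ →
    (toGraphFrame.point w τ ∈ Ω ↔ 0 < τ)

namespace BoundaryChart

variable {m : ℕ} {Ω : Set (EuclideanSpace ℝ (Fin (m + 1)))} (c : BoundaryChart Ω)

/-- The base ball of a chart. -/
def ball : Set (EuclideanSpace ℝ (Fin m)) := Metric.ball c.center c.ρ

/-- The neighbourhood covered by a chart. -/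
def domain : Set (EuclideanSpace ℝ (Fin (m + 1))) :=
  {x | c.base x ∈ c.ball ∧ |c.height x| < c.δ}

lemma isOpen_ball : IsOpen c.ball := Metric.isOpen_ball

lemma measurableSet_ball : MeasurableSet c.ball := c.isOpen_ball.measurableSet

lemma isOpen_domain : IsOpen c.domain :=
  (c.isOpen_ball.preimage c.base.continuous).inter
    (isOpen_lt c.contDiff_height.continuous.abs continuous_const)

lemma mem_iff_height {x : EuclideanSpace ℝ (Fin (m + 1))} (hx : c.base x ∈ c.ball)
    (hx' : |c.height x| < 2 * c.δ) : x ∈ Ω ↔ 0 < c.height x := by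
  conv_lhs => rw [← c.point_base_height x]
  exact c.mem_iff _ hx _ hx'

lemma mem_iff_of_mem_domain {x : EuclideanSpace ℝ (Fin (m + 1))} (hx : x ∈ c.domain) :
    x ∈ Ω ↔ 0 < c.height x :=
  c.mem_iff_height hx.1 (by linarith [hx.2, c.δ_pos])

lemma point_mem_domain {w : EuclideanSpace ℝ (Fin m)} (hw : w ∈ c.ball) {τ : ℝ}
    (hτ : |τ| < c.δ) : c.point w τ ∈ c.domain := by
  simpa [domain] using ⟨hw, hτ⟩

/-- Negative height is an open condition disjoint from `Ω` within the chart, and a point of height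
zero is approached from `Ω` along its own fibre. -/
lemma height_eq_zero_iff (hΩ : IsOpen Ω) {x : EuclideanSpace ℝ (Fin (m + 1))}
    (hx : x ∈ c.domain) : x ∈ frontier Ω ↔ c.height x = 0 := by
  rw [hΩ.frontier_eq]
  constructor
  · rintro ⟨hcl, hnot⟩
    rw [c.mem_iff_of_mem_domain hx, not_lt] at hnot
    by_contra hne
    have hlt : c.height x < 0 := lt_of_le_of_ne hnot hne
    have hnhds : c.domain ∩ {y | c.height y < 0} ∈ 𝓝 x :=
      inter_mem (c.isOpen_domain.mem_nhds hx)
        ((isOpen_lt c.contDiff_height.continuous continuous_const).mem_nhds hlt)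
    obtain ⟨y, ⟨hy1, hy2⟩, hy3⟩ := mem_closure_iff_nhds.1 hcl _ hnhds
    exact absurd ((c.mem_iff_of_mem_domain hy1).1 hy3) (not_lt.2 (le_of_lt hy2))
  · intro h0
    refine ⟨?_, by rw [c.mem_iff_of_mem_domain hx, h0]; exact lt_irrefl 0⟩
    have hxp : c.point (c.base x) 0 = x := by rw [← h0]; exact c.point_base_height x
    have ht : Tendsto (fun τ : ℝ => c.point (c.base x) τ) (𝓝[>] 0) (𝓝 x) := by
      have h2 : Continuous fun τ : ℝ => c.point (c.base x) τ :=
        c.continuous_point.comp (Continuous.prodMk_right (c.base x))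
      have := h2.tendsto 0
      rw [hxp] at this
      exact this.mono_left nhdsWithin_le_nhds
    refine mem_closure_of_tendsto ht ?_
    filter_upwards [Ioo_mem_nhdsGT c.δ_pos] with τ hτ
    refine (c.mem_iff _ hx.1 τ ?_).2 hτ.1
    rw [abs_of_pos hτ.1]; linarith [hτ.2, c.δ_pos]

lemma frontier_inter_domain (hΩ : IsOpen Ω) :
    frontier Ω ∩ c.domain = (fun w => c.point w 0) '' c.ball := by
  ext x
  constructor
  · rintro ⟨h1, h2⟩
    refine ⟨c.base x, h2.1, ?_⟩
    rw [c.height_eq_zero_iff hΩ h2] at h1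
    rw [← h1]; exact c.point_base_height x
  · rintro ⟨w, hw, rfl⟩
    have : c.point w 0 ∈ c.domain := c.point_mem_domain hw (by simpa using c.δ_pos)
    exact ⟨(c.height_eq_zero_iff hΩ this).2 (by simp), this⟩

end BoundaryChart

/-- Invariance of `ψ` along `e` lets it factor through the base. As `x` has height zero, the given
ball around it contains the image of a product neighbourhood of `(base x, 0)`. -/
lemma HasC1Boundary.exists_chart {m : ℕ} {Ω : Set (EuclideanSpace ℝ (Fin (m + 1)))}
    (hΩo : IsOpen Ω) (hΩ : HasC1Boundary Ω) {x : EuclideanSpace ℝ (Fin (m + 1))}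
    (hx : x ∈ frontier Ω) : ∃ c : BoundaryChart Ω, x ∈ c.domain := by
  obtain ⟨e, ψ, r, he, hψ, hinv, hr, hmem⟩ := hΩ x hx
  obtain ⟨J, hJ⟩ := exists_isometry_orthogonal he
  obtain ⟨c, hce, hψJ⟩ : ∃ c : GraphFrame m, c.e = e ∧ ∀ y, ψ y = c.ψ (c.base y) := by
    refine ⟨⟨J, e, he, hJ, fun w => ψ (J w), hψ.comp J.toContinuousLinearMap.contDiff⟩, rfl,
      fun y => ?_⟩
    conv_lhs => rw [← GraphFrame.J_base_add ⟨J, e, he, hJ, fun w => ψ (J w),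
      hψ.comp J.toContinuousLinearMap.contDiff⟩ y]
    exact hinv _ _
  have hmem' : ∀ y ∈ Metric.ball x r, y ∈ Ω ↔ 0 < c.height y := by
    intro y hy
    rw [hmem y hy, hψJ, GraphFrame.height, sub_pos, hce]
  have hx0 : c.height x = 0 := by
    rw [hΩo.frontier_eq] at hx
    have h1 : ¬ 0 < c.height x := fun h => hx.2 ((hmem' x (Metric.mem_ball_self hr)).2 h)
    by_contra hne
    have hlt : c.height x < 0 := lt_of_le_of_ne (not_lt.1 h1) hne
    have hnhds : Metric.ball x r ∩ {y | c.height y < 0} ∈ 𝓝 x :=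
      inter_mem (Metric.ball_mem_nhds x hr)
        ((isOpen_lt c.contDiff_height.continuous continuous_const).mem_nhds hlt)
    obtain ⟨y, ⟨hy1, hy2⟩, hy3⟩ := mem_closure_iff_nhds.1 hx.1 _ hnhds
    exact absurd ((hmem' y hy1).1 hy3) (not_lt.2 (le_of_lt hy2))
  have hxp : c.point (c.base x) 0 = x := by rw [← hx0]; exact c.point_base_height x
  have hopen : IsOpen ((fun y : EuclideanSpace ℝ (Fin m) × ℝ => c.point y.1 y.2) ⁻¹'
      Metric.ball x r) :=
    Metric.isOpen_ball.preimage c.continuous_point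
  have hnhds := hopen.mem_nhds (x := (c.base x, (0 : ℝ))) (by
    rw [Set.mem_preimage, hxp]; exact Metric.mem_ball_self hr)
  obtain ⟨A, hA, B, hB, hsub⟩ := mem_nhds_prod_iff.1 hnhds
  obtain ⟨ρ, hρ, hρA⟩ := Metric.mem_nhds_iff.1 hA
  obtain ⟨ε, hε, hεB⟩ := Metric.mem_nhds_iff.1 hB
  -- Half of `ε`, because a chart must describe `Ω` up to height `2 δ`.
  refine ⟨{ toGraphFrame := c, center := c.base x, ρ := ρ, δ := ε / 2, ρ_pos := hρ,
            δ_pos := by positivity, mem_iff := fun w hw τ hτ => ?_ }, ?_⟩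
  · have hτε : τ ∈ Metric.ball (0 : ℝ) ε := by
      rw [Metric.mem_ball, Real.dist_eq, sub_zero]
      linarith
    have hp : (w, τ) ∈ A ×ˢ B := ⟨hρA hw, hεB hτε⟩
    have h2 := hsub hp
    rw [Set.mem_preimage] at h2
    rw [hmem' _ h2, c.height_point]
  · refine ⟨Metric.mem_ball_self hρ, ?_⟩
    change |c.height x| < ε / 2
    rw [hx0, abs_zero]
    positivity

/-- Lower density bound at the boundary. -/
lemma BoundaryChart.exists_volume_ge {m : ℕ} {Ω : Set (EuclideanSpace ℝ (Fin (m + 1)))}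
    (hΩo : IsOpen Ω) (c : BoundaryChart Ω)
    {x : EuclideanSpace ℝ (Fin (m + 1))} (hxd : x ∈ c.domain) (hx : x ∈ frontier Ω) :
    ∃ κ > 0, ∀ᶠ r in 𝓝[>] (0 : ℝ), κ * r ^ (m + 1) ≤ volume.real (Metric.ball x r ∩ Ω) := by
  have hx0 : c.height x = 0 := (c.height_eq_zero_iff hΩo hxd).1 hx
  obtain ⟨L, hL⟩ := c.exists_lipschitzOnWith (c.base x) 1
  -- The point `x + (r / 2) e` has height `r / 2` and the height has Lipschitz constant `1 + L`
  -- nearby. With `(1 + L) a = 1 / 4` the ball of radius `a r` around it keeps positive height; `a ≤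
  -- 1 / 4` keeps it inside `B(x, r)`.
  set a : ℝ := 1 / (4 * (1 + L)) with ha
  have ha0 : 0 < a := by positivity
  have ha4 : (1 + (L : ℝ)) * a = 1 / 4 := by rw [ha]; field_simp
  have haq : a ≤ 1 / 4 := by nlinarith [L.coe_nonneg]
  refine ⟨a ^ (m + 1) * volume.real (Metric.ball (0 : EuclideanSpace ℝ (Fin (m + 1))) 1),
    by
      refine mul_pos (by positivity) ?_
      exact ENNReal.toReal_pos (Metric.measure_ball_pos _ _ one_pos).ne' measure_ball_lt_top.ne, ?_⟩
  obtain ⟨R, hR, hRsub⟩ := Metric.isOpen_iff.1 c.isOpen_domain x hxd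
  filter_upwards [Ioo_mem_nhdsGT (lt_min hR one_pos)] with r hr
  have hrR : r < R := hr.2.trans_le (min_le_left _ _)
  have hr1 : r < 1 := hr.2.trans_le (min_le_right _ _)
  have hr0 : 0 < r := hr.1
  have hsub : Metric.ball (x + (r / 2) • c.e) (a * r) ⊆ Metric.ball x r ∩ Ω := by
    intro y hy
    rw [Metric.mem_ball, dist_eq_norm] at hy
    have h1 : ‖(r / 2) • c.e‖ = r / 2 := by
      rw [norm_smul, c.norm_e, Real.norm_of_nonneg (by positivity), mul_one]
    have h2 : ‖y - x‖ < r := by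
      have : y - x = (y - (x + (r / 2) • c.e)) + (r / 2) • c.e := by abel
      rw [this]
      refine (norm_add_le _ _).trans_lt ?_
      rw [h1]
      nlinarith
    have hyb : y ∈ Metric.ball x r := by rw [Metric.mem_ball, dist_eq_norm]; exact h2
    refine ⟨hyb, ?_⟩
    have hyd : y ∈ c.domain := hRsub (Metric.ball_subset_ball hrR.le hyb)
    rw [c.mem_iff_of_mem_domain hyd]
    set z := y - (x + (r / 2) • c.e) with hz
    have hyz : y = x + (r / 2) • c.e + z := by rw [hz]; abel
    have hin : inner ℝ y c.e = inner ℝ x c.e + r / 2 + inner ℝ z c.e := by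
      rw [hyz, inner_add_left, inner_add_left, inner_smul_left, c.inner_e_e]
      simp
    have hinz : -‖z‖ ≤ inner ℝ z c.e := by
      have := abs_real_inner_le_norm z c.e
      rw [c.norm_e, mul_one] at this
      exact (abs_le.1 this).1
    have hb : c.base y = c.base x + c.base z := by
      conv_lhs => rw [hyz]
      simp [c.base_e]
    have hbz : ‖c.base z‖ ≤ ‖z‖ := c.norm_base_le z
    have hψ : c.ψ (c.base y) - c.ψ (c.base x) ≤ L * ‖z‖ := by
      have h3 := hL.dist_le_mul (c.base y) (by
        rw [Metric.mem_closedBall, dist_eq_norm, hb, add_sub_cancel_left]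
        nlinarith) (c.base x) (Metric.mem_closedBall_self zero_le_one)
      rw [Real.dist_eq, dist_eq_norm, hb, add_sub_cancel_left] at h3
      have h4 := le_abs_self (c.ψ (c.base x + c.base z) - c.ψ (c.base x))
      rw [hb]
      exact h4.trans (h3.trans (mul_le_mul_of_nonneg_left hbz L.coe_nonneg))
    have h5 : c.height y - c.height x ≥ r / 2 - (1 + L) * ‖z‖ := by
      simp only [GraphFrame.height] at *
      linarith
    have h6 : (1 + (L : ℝ)) * ‖z‖ ≤ (1 + L) * (a * r) := by gcongr
    rw [← mul_assoc, ha4] at h6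
    linarith
  have hvol : volume.real (Metric.ball (x + (r / 2) • c.e) (a * r))
      = (a * r) ^ (m + 1) * volume.real (Metric.ball (0 : EuclideanSpace ℝ (Fin (m + 1))) 1) := by
    rw [Measure.real, Measure.addHaar_ball_of_pos _ _ (by positivity), ENNReal.toReal_mul,
      ENNReal.toReal_ofReal (by positivity), Measure.real]
    simp
  calc _ = volume.real (Metric.ball (x + (r / 2) • c.e) (a * r)) := by rw [hvol]; ring
    _ ≤ _ := measureReal_mono hsub
      ((measure_mono Set.inter_subset_left).trans_lt measure_ball_lt_top).ne

end MeanCurvature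

namespace MeanCurvature

/-! ### Pointwise traces and their uniqueness -/

section TraceAt

variable {n : ℕ} {Ω : Set (EuclideanSpace ℝ (Fin n))} {u v : EuclideanSpace ℝ (Fin n) → ℝ}
  {x : EuclideanSpace ℝ (Fin n)} {a b : ℝ}

/-- The pointwise condition which defines traces. -/
def HasTraceAt (Ω : Set (EuclideanSpace ℝ (Fin n))) (v : EuclideanSpace ℝ (Fin n) → ℝ)
    (x : EuclideanSpace ℝ (Fin n)) (a : ℝ) : Prop :=
  Tendsto (fun r : ℝ => (∫ y in Metric.ball x r ∩ Ω, |v y - a|) / r ^ n) (𝓝[>] 0) (𝓝 0)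

lemma integrableOn_ball_inter_sub (hv : IntegrableOn v Ω) (x : EuclideanSpace ℝ (Fin n))
    (r a : ℝ) : IntegrableOn (fun y => |v y - a|) (Metric.ball x r ∩ Ω) :=
  Integrable.abs (Integrable.sub (hv.mono_set Set.inter_subset_right)
    (integrableOn_const (hs := ((measure_mono Set.inter_subset_left).trans_lt
      measure_ball_lt_top).ne)))

lemma HasTraceAt.congr (h : HasTraceAt Ω u x a) (huv : u =ᵐ[volume.restrict Ω] v) :
    HasTraceAt Ω v x a := by
  refine Tendsto.congr (fun r => ?_) h
  congr 1
  refine integral_congr_ae ?_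
  filter_upwards [ae_restrict_of_ae_restrict_of_subset
    (Set.inter_subset_right (s := Metric.ball x r)) huv] with y hy
  rw [hy]

lemma HasTraceAt.add_const_mul (hu : IntegrableOn u Ω) (hv : IntegrableOn v Ω)
    (h1 : HasTraceAt Ω u x 0) (h2 : HasTraceAt Ω v x 0) (t : ℝ) :
    HasTraceAt Ω (fun y => u y + t * v y) x 0 := by
  have h3 := h1.add (h2.const_mul |t|)
  rw [mul_zero, add_zero] at h3
  refine squeeze_zero' (eventually_nhdsWithin_of_forall fun r hr => ?_)
    (eventually_nhdsWithin_of_forall fun r hr => ?_) h3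
  · have : (0 : ℝ) < r := hr
    positivity
  · have hr' : (0 : ℝ) < r := hr
    have i1 := integrableOn_ball_inter_sub hu x r 0
    have i2 := integrableOn_ball_inter_sub hv x r 0
    have i3 : IntegrableOn (fun y => |u y + t * v y - 0|) (Metric.ball x r ∩ Ω) :=
      integrableOn_ball_inter_sub (hu.add (hv.const_mul t)) x r 0
    have i4 : IntegrableOn (fun y => |u y - 0| + |t| * |v y - 0|) (Metric.ball x r ∩ Ω) :=
      i1.add (i2.const_mul _)
    rw [← mul_div_assoc, ← add_div, ← integral_const_mul, ← integral_add i1 (i2.const_mul _)]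
    refine div_le_div_of_nonneg_right ?_ (by positivity)
    refine integral_mono i3 i4 fun y => ?_
    simp only [sub_zero]
    refine (abs_add_le _ _).trans ?_
    rw [abs_mul]

lemma HasTraceAt.zero_of_notMem_tsupport {η : EuclideanSpace ℝ (Fin n) → ℝ}
    (hx : x ∉ tsupport η) : HasTraceAt Ω (fun y => η y * v y) x 0 := by
  obtain ⟨R, hR, hsub⟩ := Metric.isOpen_iff.1 (isClosed_tsupport η).isOpen_compl x hx
  refine tendsto_const_nhds.congr' ?_
  filter_upwards [Ioo_mem_nhdsGT hR] with r hr
  have : ∫ y in Metric.ball x r ∩ Ω, |η y * v y - 0| = 0 := by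
    refine integral_eq_zero_of_ae ?_
    have hm : ∀ᵐ y ∂(volume.restrict (Metric.ball x r ∩ Ω)), y ∈ Metric.ball x r :=
      ae_restrict_of_ae_restrict_of_subset Set.inter_subset_left
        (ae_restrict_mem Metric.isOpen_ball.measurableSet)
    filter_upwards [hm] with y hy
    have : η y = 0 := image_eq_zero_of_notMem_tsupport
      (hsub (Metric.ball_subset_ball hr.2.le hy))
    simp [this]
  rw [this, zero_div]

end TraceAt

section Uniqueness

variable {m : ℕ} {Ω : Set (EuclideanSpace ℝ (Fin (m + 1)))}
  {u v : EuclideanSpace ℝ (Fin (m + 1)) → ℝ}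

/-- The triangle inequality gives `|a - b| |B(x,r) ∩ Ω| = o(r^{m+1})`, while the density bound at
the boundary makes the volume at least `κ r^{m+1}`. -/
lemma HasTraceAt.unique (hΩo : IsOpen Ω) (hΩ : HasC1Boundary Ω)
    (hv : IntegrableOn v Ω) {x : EuclideanSpace ℝ (Fin (m + 1))} (hx : x ∈ frontier Ω) {a b : ℝ}
    (ha : HasTraceAt Ω v x a) (hb : HasTraceAt Ω v x b) : a = b := by
  obtain ⟨c, hc⟩ := hΩ.exists_chart hΩo hx
  obtain ⟨κ, hκ, hev⟩ := c.exists_volume_ge hΩo hc hx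
  have h3 := ha.add hb
  rw [add_zero] at h3
  have h4 : κ * |a - b| ≤ 0 := by
    refine ge_of_tendsto h3 ?_
    filter_upwards [hev, self_mem_nhdsWithin] with r hr hr0
    have hr0' : (0 : ℝ) < r := hr0
    have i1 := integrableOn_ball_inter_sub hv x r a
    have i2 := integrableOn_ball_inter_sub hv x r b
    rw [← add_div, ← integral_add i1 i2, le_div_iff₀ (by positivity)]
    have hfin : volume (Metric.ball x r ∩ Ω) ≠ ∞ :=
      ((measure_mono Set.inter_subset_left).trans_lt measure_ball_lt_top).ne
    calc κ * |a - b| * r ^ (m + 1) = (κ * r ^ (m + 1)) * |a - b| := by ring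
      _ ≤ volume.real (Metric.ball x r ∩ Ω) * |a - b| := by gcongr
      _ = ∫ y in Metric.ball x r ∩ Ω, |a - b| := by simp
      _ ≤ _ := by
        refine integral_mono (integrableOn_const (hs := hfin)) (i1.add i2) fun y => ?_
        have := abs_sub_le a (v y) b
        rwa [abs_sub_comm a (v y)] at this
  have h5 : |a - b| ≤ 0 := by
    by_contra h
    push Not at h
    nlinarith [mul_pos hκ h]
  exact sub_eq_zero.1 (abs_nonpos_iff.1 h5)

lemma ae_surfaceMeasure_mem_frontier {n : ℕ} (Ω : Set (EuclideanSpace ℝ (Fin n))) :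
    ∀ᵐ x ∂(surfaceMeasure Ω), x ∈ frontier Ω :=
  ae_restrict_mem isClosed_frontier.measurableSet

lemma HasTrace.ae_eq_zero (hΩo : IsOpen Ω) (hΩ : HasC1Boundary Ω)
    (hv : IntegrableOn v Ω) (h0 : VanishesOnBoundary Ω v)
    {T : EuclideanSpace ℝ (Fin (m + 1)) → ℝ} (hT : HasTrace Ω v T) :
    T =ᵐ[surfaceMeasure Ω] 0 := by
  filter_upwards [hT.2, h0.2, ae_surfaceMeasure_mem_frontier Ω] with x h1 h2 hx
  exact HasTraceAt.unique hΩo hΩ hv hx h1 h2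

lemma VanishesOnBoundary.add_const_mul {n : ℕ} {Ω : Set (EuclideanSpace ℝ (Fin n))}
    {u v : EuclideanSpace ℝ (Fin n) → ℝ} (hu : IntegrableOn u Ω) (hv : IntegrableOn v Ω)
    (h1 : VanishesOnBoundary Ω u) (h2 : VanishesOnBoundary Ω v) (t : ℝ) :
    VanishesOnBoundary Ω (fun y => u y + t * v y) := by
  refine ⟨integrable_zero _ _ _, ?_⟩
  filter_upwards [h1.2, h2.2] with x hx1 hx2
  exact HasTraceAt.add_const_mul hu hv hx1 hx2 t

lemma IsTest.vanishesOnBoundary_mul {n : ℕ} {Ω : Set (EuclideanSpace ℝ (Fin n))}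
    (hΩo : IsOpen Ω) {η : EuclideanSpace ℝ (Fin n) → ℝ} (hη : IsTest Ω η)
    (v : EuclideanSpace ℝ (Fin n) → ℝ) : VanishesOnBoundary Ω (fun y => η y * v y) := by
  refine ⟨integrable_zero _ _ _, ?_⟩
  filter_upwards [ae_surfaceMeasure_mem_frontier Ω] with x hx
  rw [hΩo.frontier_eq] at hx
  exact HasTraceAt.zero_of_notMem_tsupport fun h => hx.2 (hη.2.2 h)

end Uniqueness

end MeanCurvature

namespace MeanCurvature

/-! ### Surface measure of a `C¹` graph -/

section Hausdorff

open Measure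

lemma euclideanHausdorffMeasure_image_le {X Y : Type*} [MetricSpace X] [MetricSpace Y]
    [MeasurableSpace X] [BorelSpace X] [MeasurableSpace Y] [BorelSpace Y] {K : NNReal} {f : X → Y}
    {s : Set X} (h : LipschitzOnWith K f s) (d : ℕ) :
    euclideanHausdorffMeasure d (f '' s) ≤ (K : ℝ≥0∞) ^ d * euclideanHausdorffMeasure d s := by
  have h1 := h.hausdorffMeasure_image_le (d := d) (by positivity)
  rw [ENNReal.rpow_natCast] at h1
  simp only [euclideanHausdorffMeasure_def, Measure.smul_apply]
  rw [mul_smul_comm]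
  gcongr

/-- Countably many of the neighbourhoods suffice, by second countability; made disjoint, they cut
any measurable set into pieces on which the comparison is known. -/
lemma measure_le_of_forall_nhds {X : Type*} [TopologicalSpace X] [SecondCountableTopology X]
    [MeasurableSpace X] [OpensMeasurableSpace X] {μ ν : Measure X}
    (h : ∀ x : X, ∃ U ∈ 𝓝 x, ∀ A ⊆ U, MeasurableSet A → μ A ≤ ν A) : μ ≤ ν := by
  choose U hU hle using h
  obtain ⟨s, hs, hcov⟩ := TopologicalSpace.countable_cover_nhds
    (fun x => interior_mem_nhds.2 (hU x))
  rcases s.eq_empty_or_nonempty with rfl | hne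
  · simp only [Set.mem_empty_iff_false, Set.iUnion_of_empty, Set.iUnion_empty] at hcov
    refine Measure.le_iff.2 fun A _ => ?_
    have : A = ∅ := Set.subset_eq_empty (Set.subset_univ A) hcov.symm
    simp [this]
  obtain ⟨g, rfl⟩ := hs.exists_eq_range hne
  simp only [Set.mem_range, Set.iUnion_exists, Set.iUnion_iUnion_eq'] at hcov
  set D := disjointed fun k => interior (U (g k)) with hD
  have hDm : ∀ k, MeasurableSet (D k) := fun k =>
    MeasurableSet.disjointed (fun i => isOpen_interior.measurableSet) k
  have hDu : ⋃ k, D k = Set.univ := by rw [hD, iUnion_disjointed, hcov]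
  refine Measure.le_iff.2 fun A hA => ?_
  have hAD : A = ⋃ k, A ∩ D k := by rw [← Set.inter_iUnion, hDu, Set.inter_univ]
  have hdis : Pairwise (Function.onFun Disjoint fun k => A ∩ D k) := fun i j hij =>
    ((disjoint_disjointed _) hij).mono Set.inter_subset_right Set.inter_subset_right
  rw [hAD, measure_iUnion hdis fun k => hA.inter (hDm k),
    measure_iUnion hdis fun k => hA.inter (hDm k)]
  exact ENNReal.tsum_le_tsum fun k => hle (g k) _
    (Set.inter_subset_right.trans ((disjointed_subset _ k).trans interior_subset))
    (hA.inter (hDm k))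

namespace GraphFrame

variable {m : ℕ} (c : GraphFrame m)

lemma lipschitzOnWith_point {L : NNReal} {s : Set (EuclideanSpace ℝ (Fin m))}
    (h : LipschitzOnWith L c.ψ s) : LipschitzOnWith (1 + L) (fun w => c.point w 0) s := by
  refine LipschitzOnWith.of_dist_le_mul fun x hx y hy => ?_
  have h1 := h.dist_le_mul x hx y hy
  rw [Real.dist_eq] at h1
  have e : c.point x 0 - c.point y 0 = c.J (x - y) + (c.ψ x - c.ψ y) • c.e := by
    simp only [point, add_zero, map_sub, sub_smul]; abel
  rw [dist_eq_norm, e]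
  refine (norm_add_le _ _).trans ?_
  rw [c.J.norm_map, norm_smul, c.norm_e, mul_one, Real.norm_eq_abs, ← dist_eq_norm]
  push_cast
  linarith

/-- The surface measure of a graph over a ball is controlled by Lebesgue measure on the base. -/
lemma exists_map_base_le (w : EuclideanSpace ℝ (Fin m)) (r : ℝ) :
    ∃ C : ℝ≥0∞, C ≠ ∞ ∧
      ((euclideanHausdorffMeasure m).restrict
        ((fun w => c.point w 0) '' Metric.ball w r)).map c.base
        ≤ C • volume.restrict (Metric.ball w r) := by
  obtain ⟨L, hL⟩ := c.exists_lipschitzOnWith w r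
  refine ⟨((1 + L : NNReal) : ℝ≥0∞) ^ m, by simp, Measure.le_iff.2 fun A hA => ?_⟩
  have hb : Measurable c.base := c.base.continuous.measurable
  rw [Measure.map_apply hb hA, Measure.restrict_apply (hb hA), Measure.smul_apply,
    Measure.restrict_apply hA, smul_eq_mul]
  have hset : c.base ⁻¹' A ∩ (fun w => c.point w 0) '' Metric.ball w r
      = (fun w => c.point w 0) '' (A ∩ Metric.ball w r) := by
    ext x
    constructor
    · rintro ⟨h1, y, hy, rfl⟩
      refine ⟨y, ⟨?_, hy⟩, rfl⟩
      simpa using h1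
    · rintro ⟨y, ⟨h1, h2⟩, rfl⟩
      exact ⟨by simpa using h1, y, h2, rfl⟩
  rw [hset]
  have h1 := euclideanHausdorffMeasure_image_le (c.lipschitzOnWith_point
    ((hL.mono Metric.ball_subset_closedBall).mono (Set.inter_subset_right (s := A)))) m
  rwa [EuclideanSpace.euclideanHausdorffMeasure_eq_volume] at h1

/-- A linear contraction onto the base which preserves the area of the tangent plane of slope
`a`. -/
noncomputable def flatten (a : EuclideanSpace ℝ (Fin m)) :
    EuclideanSpace ℝ (Fin (m + 1)) →L[ℝ] EuclideanSpace ℝ (Fin m) :=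
  c.base + (((√(1 + ‖a‖ ^ 2))⁻¹ • ((innerSL ℝ (‖a‖⁻¹ • a)).comp c.base + ‖a‖ • innerSL ℝ c.e)
    - (innerSL ℝ (‖a‖⁻¹ • a)).comp c.base).smulRight (‖a‖⁻¹ • a))

lemma flatten_apply (a : EuclideanSpace ℝ (Fin m)) (x : EuclideanSpace ℝ (Fin (m + 1))) :
    c.flatten a x = c.base x + ((√(1 + ‖a‖ ^ 2))⁻¹ * (inner ℝ (‖a‖⁻¹ • a) (c.base x)
      + ‖a‖ * inner ℝ c.e x) - inner ℝ (‖a‖⁻¹ • a) (c.base x)) • (‖a‖⁻¹ • a) := by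
  rw [inner_smul_left]
  simp only [flatten, _root_.add_apply, ContinuousLinearMap.smulRight_apply]
  congr 2
  simp [mul_add]

/-- Let `b = a / |a|` and `s = √(1 + |a|²)`. The map keeps the base part orthogonal to `b` and
replaces the `b`-component `q` by `(q + |a| t) / s`, where `t` is the `e`-component. By
Cauchy–Schwarz the square of the latter is at most `q² + t²`. -/
lemma norm_flatten_le (a : EuclideanSpace ℝ (Fin m)) (x : EuclideanSpace ℝ (Fin (m + 1))) :
    ‖c.flatten a x‖ ≤ ‖x‖ := by
  have h4 := c.norm_sq_add (c.base x) (inner ℝ x c.e)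
  rw [c.J_base_add, real_inner_comm] at h4
  rw [flatten_apply]
  set b := ‖a‖⁻¹ • a with hb
  -- Only an inequality: for `a = 0` the convention `0⁻¹ = 0` makes `b = 0`.
  have hb1 : ‖b‖ ≤ 1 := by
    rw [hb, norm_smul, norm_inv, norm_norm]
    exact inv_mul_le_one
  set s := √(1 + ‖a‖ ^ 2) with hs
  have hs2 : s ^ 2 = 1 + ‖a‖ ^ 2 := Real.sq_sqrt (by positivity)
  have hs0 : 0 < s := Real.sqrt_pos.2 (by positivity)
  set q : ℝ := inner ℝ b (c.base x) with hq
  set t : ℝ := inner ℝ c.e x with ht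
  set k := s⁻¹ * (q + ‖a‖ * t) - q with hk
  refine le_of_sq_le_sq ?_ (norm_nonneg _)
  rw [h4, norm_add_sq_real, inner_smul_right, real_inner_comm, ← hq, norm_smul, mul_pow,
    Real.norm_eq_abs, sq_abs]
  have h5 : k ^ 2 * ‖b‖ ^ 2 ≤ k ^ 2 :=
    mul_le_of_le_one_right (sq_nonneg k) (pow_le_one₀ (norm_nonneg _) hb1)
  have h6 : (k + q) ^ 2 ≤ q ^ 2 + t ^ 2 := by
    have : k + q = (q + ‖a‖ * t) / s := by rw [hk]; field_simp; ring
    rw [this, div_pow, div_le_iff₀ (by positivity), hs2]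
    nlinarith [sq_nonneg (‖a‖ * q - t)]
  nlinarith

/-- On the tangent plane `t = |a| q`, so the new `b`-component is `(1 + |a|²) q / s = s q`. The
parametrised tangent plane is thus stretched by `s` along `b` and fixed across it, which gives
determinant `s`. -/
lemma flatten_tangent (a w : EuclideanSpace ℝ (Fin m)) :
    c.flatten a (c.J w + inner ℝ a w • c.e) =
      LinearMap.transvection
        ((√(1 + ‖a‖ ^ 2) - 1) • (innerSL ℝ (‖a‖⁻¹ • a)).toLinearMap) (‖a‖⁻¹ • a) w := by
  have hs2 : √(1 + ‖a‖ ^ 2) ^ 2 = 1 + ‖a‖ ^ 2 := Real.sq_sqrt (by positivity)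
  have hs0 : 0 < √(1 + ‖a‖ ^ 2) := Real.sqrt_pos.2 (by positivity)
  have hin : inner ℝ a w = ‖a‖ * inner ℝ (‖a‖⁻¹ • a) w := by
    rcases eq_or_ne a 0 with rfl | ha
    · simp
    · have : ‖a‖ ≠ 0 := norm_ne_zero_iff.2 ha
      rw [inner_smul_left]; simp; field_simp
  have hbase : c.base (c.J w + inner ℝ a w • c.e) = w := by simp [base_J, base_e]
  have hie : inner ℝ c.e (c.J w + inner ℝ a w • c.e) = inner ℝ a w := by
    rw [inner_add_right, inner_smul_right, c.inner_e_e, real_inner_comm, c.inner_J]; simp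
  rw [flatten_apply, hbase, hie, hin, LinearMap.transvection.apply]
  congr 2
  simp only [LinearMap.smul_apply, smul_eq_mul, ContinuousLinearMap.coe_coe, innerSL_apply_apply]
  generalize inner ℝ (‖a‖⁻¹ • a) w = q
  field_simp
  linear_combination (-q) * hs2

lemma det_transvection_slope (a : EuclideanSpace ℝ (Fin m)) :
    (LinearMap.transvection
        ((√(1 + ‖a‖ ^ 2) - 1) • (innerSL ℝ (‖a‖⁻¹ • a)).toLinearMap) (‖a‖⁻¹ • a)).det
      = √(1 + ‖a‖ ^ 2) := by
  rw [LinearMap.transvection.det]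
  rcases eq_or_ne a 0 with rfl | ha
  · simp
  · have : ‖a‖ ≠ 0 := norm_ne_zero_iff.2 ha
    simp only [LinearMap.smul_apply, smul_eq_mul, ContinuousLinearMap.coe_coe,
      innerSL_apply_apply, real_inner_self_eq_norm_sq, norm_smul, norm_inv, norm_norm]
    rw [inv_mul_cancel₀ this]
    ring

lemma measurableEmbedding_graph : MeasurableEmbedding fun w => c.point w 0 :=
  (c.continuous_point.comp (Continuous.prodMk_left 0)).measurableEmbedding fun w w' h => by
    simpa using congrArg c.base h

/-- Follow the graph map by the flattening adapted to the tangent plane at `w₀`. The composite has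
derivative of determinant `slope w₀` there, so near `w₀` it enlarges volume by almost that factor.
As the flattening is a contraction, the enlarged volume is at most the Hausdorff measure of the
piece of graph. -/
lemma exists_nhds_slope_le (w₀ : EuclideanSpace ℝ (Fin m)) {ε : ℝ} (hε : 0 < ε) :
    ∃ U ∈ 𝓝 w₀, ∀ A ⊆ U, MeasurableSet A →
      (volume.withDensity fun w => ENNReal.ofReal (c.slope w)) A
        ≤ (ENNReal.ofReal (1 + ε) • (euclideanHausdorffMeasure m).comap fun w => c.point w 0) A := by
  set a := (InnerProductSpace.toDual ℝ (EuclideanSpace ℝ (Fin m))).symm (fderiv ℝ c.ψ w₀) with ha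
  have hna : ‖a‖ = ‖fderiv ℝ c.ψ w₀‖ := LinearIsometryEquiv.norm_map _ _
  have hslope : c.slope w₀ = √(1 + ‖a‖ ^ 2) := by rw [slope, hna]
  have hia : ∀ w, fderiv ℝ c.ψ w₀ w = inner ℝ a w := fun w => by simp [ha]
  let B : EuclideanSpace ℝ (Fin m) →L[ℝ] EuclideanSpace ℝ (Fin m) :=
    (c.flatten a).comp (c.J.toContinuousLinearMap + (fderiv ℝ c.ψ w₀).smulRight c.e)
  have hB : (B : EuclideanSpace ℝ (Fin m) →ₗ[ℝ] EuclideanSpace ℝ (Fin m))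
      = LinearMap.transvection
        ((√(1 + ‖a‖ ^ 2) - 1) • (innerSL ℝ (‖a‖⁻¹ • a)).toLinearMap) (‖a‖⁻¹ • a) := by
    refine LinearMap.ext fun w => ?_
    rw [← c.flatten_tangent, ← hia]
    rfl
  have hdet : B.det = c.slope w₀ := by
    rw [ContinuousLinearMap.det, hB, det_transvection_slope, hslope]
  have hs0 : 0 < c.slope w₀ := zero_lt_one.trans_le (c.one_le_slope w₀)
  have hderiv : HasStrictFDerivAt (fun w => c.flatten a (c.point w 0)) B w₀ := by
    refine (c.flatten a).hasStrictFDerivAt.comp w₀ ?_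
    have h1 := (c.contDiff_ψ.contDiffAt (x := w₀)).hasStrictFDerivAt (by norm_num)
    have h2 := (c.J.toContinuousLinearMap.hasStrictFDerivAt (x := w₀)).add (h1.smul_const c.e)
    refine h2.congr_of_eventuallyEq (Eventually.of_forall fun w => ?_)
    simp [point]
  -- Strictly below the determinant, as volume expansion requires, yet `(1 + ε) k > slope w₀`, which
  -- leaves room for the continuity of the slope.
  set k : NNReal := ⟨c.slope w₀ / (1 + ε / 2), by positivity⟩ with hk
  have hklt : (k : ℝ) < c.slope w₀ := by
    change c.slope w₀ / (1 + ε / 2) < _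
    rw [div_lt_iff₀ (by positivity)]
    nlinarith
  have hkdet : (k : ℝ≥0∞) < ENNReal.ofReal |B.det| := by
    rw [hdet, abs_of_pos hs0, ← ENNReal.ofReal_coe_nnreal]
    exact (ENNReal.ofReal_lt_ofReal_iff hs0).2 hklt
  obtain ⟨d, hd, hd0⟩ := ((mul_le_addHaar_image_of_lt_det volume B hkdet).and
    self_mem_nhdsWithin).exists
  obtain ⟨V, hV, happ⟩ := hderiv.approximates_deriv_on_nhds (c := d) (Or.inr hd0)
  have hkε : c.slope w₀ < (1 + ε) * k := by
    change _ < (1 + ε) * (c.slope w₀ / (1 + ε / 2))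
    rw [← mul_div_assoc, lt_div_iff₀ (by positivity)]
    nlinarith
  refine ⟨V ∩ {w | c.slope w < (1 + ε) * k}, inter_mem hV
    ((isOpen_lt c.continuous_slope continuous_const).mem_nhds hkε), fun A hA hAm => ?_⟩
  rw [withDensity_apply _ hAm, Measure.smul_apply, smul_eq_mul,
    c.measurableEmbedding_graph.comap_apply]
  calc ∫⁻ w in A, ENNReal.ofReal (c.slope w)
      ≤ ∫⁻ _ in A, ENNReal.ofReal (1 + ε) * k := by
        refine setLIntegral_mono measurable_const fun w hw => ?_
        rw [← ENNReal.ofReal_coe_nnreal, ← ENNReal.ofReal_mul (by positivity)]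
        exact ENNReal.ofReal_le_ofReal (le_of_lt (hA hw).2)
    _ = ENNReal.ofReal (1 + ε) * (k * volume A) := by
        rw [setLIntegral_const, mul_assoc]
    _ ≤ ENNReal.ofReal (1 + ε) * volume ((fun w => c.flatten a (c.point w 0)) '' A) := by
        gcongr
        exact hd A _ (happ.mono_set (hA.trans Set.inter_subset_left))
    _ ≤ _ := by
        gcongr
        have hlip : LipschitzOnWith 1 (c.flatten a) ((fun w => c.point w 0) '' A) :=
          LipschitzOnWith.of_dist_le_mul fun x _ y _ => by
            rw [dist_eq_norm, dist_eq_norm, ← map_sub, NNReal.coe_one, one_mul]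
            exact c.norm_flatten_le a _
        have := euclideanHausdorffMeasure_image_le hlip m
        rw [Set.image_image, EuclideanSpace.euclideanHausdorffMeasure_eq_volume] at this
        simpa using this

/-- The area of a graph, computed by the slope factor, is at most its Hausdorff measure. -/
lemma withDensity_slope_le :
    (volume.withDensity fun w => ENNReal.ofReal (c.slope w))
      ≤ (euclideanHausdorffMeasure m).comap fun w => c.point w 0 := by
  refine Measure.le_iff.2 fun A hA => ?_
  have h1 : Tendsto (fun ε : ℝ => ENNReal.ofReal (1 + ε) *
      ((euclideanHausdorffMeasure m).comap fun w => c.point w 0) A) (𝓝[>] 0)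
      (𝓝 (1 * ((euclideanHausdorffMeasure m).comap fun w => c.point w 0) A)) := by
    refine ENNReal.Tendsto.mul_const ?_ (Or.inl one_ne_zero)
    have : Continuous fun ε : ℝ => ENNReal.ofReal (1 + ε) :=
      ENNReal.continuous_ofReal.comp (continuous_const.add continuous_id)
    have := this.tendsto 0
    rw [add_zero, ENNReal.ofReal_one] at this
    exact this.mono_left nhdsWithin_le_nhds
  rw [one_mul] at h1
  refine ge_of_tendsto h1 (eventually_nhdsWithin_of_forall fun ε hε => ?_)
  exact measure_le_of_forall_nhds (fun w => c.exists_nhds_slope_le w hε) A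

lemma setLIntegral_slope_le (B : Set (EuclideanSpace ℝ (Fin m)))
    (g : EuclideanSpace ℝ (Fin (m + 1)) → ℝ≥0∞) :
    ∫⁻ w in B, g (c.point w 0) ∂(volume.withDensity fun w => ENNReal.ofReal (c.slope w))
      ≤ ∫⁻ x in (fun w => c.point w 0) '' B, g x ∂(euclideanHausdorffMeasure m) := by
  have hemb := c.measurableEmbedding_graph
  calc ∫⁻ w in B, g (c.point w 0) ∂(volume.withDensity fun w => ENNReal.ofReal (c.slope w))
      ≤ ∫⁻ w in B, g (c.point w 0) ∂((euclideanHausdorffMeasure m).comap fun w => c.point w 0) :=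
        lintegral_mono' (Measure.restrict_mono le_rfl c.withDensity_slope_le) le_rfl
    _ = ∫⁻ x in (fun w => c.point w 0) '' B, g x ∂(((euclideanHausdorffMeasure m).comap
          fun w => c.point w 0).map fun w => c.point w 0) := by
        rw [hemb.restrict_map, hemb.lintegral_map,
          Set.preimage_image_eq _ hemb.injective]
    _ ≤ _ := by
        rw [hemb.map_comap]
        exact lintegral_mono' (Measure.restrict_mono le_rfl Measure.restrict_le_self) le_rfl

end GraphFrame

end Hausdorff

end MeanCurvature

/-! ### Traces along the fibres of a chart -/

namespace MeanCurvature

variable {m : ℕ}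

lemma GraphFrame.setLIntegral_point (c : GraphFrame m) {A : Set (EuclideanSpace ℝ (Fin m))}
    {I : Set ℝ} {g : EuclideanSpace ℝ (Fin (m + 1)) → ℝ≥0∞} (hg : Measurable g) :
    ∫⁻ x in {x | c.base x ∈ A ∧ c.height x ∈ I}, g x
      = ∫⁻ w in A, ∫⁻ τ in I, g (c.point w τ) := by
  have hpre : (fun x : EuclideanSpace ℝ (Fin m) × ℝ => c.point x.1 x.2) ⁻¹'
      {x | c.base x ∈ A ∧ c.height x ∈ I} = A ×ˢ I := by
    ext ⟨w, τ⟩; simp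
  rw [← c.measurePreserving_point.setLIntegral_comp_preimage_emb c.measurableEmbedding_point,
    hpre, Measure.volume_eq_prod, ← Measure.prod_restrict]
  exact lintegral_prod (fun x : EuclideanSpace ℝ (Fin m) × ℝ => g (c.point x.1 x.2))
    (hg.comp c.continuous_point.measurable).aemeasurable

namespace BoundaryChart

variable {Ω : Set (EuclideanSpace ℝ (Fin (m + 1)))} (c : BoundaryChart Ω)
  {v : EuclideanSpace ℝ (Fin (m + 1)) → ℝ}

/-- The bound on the oscillation of `v` along the fibre over `w`. -/
noncomputable def fibreVariation (v : EuclideanSpace ℝ (Fin (m + 1)) → ℝ)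
    (w : EuclideanSpace ℝ (Fin m)) : ℝ≥0∞ :=
  liminf (quotientNorm c.δ fun τ => v (c.point w τ)) atTop

lemma measurable_quotientNorm (hv : Measurable v) (k : ℕ) :
    Measurable fun w => quotientNorm c.δ (fun τ => v (c.point w τ)) k := by
  unfold quotientNorm
  have h1 : Measurable fun x : EuclideanSpace ℝ (Fin m) × ℝ => v (c.point x.1 x.2) :=
    hv.comp c.continuous_point.measurable
  have h2 : Measurable fun x : EuclideanSpace ℝ (Fin m) × ℝ =>
      v (c.point x.1 (x.2 + 1 / ((k : ℝ) + 1))) :=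
    h1.comp (measurable_fst.prodMk (measurable_snd.add_const _))
  exact Measurable.lintegral_prod_right' (ν := volume.restrict (Set.Ioo 0 c.δ))
    (f := fun x : EuclideanSpace ℝ (Fin m) × ℝ =>
      ‖((k : ℝ) + 1) * (v (c.point x.1 (x.2 + 1 / ((k : ℝ) + 1))) - v (c.point x.1 x.2))‖ₑ)
    (measurable_const.mul (h2.sub h1)).enorm

lemma measurable_fibreVariation (hv : Measurable v) : Measurable (c.fibreVariation v) :=
  Measurable.liminf fun k => c.measurable_quotientNorm hv k

/-- By Fubini the left side is the `L¹` norm of the difference quotient in direction `e` over the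
region of heights in `(0, δ)`, and total variation controls it. -/
lemma lintegral_quotientNorm_le (hv : Measurable v) (hvi : Integrable v) {M : ℝ}
    (hM : ∀ g : EuclideanSpace ℝ (Fin (m + 1)) → EuclideanSpace ℝ (Fin (m + 1)), IsTest Ω g →
      (∀ x, ‖g x‖ ≤ 1) → |∫ x in Ω, v x * divergence g x| ≤ M) {k : ℕ}
    (hk : 1 / ((k : ℝ) + 1) < c.δ) :
    ∫⁻ w in c.ball, quotientNorm c.δ (fun τ => v (c.point w τ)) k ≤ ENNReal.ofReal M := by
  set h : ℝ := 1 / ((k : ℝ) + 1) with hh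
  have hh0 : 0 < h := by positivity
  set U : Set (EuclideanSpace ℝ (Fin (m + 1))) :=
    {x | c.base x ∈ c.ball ∧ c.height x ∈ Set.Ioo 0 c.δ} with hU
  have hUo : IsOpen U := (c.isOpen_ball.preimage c.base.continuous).inter
    (isOpen_Ioo.preimage c.contDiff_height.continuous)
  have htr := setIntegral_abs_translate_sub_le hUo hvi hM c.norm_e hh0.le (by
    intro x hx s hs
    -- A height below `δ` plus a shift at most `h < δ` stays below `2 δ`, the range in which the
    -- chart describes `Ω`.
    rw [← c.point_base_height x, c.point_add]
    refine (c.mem_iff _ hx.1 _ ?_).2 ?_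
    · rw [abs_lt]; constructor <;> linarith [hx.2.1, hx.2.2, hs.1, hs.2, c.δ_pos]
    · linarith [hx.2.1, hs.1])
  have hmeas : Measurable fun x => ‖((k : ℝ) + 1) * (v (x + h • c.e) - v x)‖ₑ :=
    (measurable_const.mul ((hv.comp (measurable_add_const _)).sub hv)).enorm
  have e1 := c.setLIntegral_point (A := c.ball) (I := Set.Ioo 0 c.δ) hmeas
  simp only [c.point_add] at e1
  unfold quotientNorm
  rw [← e1]
  have hint : IntegrableOn (fun x => ((k : ℝ) + 1) * (v (x + h • c.e) - v x)) U :=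
    (((hvi.comp_add_right (h • c.e)).sub hvi).const_mul _).integrableOn
  rw [← ofReal_integral_norm_eq_lintegral_enorm hint]
  refine ENNReal.ofReal_le_ofReal ?_
  have hk0 : (0 : ℝ) < (k : ℝ) + 1 := by positivity
  simp only [norm_mul, Real.norm_eq_abs, abs_of_pos hk0]
  rw [integral_const_mul]
  calc ((k : ℝ) + 1) * ∫ x in U, |v (x + h • c.e) - v x| ≤ ((k : ℝ) + 1) * (M * h) := by gcongr
    _ = M := by rw [hh]; field_simp

/-- Fatou's lemma applied to the uniform bound on the difference quotients. -/
lemma lintegral_fibreVariation_ne_top (hv : Measurable v) (hvi : Integrable v) {M : ℝ}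
    (hM : ∀ g : EuclideanSpace ℝ (Fin (m + 1)) → EuclideanSpace ℝ (Fin (m + 1)), IsTest Ω g →
      (∀ x, ‖g x‖ ≤ 1) → |∫ x in Ω, v x * divergence g x| ≤ M) :
    ∫⁻ w in c.ball, c.fibreVariation v w ≠ ∞ := by
  refine ne_top_of_le_ne_top (ENNReal.ofReal_ne_top (r := M))
    ((lintegral_liminf_le fun k => c.measurable_quotientNorm hv k).trans ?_)
  have hev : ∀ᶠ k : ℕ in atTop, 1 / ((k : ℝ) + 1) < c.δ :=
    tendsto_one_div_add_atTop_nhds_zero_nat.eventually_lt_const c.δ_pos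
  refine (liminf_le_liminf (hev.mono fun k hk => c.lintegral_quotientNorm_le hv hvi hM hk)).trans ?_
  simp

end BoundaryChart

lemma eventually_ae_Ioo {P : ℝ → Prop} (h : ∀ᶠ τ in 𝓝[>] (0 : ℝ) ⊓ ae volume, P τ) :
    ∃ η > 0, ∀ᵐ τ ∂(volume.restrict (Set.Ioo 0 η)), P τ := by
  obtain ⟨A, hA, B, hB, hAB⟩ := mem_inf_iff_superset.1 h
  obtain ⟨η, hη, hsub⟩ := mem_nhdsGT_iff_exists_Ioo_subset.1 hA
  refine ⟨η, hη, ?_⟩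
  filter_upwards [ae_restrict_of_ae (show ∀ᵐ τ, τ ∈ B from hB), ae_restrict_mem measurableSet_Ioo]
    with τ h1 h2
  exact hAB ⟨hsub h2, h1⟩

/-- The mean deviation from `a` over the interval `(0, 1 / (j + 1))`. -/
noncomputable def meanDeviation (w : ℝ → ℝ) (a : ℝ) (j : ℕ) : ℝ≥0∞ :=
  ENNReal.ofReal ((j : ℝ) + 1) * ∫⁻ τ in Set.Ioo 0 (1 / ((j : ℝ) + 1)), ‖w τ - a‖ₑ

lemma meanDeviation_le_of_ae {w : ℝ → ℝ} {a η : ℝ} {C : ℝ≥0∞}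
    (h : ∀ᵐ τ ∂(volume.restrict (Set.Ioo 0 η)), ‖w τ - a‖ₑ ≤ C) {j : ℕ}
    (hj : 1 / ((j : ℝ) + 1) ≤ η) : meanDeviation w a j ≤ C := by
  have hj0 : (0 : ℝ) < (j : ℝ) + 1 := by positivity
  have h1 : ∫⁻ τ in Set.Ioo 0 (1 / ((j : ℝ) + 1)), ‖w τ - a‖ₑ
      ≤ ∫⁻ _ in Set.Ioo (0 : ℝ) (1 / ((j : ℝ) + 1)), C :=
    lintegral_mono_ae (ae_restrict_of_ae_restrict_of_subset (Set.Ioo_subset_Ioo_right hj) h)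
  calc meanDeviation w a j
      ≤ ENNReal.ofReal ((j : ℝ) + 1) * ∫⁻ _ in Set.Ioo (0 : ℝ) (1 / ((j : ℝ) + 1)), C := by
        unfold meanDeviation; gcongr
    _ = (ENNReal.ofReal ((j : ℝ) + 1) * ENNReal.ofReal (1 / ((j : ℝ) + 1))) * C := by
        rw [setLIntegral_const, Real.volume_Ioo, sub_zero]; ring
    _ = C := by
        rw [← ENNReal.ofReal_mul hj0.le, mul_one_div_cancel hj0.ne', ENNReal.ofReal_one, one_mul]

lemma tendsto_meanDeviation {w : ℝ → ℝ} {a : ℝ}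
    (h : Tendsto w (𝓝[>] 0 ⊓ ae volume) (𝓝 a)) :
    Tendsto (meanDeviation w a) atTop (𝓝 0) := by
  rw [ENNReal.tendsto_nhds_zero]
  intro ε hε
  have h1 : Tendsto (fun τ => edist (w τ) a) (𝓝[>] 0 ⊓ ae volume) (𝓝 0) :=
    tendsto_iff_edist_tendsto_0.1 h
  obtain ⟨η, hη, hae⟩ := eventually_ae_Ioo (ENNReal.tendsto_nhds_zero.1 h1 ε hε)
  have hev : ∀ᶠ k : ℕ in atTop, 1 / ((k : ℝ) + 1) < η :=
    tendsto_one_div_add_atTop_nhds_zero_nat.eventually_lt_const hη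
  filter_upwards [hev] with k hk
  refine meanDeviation_le_of_ae (η := η) ?_ hk.le
  simpa only [edist_eq_enorm_sub] using hae

/-- Exhibits the essential limit as a limit of averages, which is what makes the fibrewise trace
measurable in the base variable. -/
lemma tendsto_mean {w : ℝ → ℝ} (hw : Integrable w) {a : ℝ}
    (h : Tendsto w (𝓝[>] 0 ⊓ ae volume) (𝓝 a)) :
    Tendsto (fun j : ℕ => ((j : ℝ) + 1) * ∫ τ in Set.Ioo 0 (1 / ((j : ℝ) + 1)), w τ) atTop
      (𝓝 a) := by
  rw [tendsto_iff_edist_tendsto_0]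
  refine tendsto_of_tendsto_of_tendsto_of_le_of_le tendsto_const_nhds (tendsto_meanDeviation h)
    (fun _ => zero_le) fun j => ?_
  have hj0 : (0 : ℝ) < (j : ℝ) + 1 := by positivity
  have e : ((j : ℝ) + 1) * (∫ τ in Set.Ioo 0 (1 / ((j : ℝ) + 1)), w τ) - a
      = ((j : ℝ) + 1) * ∫ τ in Set.Ioo 0 (1 / ((j : ℝ) + 1)), (w τ - a) := by
    rw [integral_sub hw.integrableOn (integrableOn_const (hs := by simp)), setIntegral_const,
      Real.volume_real_Ioo_of_le (by positivity), sub_zero, smul_eq_mul, mul_sub, ← mul_assoc,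
      mul_one_div_cancel hj0.ne', one_mul]
  simp only [edist_eq_enorm_sub, e, enorm_mul, meanDeviation]
  rw [Real.enorm_of_nonneg hj0.le]
  gcongr
  exact enorm_integral_le_lintegral_enorm _

namespace BoundaryChart

variable {Ω : Set (EuclideanSpace ℝ (Fin (m + 1)))} (c : BoundaryChart Ω)
  {v : EuclideanSpace ℝ (Fin (m + 1)) → ℝ}

/-- `T` is the trace of `v` in the chart `c`, as an essential limit along the fibres. -/
structure IsFibreTrace (v : EuclideanSpace ℝ (Fin (m + 1)) → ℝ)
    (T : EuclideanSpace ℝ (Fin m) → ℝ) : Prop where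
  measurable : Measurable T
  integrableOn : IntegrableOn T c.ball
  tendsto : ∀ᵐ w ∂(volume.restrict c.ball),
    Tendsto (fun τ => v (c.point w τ)) (𝓝[>] 0 ⊓ ae volume) (𝓝 (T w))
  enorm_sub_le : ∀ᵐ w ∂(volume.restrict c.ball), ∀ᵐ τ ∂(volume.restrict (Set.Ioo 0 c.δ)),
    ‖v (c.point w τ) - T w‖ₑ ≤ c.fibreVariation v w

lemma measurable_fibre_mean (hv : Measurable v) (j : ℕ) :
    StronglyMeasurable fun w =>
      ((j : ℝ) + 1) * ∫ τ in Set.Ioo 0 (1 / ((j : ℝ) + 1)), v (c.point w τ) := by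
  refine StronglyMeasurable.const_mul ?_ _
  exact StronglyMeasurable.integral_prod_right'
    (f := fun x : EuclideanSpace ℝ (Fin m) × ℝ => v (c.point x.1 x.2))
    (hv.comp c.continuous_point.measurable).stronglyMeasurable

/-- For a.e. `τ`, `|T w|` is at most `|v|` at height `τ` plus the fibre variation. Averaging over `τ
∈ (0, δ)` and integrating over `w` leaves two finite terms. -/
lemma lintegral_enorm_trace_ne_top (hv : Measurable v) (hvi : Integrable v)
    (hV : ∫⁻ w in c.ball, c.fibreVariation v w ≠ ∞) {T : EuclideanSpace ℝ (Fin m) → ℝ}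
    (h : ∀ᵐ w ∂(volume.restrict c.ball), ∀ᵐ τ ∂(volume.restrict (Set.Ioo 0 c.δ)),
      ‖v (c.point w τ) - T w‖ₑ ≤ c.fibreVariation v w) :
    ∫⁻ w in c.ball, ‖T w‖ₑ ≠ ∞ := by
  have hδ := c.δ_pos
  have hδ' : ENNReal.ofReal c.δ ≠ 0 := by simpa using hδ
  have h1 : ∀ᵐ w ∂(volume.restrict c.ball), ENNReal.ofReal c.δ * ‖T w‖ₑ
      ≤ (∫⁻ τ in Set.Ioo 0 c.δ, ‖v (c.point w τ)‖ₑ)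
        + c.fibreVariation v w * ENNReal.ofReal c.δ := by
    filter_upwards [h] with w hw
    have h2 : ∀ᵐ τ ∂(volume.restrict (Set.Ioo 0 c.δ)),
        ‖T w‖ₑ ≤ ‖v (c.point w τ)‖ₑ + c.fibreVariation v w := by
      filter_upwards [hw] with τ hτ
      have e : T w = v (c.point w τ) - (v (c.point w τ) - T w) := by ring
      calc ‖T w‖ₑ = ‖v (c.point w τ) - (v (c.point w τ) - T w)‖ₑ := by rw [← e]
        _ ≤ ‖v (c.point w τ)‖ₑ + ‖v (c.point w τ) - T w‖ₑ := enorm_sub_le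
        _ ≤ _ := by gcongr
    have h3 := lintegral_mono_ae h2
    rw [lintegral_add_right _ measurable_const, setLIntegral_const, setLIntegral_const,
      Real.volume_Ioo, sub_zero, mul_comm] at h3
    exact h3
  have hvm : Measurable fun x => ‖v x‖ₑ := hv.enorm
  have e1 := c.setLIntegral_point (A := c.ball) (I := Set.Ioo 0 c.δ) hvm
  have h4 : ∫⁻ w in c.ball, ENNReal.ofReal c.δ * ‖T w‖ₑ ≠ ∞ := by
    refine ne_top_of_le_ne_top ?_ (lintegral_mono_ae h1)
    rw [lintegral_add_right _ ((c.measurable_fibreVariation hv).mul_const _), ← e1,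
      lintegral_mul_const _ (c.measurable_fibreVariation hv)]
    refine ENNReal.add_ne_top.2 ⟨?_, ENNReal.mul_ne_top hV ENNReal.ofReal_ne_top⟩
    exact hvi.integrableOn.2.ne
  rw [lintegral_const_mul' _ _ ENNReal.ofReal_ne_top] at h4
  intro htop
  rw [htop, ENNReal.mul_top hδ'] at h4
  exact h4 rfl

lemma exists_isFibreTrace (hv : Measurable v) (hvi : Integrable v)
    (hV : ∫⁻ w in c.ball, c.fibreVariation v w ≠ ∞) : ∃ T, c.IsFibreTrace v T := by
  have hprod : Integrable (fun x : EuclideanSpace ℝ (Fin m) × ℝ => v (c.point x.1 x.2)) :=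
    (c.measurePreserving_point.integrable_comp_emb c.measurableEmbedding_point).2 hvi
  rw [Measure.volume_eq_prod] at hprod
  have hfib : ∀ᵐ w ∂(volume.restrict c.ball), Integrable fun τ => v (c.point w τ) :=
    ae_restrict_of_ae hprod.prod_right_ae
  have hfin : ∀ᵐ w ∂(volume.restrict c.ball), c.fibreVariation v w < ∞ :=
    ae_lt_top (c.measurable_fibreVariation hv) hV
  -- The hypotheses on the fibre sit inside the existential, so that a value can be chosen for every
  -- `w`; on the exceptional null set it is `0`.
  have hex : ∀ w, ∃ a : ℝ, ((Integrable fun τ => v (c.point w τ)) → c.fibreVariation v w < ∞ →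
      Tendsto (fun τ => v (c.point w τ)) (𝓝[>] 0 ⊓ ae volume) (𝓝 a) ∧
      ∀ᵐ τ ∂(volume.restrict (Set.Ioo 0 c.δ)),
        ‖v (c.point w τ) - a‖ₑ ≤ c.fibreVariation v w) := by
    intro w
    by_cases h : (Integrable fun τ => v (c.point w τ)) ∧ c.fibreVariation v w < ∞
    · obtain ⟨a, ha⟩ := exists_essLimit h.1 c.δ_pos h.2.ne
      exact ⟨a, fun _ _ => ha⟩
    · exact ⟨0, fun h1 h2 => absurd ⟨h1, h2⟩ h⟩
  choose T hT using hex
  have hTm : AEMeasurable T (volume.restrict c.ball) := by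
    refine aemeasurable_of_tendsto_metrizable_ae atTop
      (fun j => (c.measurable_fibre_mean hv j).measurable.aemeasurable) ?_
    filter_upwards [hfib, hfin] with w h1 h2
    exact tendsto_mean h1 (hT w h1 h2).1
  have hbound : ∀ᵐ w ∂(volume.restrict c.ball), ∀ᵐ τ ∂(volume.restrict (Set.Ioo 0 c.δ)),
      ‖v (c.point w τ) - hTm.mk T w‖ₑ ≤ c.fibreVariation v w := by
    filter_upwards [hfib, hfin, hTm.ae_eq_mk] with w h1 h2 h3
    rw [← h3]
    exact (hT w h1 h2).2
  refine ⟨hTm.mk T, hTm.measurable_mk, ⟨hTm.measurable_mk.aestronglyMeasurable, ?_⟩, ?_, hbound⟩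
  · exact (c.lintegral_enorm_trace_ne_top hv hvi hV hbound).lt_top
  · filter_upwards [hfib, hfin, hTm.ae_eq_mk] with w h1 h2 h3
    rw [← h3]
    exact (hT w h1 h2).1

end BoundaryChart

end MeanCurvature

/-! ### From fibrewise limits to traces by averages -/

namespace MeanCurvature

lemma hasTraceAt_of_lintegral {n : ℕ} {Ω : Set (EuclideanSpace ℝ (Fin n))}
    {v : EuclideanSpace ℝ (Fin n) → ℝ} (hv : IntegrableOn v Ω) {x : EuclideanSpace ℝ (Fin n)}
    {a : ℝ} (h : Tendsto (fun r : ℝ => (∫⁻ y in Metric.ball x r ∩ Ω, ‖v y - a‖ₑ)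
      / ENNReal.ofReal (r ^ n)) (𝓝[>] 0) (𝓝 0)) : HasTraceAt Ω v x a := by
  have h1 := (ENNReal.tendsto_toReal ENNReal.zero_ne_top).comp h
  refine h1.congr' (eventually_nhdsWithin_of_forall fun r hr => ?_)
  have hr0 : (0 : ℝ) < r := hr
  have hm : AEStronglyMeasurable (fun y => v y - a)
      (volume.restrict (Metric.ball x r ∩ Ω)) :=
    (hv.mono_set Set.inter_subset_right).1.sub aestronglyMeasurable_const
  simp only [Function.comp, ENNReal.toReal_div]
  rw [ENNReal.toReal_ofReal (by positivity), ← integral_norm_eq_lintegral_enorm hm]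
  simp only [Real.norm_eq_abs]

namespace BoundaryChart

variable {m : ℕ} {Ω : Set (EuclideanSpace ℝ (Fin (m + 1)))} (c : BoundaryChart Ω)
  {v : EuclideanSpace ℝ (Fin (m + 1)) → ℝ} {T : EuclideanSpace ℝ (Fin m) → ℝ}

/-- The supremum of the mean deviations of `v` from `T` over the fibres, at scales at most
`1 / (k + 1)`. -/
noncomputable def supDeviation (v : EuclideanSpace ℝ (Fin (m + 1)) → ℝ)
    (T : EuclideanSpace ℝ (Fin m) → ℝ) (k : ℕ) (w : EuclideanSpace ℝ (Fin m)) : ℝ≥0∞ :=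
  ⨆ j : ℕ, meanDeviation (fun τ => v (c.point w τ)) (T w) (j + k)

lemma measurable_enorm_sub (hv : Measurable v) (hT : Measurable T) :
    Measurable fun x : EuclideanSpace ℝ (Fin m) × ℝ => ‖v (c.point x.1 x.2) - T x.1‖ₑ :=
  ((hv.comp c.continuous_point.measurable).sub (hT.comp measurable_fst)).enorm

lemma measurable_supDeviation (hv : Measurable v) (hT : Measurable T) (k : ℕ) :
    Measurable (c.supDeviation v T k) := by
  refine Measurable.iSup fun j => ?_
  unfold meanDeviation
  exact (Measurable.lintegral_prod_right' (c.measurable_enorm_sub hv hT)).const_mul _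

lemma tendsto_supDeviation {w : EuclideanSpace ℝ (Fin m)}
    (h : Tendsto (fun τ => v (c.point w τ)) (𝓝[>] 0 ⊓ ae volume) (𝓝 (T w))) :
    Tendsto (fun k => c.supDeviation v T k w) atTop (𝓝 0) := by
  rw [ENNReal.tendsto_nhds_zero]
  intro ε hε
  obtain ⟨N, hN⟩ := eventually_atTop.1 (ENNReal.tendsto_nhds_zero.1 (tendsto_meanDeviation h) ε hε)
  exact eventually_atTop.2 ⟨N, fun k hk => iSup_le fun j => hN _ (hk.trans (Nat.le_add_left k j))⟩

lemma supDeviation_le {w : EuclideanSpace ℝ (Fin m)}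
    (h : ∀ᵐ τ ∂(volume.restrict (Set.Ioo 0 c.δ)),
      ‖v (c.point w τ) - T w‖ₑ ≤ c.fibreVariation v w) {k : ℕ}
    (hk : 1 / ((k : ℝ) + 1) ≤ c.δ) : c.supDeviation v T k w ≤ c.fibreVariation v w := by
  refine iSup_le fun j => meanDeviation_le_of_ae h (le_trans ?_ hk)
  push_cast
  gcongr
  linarith [(Nat.cast_nonneg j : (0 : ℝ) ≤ j)]

/-- At small scales the deviation over a fibre is controlled by `supDeviation`. -/
lemma lintegral_Ioo_le_supDeviation (w : EuclideanSpace ℝ (Fin m)) {k : ℕ} {s : ℝ} (hs : 0 < s)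
    (hsk : s ≤ 1 / ((k : ℝ) + 1)) :
    ∫⁻ τ in Set.Ioo 0 s, ‖v (c.point w τ) - T w‖ₑ
      ≤ ENNReal.ofReal (2 * s) * c.supDeviation v T k w := by
  have hk0 : (0 : ℝ) < (k : ℝ) + 1 := by positivity
  have hinv : ((k + 1 : ℕ) : ℝ) ≤ 1 / s := by
    rw [le_div_iff₀ hs]
    rw [le_div_iff₀ hk0] at hsk
    push_cast
    linarith
  -- Round `s` up to `1 / q` with `q = ⌊1 / s⌋ = j + k + 1`. Then `s ≤ 1 / q ≤ 2 s`, which is where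
  -- the factor `2` comes from.
  have hfl : k + 1 ≤ ⌊1 / s⌋₊ := Nat.le_floor hinv
  obtain ⟨j, hj⟩ := Nat.exists_eq_add_of_le hfl
  have hj' : ⌊1 / s⌋₊ = j + k + 1 := by omega
  have h1 : ((j + k : ℕ) : ℝ) + 1 ≤ 1 / s := by
    have := Nat.floor_le (show 0 ≤ 1 / s by positivity)
    rw [hj'] at this
    exact_mod_cast this
  have h2 : 1 / s < ((j + k : ℕ) : ℝ) + 1 + 1 := by
    have := Nat.lt_floor_add_one (1 / s)
    rw [hj'] at this
    exact_mod_cast this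
  set q : ℝ := ((j + k : ℕ) : ℝ) + 1 with hq
  have hq1 : 1 ≤ q := by rw [hq]; linarith [(Nat.cast_nonneg (j + k) : (0 : ℝ) ≤ ((j + k : ℕ) : ℝ))]
  have hq0 : 0 < q := by linarith
  have h3 : s ≤ 1 / q := by
    rw [le_div_iff₀ hq0]; rw [le_div_iff₀ hs] at h1; linarith
  have h4 : 1 ≤ 2 * s * q := by
    rw [div_lt_iff₀ hs] at h2; nlinarith
  calc ∫⁻ τ in Set.Ioo 0 s, ‖v (c.point w τ) - T w‖ₑ
      ≤ ∫⁻ τ in Set.Ioo 0 (1 / q), ‖v (c.point w τ) - T w‖ₑ :=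
        lintegral_mono_set (Set.Ioo_subset_Ioo_right h3)
    _ = 1 * ∫⁻ τ in Set.Ioo 0 (1 / q), ‖v (c.point w τ) - T w‖ₑ := (one_mul _).symm
    _ ≤ ENNReal.ofReal (2 * s * q) * ∫⁻ τ in Set.Ioo 0 (1 / q), ‖v (c.point w τ) - T w‖ₑ := by
        gcongr
        rw [← ENNReal.ofReal_one]
        exact ENNReal.ofReal_le_ofReal h4
    _ = ENNReal.ofReal (2 * s) *
        meanDeviation (fun τ => v (c.point w τ)) (T w) (j + k) := by
        rw [ENNReal.ofReal_mul (by positivity), mul_assoc]; rfl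
    _ ≤ _ := by
        gcongr
        exact le_iSup (fun j => meanDeviation (fun τ => v (c.point w τ)) (T w) (j + k)) j

/-- Small balls around a boundary point meet `Ω` in the region above a small ball of the base,
at small height. -/
lemma exists_ball_inter_subset {w : EuclideanSpace ℝ (Fin m)} (hw : w ∈ c.ball) :
    ∃ C : ℝ, 0 < C ∧ ∀ᶠ r in 𝓝[>] (0 : ℝ), Metric.closedBall w r ⊆ c.ball ∧
      Metric.ball (c.point w 0) r ∩ Ω ⊆
        {x | c.base x ∈ Metric.closedBall w r ∧ c.height x ∈ Set.Ioo 0 (C * r)} := by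
  obtain ⟨L, hL⟩ := c.exists_lipschitzOnWith w 1
  have hd : c.point w 0 ∈ c.domain := c.point_mem_domain hw (by simpa using c.δ_pos)
  obtain ⟨R, hR, hRsub⟩ := Metric.isOpen_iff.1 c.isOpen_domain _ hd
  obtain ⟨R', hR', hRsub'⟩ := Metric.isOpen_iff.1 c.isOpen_ball _ hw
  -- A Lipschitz constant of the height near the boundary point, where the height vanishes.
  refine ⟨1 + L, by positivity, ?_⟩
  filter_upwards [Ioo_mem_nhdsGT (lt_min (lt_min hR hR') one_pos)] with r hr
  have hr1 : r < 1 := hr.2.trans_le (min_le_right _ _)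
  have hrR : r < R := hr.2.trans_le ((min_le_left _ _).trans (min_le_left _ _))
  have hrR' : r < R' := hr.2.trans_le ((min_le_left _ _).trans (min_le_right _ _))
  refine ⟨(Metric.closedBall_subset_ball hrR').trans hRsub', ?_⟩
  rintro y ⟨hy, hyΩ⟩
  have hyd : y ∈ c.domain := hRsub (Metric.ball_subset_ball hrR.le hy)
  rw [Metric.mem_ball, dist_eq_norm] at hy
  set z := y - c.point w 0 with hz
  have hyz : y = c.point w 0 + z := by rw [hz]; abel
  have hb : c.base y - w = c.base z := by rw [hz, map_sub, c.base_point]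
  have hbz : ‖c.base z‖ ≤ ‖z‖ := c.norm_base_le z
  have hbw : dist (c.base y) w ≤ ‖z‖ := by rw [dist_eq_norm, hb]; exact hbz
  refine ⟨Metric.mem_closedBall.2 (hbw.trans hy.le), (c.mem_iff_of_mem_domain hyd).1 hyΩ, ?_⟩
  have hin : inner ℝ y c.e = inner ℝ (c.point w 0) c.e + inner ℝ z c.e := by
    conv_lhs => rw [hyz]
    exact inner_add_left _ _ _
  have hinz : inner ℝ z c.e ≤ ‖z‖ := by
    have := abs_real_inner_le_norm z c.e
    rw [c.norm_e, mul_one] at this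
    exact (abs_le.1 this).2
  have hψ : c.ψ w - c.ψ (c.base y) ≤ L * ‖z‖ := by
    have h3 := hL.dist_le_mul w (Metric.mem_closedBall_self zero_le_one) (c.base y)
      (Metric.mem_closedBall.2 (hbw.trans (hy.le.trans hr1.le)))
    rw [Real.dist_eq, dist_comm] at h3
    exact (le_abs_self _).trans (h3.trans (mul_le_mul_of_nonneg_left hbw L.coe_nonneg))
  have h0 : c.height (c.point w 0) = 0 := c.height_point w 0
  have h5 : c.height y ≤ (1 + L) * ‖z‖ := by
    rw [GraphFrame.height, c.base_point] at h0
    rw [GraphFrame.height]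
    linarith
  exact h5.trans_lt (by have := L.coe_nonneg; gcongr)

/-- On the fibre over `w'` split `v - T w` into `v - T w'`, controlled by `supDeviation`, and `T w'
- T w`, constant along the fibre of length `C r`. Both remainders are integrals over a ball of the
base, ready for Lebesgue differentiation. -/
lemma setLIntegral_ball_le (hv : Measurable v) (hT : Measurable T) {w : EuclideanSpace ℝ (Fin m)}
    {C r : ℝ} (hC : 0 < C) (hr : 0 < r) {k : ℕ} (hk : C * r ≤ 1 / ((k : ℝ) + 1))
    (hball : Metric.closedBall w r ⊆ c.ball)
    (hsub : Metric.ball (c.point w 0) r ∩ Ω ⊆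
        {x | c.base x ∈ Metric.closedBall w r ∧ c.height x ∈ Set.Ioo 0 (C * r)}) :
    ∫⁻ y in Metric.ball (c.point w 0) r ∩ Ω, ‖v y - T w‖ₑ ≤
      ENNReal.ofReal (C * r) * (2 * (∫⁻ w' in Metric.closedBall w r,
        c.ball.indicator (c.supDeviation v T k) w') +
        ∫⁻ w' in Metric.closedBall w r, ‖c.ball.indicator T w' - c.ball.indicator T w‖ₑ) := by
  have hCr : 0 < C * r := mul_pos hC hr
  have hm : Measurable fun y => ‖v y - T w‖ₑ := (hv.sub_const _).enorm
  have hwb : w ∈ c.ball := hball (Metric.mem_closedBall_self hr.le)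
  calc ∫⁻ y in Metric.ball (c.point w 0) r ∩ Ω, ‖v y - T w‖ₑ
      ≤ ∫⁻ y in {x | c.base x ∈ Metric.closedBall w r ∧ c.height x ∈ Set.Ioo 0 (C * r)},
          ‖v y - T w‖ₑ := lintegral_mono_set hsub
    _ = ∫⁻ w' in Metric.closedBall w r, ∫⁻ τ in Set.Ioo 0 (C * r),
          ‖v (c.point w' τ) - T w‖ₑ := c.setLIntegral_point hm
    _ ≤ ∫⁻ w' in Metric.closedBall w r, (ENNReal.ofReal (C * r) * (2 *
          c.ball.indicator (c.supDeviation v T k) w') + ENNReal.ofReal (C * r) *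
          ‖c.ball.indicator T w' - c.ball.indicator T w‖ₑ) := by
        refine setLIntegral_mono' Metric.isClosed_closedBall.measurableSet fun w' hw' => ?_
        rw [Set.indicator_of_mem (hball hw'), Set.indicator_of_mem (hball hw'),
          Set.indicator_of_mem hwb]
        calc ∫⁻ τ in Set.Ioo 0 (C * r), ‖v (c.point w' τ) - T w‖ₑ
            ≤ ∫⁻ τ in Set.Ioo 0 (C * r), (‖v (c.point w' τ) - T w'‖ₑ + ‖T w' - T w‖ₑ) := by
              refine lintegral_mono fun τ => ?_
              have e : v (c.point w' τ) - T w
                  = (v (c.point w' τ) - T w') + (T w' - T w) := by ring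
              rw [e]
              exact enorm_add_le _ _
          _ = (∫⁻ τ in Set.Ioo 0 (C * r), ‖v (c.point w' τ) - T w'‖ₑ)
                + ENNReal.ofReal (C * r) * ‖T w' - T w‖ₑ := by
              rw [lintegral_add_right _ measurable_const, setLIntegral_const, Real.volume_Ioo,
                sub_zero, mul_comm (‖T w' - T w‖ₑ)]
          _ ≤ _ := by
              gcongr
              refine (c.lintegral_Ioo_le_supDeviation w' hCr hk).trans (le_of_eq ?_)
              rw [mul_comm (2 : ℝ), ENNReal.ofReal_mul hCr.le]
              simp [mul_assoc]
    _ = _ := by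
        have hTm : Measurable fun w' =>
            ENNReal.ofReal (C * r) * ‖c.ball.indicator T w' - c.ball.indicator T w‖ₑ :=
          (((hT.indicator c.measurableSet_ball).sub_const _).enorm).const_mul _
        rw [lintegral_add_right _ hTm, lintegral_const_mul' _ _ ENNReal.ofReal_ne_top,
          lintegral_const_mul' _ _ ENNReal.ofReal_ne_top, lintegral_const_mul' _ _ (by simp),
          mul_add]

/-- The fibrewise trace is the trace in the sense of averages. -/
lemma IsFibreTrace.hasTraceAt {c : BoundaryChart Ω} (h : c.IsFibreTrace v T) (hv : Measurable v)
    (hvi : Integrable v) (hV : ∫⁻ w in c.ball, c.fibreVariation v w ≠ ∞) :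
    ∀ᵐ w ∂(volume.restrict c.ball), HasTraceAt Ω v (c.point w 0) (T w) := by
  let 𝓕 := IsUnifLocDoublingMeasure.vitaliFamily (volume : Measure (EuclideanSpace ℝ (Fin m))) 1
  -- For such `k` the function `supDeviation` is dominated by the integrable fibre variation, so
  -- a.e. `w` is a differentiation point, for all these `k` at once.
  have hN : ∀ k : ℕ, 1 / ((k : ℝ) + 1) ≤ c.δ → ∀ᵐ w : EuclideanSpace ℝ (Fin m),
      Tendsto (fun A => (∫⁻ w' in A, c.ball.indicator (c.supDeviation v T k) w') / volume A)
        (𝓕.filterAt w) (𝓝 (c.ball.indicator (c.supDeviation v T k) w)) := by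
    intro k hk
    refine 𝓕.ae_tendsto_lintegral_div ((c.measurable_supDeviation hv h.measurable k).indicator
      c.measurableSet_ball).aemeasurable ?_
    rw [lintegral_indicator c.measurableSet_ball]
    refine ne_top_of_le_ne_top hV (lintegral_mono_ae ?_)
    filter_upwards [h.enorm_sub_le] with w hw
    exact c.supDeviation_le hw hk
  have hN' : ∀ᵐ w : EuclideanSpace ℝ (Fin m), ∀ k : ℕ, 1 / ((k : ℝ) + 1) ≤ c.δ →
      Tendsto (fun A => (∫⁻ w' in A, c.ball.indicator (c.supDeviation v T k) w') / volume A)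
        (𝓕.filterAt w) (𝓝 (c.ball.indicator (c.supDeviation v T k) w)) := by
    rw [ae_all_iff]
    intro k
    by_cases hk : 1 / ((k : ℝ) + 1) ≤ c.δ
    · filter_upwards [hN k hk] with w hw _ using hw
    · exact Eventually.of_forall fun w hk' => absurd hk' hk
  have hTi : Integrable (c.ball.indicator T) :=
    (integrable_indicator_iff c.measurableSet_ball).2 h.integrableOn
  have hT := 𝓕.ae_tendsto_lintegral_enorm_sub_div hTi.locallyIntegrable
  filter_upwards [ae_restrict_of_ae hN', ae_restrict_of_ae hT, h.tendsto,
    ae_restrict_mem c.measurableSet_ball] with w h1 h2 h3 hw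
  obtain ⟨C, hC, hev⟩ := c.exists_ball_inter_subset hw
  refine hasTraceAt_of_lintegral hvi.integrableOn ?_
  have hcb : Tendsto (fun r : ℝ => Metric.closedBall w r) (𝓝[>] 0) (𝓕.filterAt w) :=
    IsUnifLocDoublingMeasure.tendsto_closedBall_filterAt volume (fun _ => w) id tendsto_id
      (eventually_nhdsWithin_of_forall fun r hr => by
        have : (0 : ℝ) < r := hr
        simpa using this.le)
  -- The factor that turns `C r / r^{m+1}` into the reciprocal volume of the base ball of radius
  -- `r`.
  set κ : ℝ≥0∞ := ENNReal.ofReal C * volume (Metric.closedBall (0 : EuclideanSpace ℝ (Fin m)) 1)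
    with hκ
  have hκt : κ ≠ ∞ := ENNReal.mul_ne_top ENNReal.ofReal_ne_top measure_closedBall_lt_top.ne
  rw [ENNReal.tendsto_nhds_zero]
  intro ε hε
  -- The order of limits matters: `k` is fixed first, making the value at `w` less than `ε`; then `r
  -- ↓ 0` with `C r < 1 / (k + 1)`.
  have h4 : Tendsto (fun k => κ * (2 * c.supDeviation v T k w + 0)) atTop (𝓝 0) := by
    have h5 := ENNReal.Tendsto.const_mul (a := κ)
      ((ENNReal.Tendsto.const_mul (a := 2) (c.tendsto_supDeviation h3)
        (Or.inr (by simp))).add_const 0) (Or.inr hκt)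
    simpa using h5
  obtain ⟨k, hk1, hk2⟩ := ((h4.eventually_lt_const hε).and
    (tendsto_one_div_add_atTop_nhds_zero_nat.eventually_lt_const c.δ_pos)).exists
  have h6 := ((ENNReal.Tendsto.const_mul (a := 2) ((h1 k hk2.le).comp hcb)
    (Or.inr (by simp))).add (h2.comp hcb))
  have h7 := ENNReal.Tendsto.const_mul (a := κ) h6 (Or.inr hκt)
  rw [Set.indicator_of_mem hw (c.supDeviation v T k)] at h7
  have hsmall : ∀ᶠ r in 𝓝[>] (0 : ℝ), C * r < 1 / ((k : ℝ) + 1) := by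
    have h8 : Tendsto (fun r : ℝ => C * r) (𝓝[>] 0) (𝓝 0) := by
      have := (continuous_const_mul C).tendsto (0 : ℝ)
      rw [mul_zero] at this
      exact this.mono_left nhdsWithin_le_nhds
    exact h8.eventually_lt_const (by positivity)
  filter_upwards [h7.eventually_lt_const hk1, hev, hsmall, self_mem_nhdsWithin]
    with r hr1 hr2 hr3 hr0
  have hr0' : (0 : ℝ) < r := hr0
  refine le_trans ?_ hr1.le
  refine (ENNReal.div_le_div_right
    (c.setLIntegral_ball_le hv h.measurable hC hr0' hr3.le hr2.1 hr2.2) _).trans (le_of_eq ?_)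
  have hvol : volume (Metric.closedBall w r) = ENNReal.ofReal (r ^ m)
      * volume (Metric.closedBall (0 : EuclideanSpace ℝ (Fin m)) 1) := by
    rw [Measure.addHaar_closedBall' _ _ hr0'.le]; simp
  have hω0 : volume (Metric.closedBall (0 : EuclideanSpace ℝ (Fin m)) 1) ≠ 0 :=
    (Metric.measure_closedBall_pos _ _ one_pos).ne'
  have hωt : volume (Metric.closedBall (0 : EuclideanSpace ℝ (Fin m)) 1) ≠ ∞ :=
    measure_closedBall_lt_top.ne
  have hrm0 : ENNReal.ofReal (r ^ m) ≠ 0 := by simpa using pow_pos hr0' m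
  have hr00 : ENNReal.ofReal r ≠ 0 := by simpa using hr0'
  simp only [Function.comp]
  rw [hvol, hκ, pow_succ, ENNReal.ofReal_mul hC.le,
    ENNReal.ofReal_mul (p := r ^ m) (by positivity)]
  generalize (∫⁻ w' in Metric.closedBall w r, c.ball.indicator (c.supDeviation v T k) w') = X
  generalize (∫⁻ w' in Metric.closedBall w r, ‖c.ball.indicator T w' - c.ball.indicator T w‖ₑ) = Y
  generalize volume (Metric.closedBall (0 : EuclideanSpace ℝ (Fin m)) 1) = ω at hω0 hωt
  have hrt : ENNReal.ofReal r ≠ ∞ := ENNReal.ofReal_ne_top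
  have hrmt : ENNReal.ofReal (r ^ m) ≠ ∞ := ENNReal.ofReal_ne_top
  generalize ENNReal.ofReal r = R at hr00 hrt
  generalize ENNReal.ofReal (r ^ m) = Q at hrm0 hrmt
  generalize ENNReal.ofReal C = D
  simp only [div_eq_mul_inv]
  rw [ENNReal.mul_inv (Or.inl hrm0) (Or.inl hrmt), ENNReal.mul_inv (Or.inl hrm0) (Or.inl hrmt)]
  have e1 := ENNReal.mul_inv_cancel hr00 hrt
  have e2 := ENNReal.mul_inv_cancel hω0 hωt
  calc D * R * (2 * X + Y) * (Q⁻¹ * R⁻¹) = D * (2 * X + Y) * Q⁻¹ * (R * R⁻¹) := by ring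
    _ = D * (2 * X + Y) * Q⁻¹ * (ω * ω⁻¹) := by rw [e1, e2]
    _ = _ := by ring

end BoundaryChart

end MeanCurvature

namespace MeanCurvature

/-! ### Cut-off profiles and approximate identities -/

section Profile

/-- A smooth nondecreasing profile, equal to `0` on `(-∞, 1]` and to `1` on `[2, ∞)`. -/
noncomputable def profile (t : ℝ) : ℝ := Real.smoothTransition (t - 1)

lemma contDiff_profile : ContDiff ℝ 1 profile :=
  Real.smoothTransition.contDiff.comp (contDiff_id.sub contDiff_const)

lemma profile_mem_Icc (t : ℝ) : profile t ∈ Set.Icc (0 : ℝ) 1 :=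
  ⟨Real.smoothTransition.nonneg _, Real.smoothTransition.le_one _⟩

lemma profile_of_le_one {t : ℝ} (h : t ≤ 1) : profile t = 0 :=
  Real.smoothTransition.zero_of_nonpos (by linarith)

lemma profile_of_two_le {t : ℝ} (h : 2 ≤ t) : profile t = 1 :=
  Real.smoothTransition.one_of_one_le (by linarith)

lemma monotone_profile : Monotone profile := fun _ _ h =>
  Real.smoothTransition.monotone (by linarith)

lemma deriv_profile_nonneg (t : ℝ) : 0 ≤ deriv profile t := monotone_profile.deriv_nonneg

lemma hasDerivAt_profile (t : ℝ) : HasDerivAt profile (deriv profile t) t :=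
  (contDiff_profile.differentiable (by norm_num) t).hasDerivAt

lemma continuous_deriv_profile : Continuous (deriv profile) :=
  contDiff_profile.continuous_deriv (by norm_num)

lemma deriv_profile_of_two_lt {t : ℝ} (h : 2 < t) : deriv profile t = 0 := by
  have : profile =ᶠ[𝓝 t] fun _ => 1 := by
    filter_upwards [lt_mem_nhds h] with s hs using profile_of_two_le hs.le
  rw [this.deriv_eq]; simp

/-- The derivative of the profile at scale `1 / (k + 1)`, an approximate identity. -/
noncomputable def kernel (k : ℕ) (τ : ℝ) : ℝ := ((k : ℝ) + 1) * deriv profile (((k : ℝ) + 1) * τ)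

lemma kernel_nonneg (k : ℕ) (τ : ℝ) : 0 ≤ kernel k τ :=
  mul_nonneg (by positivity) (deriv_profile_nonneg _)

lemma continuous_kernel (k : ℕ) : Continuous (kernel k) :=
  continuous_const.mul (continuous_deriv_profile.comp (continuous_const.mul continuous_id))

lemma hasDerivAt_profile_mul (k : ℕ) (τ : ℝ) :
    HasDerivAt (fun τ => profile (((k : ℝ) + 1) * τ)) (kernel k τ) τ := by
  have h1 : HasDerivAt (fun τ : ℝ => ((k : ℝ) + 1) * τ) ((k : ℝ) + 1) τ := by
    simpa using (hasDerivAt_id τ).const_mul ((k : ℝ) + 1)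
  have := (hasDerivAt_profile (((k : ℝ) + 1) * τ)).comp τ h1
  rwa [mul_comm] at this

lemma lintegral_kernel_le {δ : ℝ} (hδ : 0 < δ) (k : ℕ) :
    ∫⁻ τ in Set.Ioo 0 δ, ENNReal.ofReal (kernel k τ) ≤ 1 := by
  have hi : IntervalIntegrable (kernel k) volume 0 δ := (continuous_kernel k).intervalIntegrable _ _
  have h1 : ∫ τ in (0 : ℝ)..δ, kernel k τ ≤ 1 := by
    rw [intervalIntegral.integral_eq_sub_of_hasDerivAt (fun τ _ => hasDerivAt_profile_mul k τ) hi]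
    have h2 := (profile_mem_Icc (((k : ℝ) + 1) * δ)).2
    have h3 := (profile_mem_Icc (((k : ℝ) + 1) * 0)).1
    linarith
  rw [intervalIntegral.integral_of_le hδ.le] at h1
  calc ∫⁻ τ in Set.Ioo 0 δ, ENNReal.ofReal (kernel k τ)
      ≤ ∫⁻ τ in Set.Ioc 0 δ, ENNReal.ofReal (kernel k τ) :=
        lintegral_mono_set Set.Ioo_subset_Ioc_self
    _ = ENNReal.ofReal (∫ τ in Set.Ioc 0 δ, kernel k τ) :=
        (ofReal_integral_eq_lintegral_ofReal ((intervalIntegrable_iff_integrableOn_Ioc_of_le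
          hδ.le).1 hi) (Eventually.of_forall fun τ => kernel_nonneg k τ)).symm
    _ ≤ 1 := by
        rw [← ENNReal.ofReal_one]; exact ENNReal.ofReal_le_ofReal h1

lemma lintegral_kernel_mul_le {δ : ℝ} (hδ : 0 < δ) (k : ℕ) {g : ℝ → ℝ≥0∞} {C : ℝ≥0∞}
    (hC : C ≠ ∞)
    (h : ∀ᵐ τ ∂(volume.restrict (Set.Ioo 0 δ)), τ ≤ 2 / ((k : ℝ) + 1) → g τ ≤ C) :
    ∫⁻ τ in Set.Ioo 0 δ, ENNReal.ofReal (kernel k τ) * g τ ≤ C := by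
  have hk0 : (0 : ℝ) < (k : ℝ) + 1 := by positivity
  calc ∫⁻ τ in Set.Ioo 0 δ, ENNReal.ofReal (kernel k τ) * g τ
      ≤ ∫⁻ τ in Set.Ioo 0 δ, ENNReal.ofReal (kernel k τ) * C := by
        refine lintegral_mono_ae ?_
        filter_upwards [h] with τ hτ
        by_cases h2 : τ ≤ 2 / ((k : ℝ) + 1)
        · gcongr; exact hτ h2
        · push Not at h2
          rw [div_lt_iff₀ hk0, mul_comm] at h2
          simp [kernel, deriv_profile_of_two_lt h2]
    _ = (∫⁻ τ in Set.Ioo 0 δ, ENNReal.ofReal (kernel k τ)) * C := lintegral_mul_const' _ _ hC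
    _ ≤ 1 * C := by gcongr; exact lintegral_kernel_le hδ k
    _ = C := one_mul C

/-- The kernels have mass at most one and vanish above `2 / (k + 1)`, so eventually they see only
heights where `g < a + ε` almost everywhere. -/
lemma limsup_lintegral_kernel_le {δ : ℝ} (hδ : 0 < δ) {g : ℝ → ℝ≥0∞} {a : ℝ≥0∞}
    (h : Tendsto g (𝓝[>] 0 ⊓ ae volume) (𝓝 a)) :
    limsup (fun k => ∫⁻ τ in Set.Ioo 0 δ, ENNReal.ofReal (kernel k τ) * g τ) atTop ≤ a := by
  refine ENNReal.le_of_forall_pos_le_add fun ε hε ha => ?_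
  have hlt : a < a + ε := ENNReal.lt_add_right ha.ne (by simpa using hε.ne')
  obtain ⟨η, hη, hae⟩ := eventually_ae_Ioo (h.eventually_lt_const hlt)
  refine limsup_le_of_le (h := ?_)
  have h2 : Tendsto (fun k : ℕ => 2 / ((k : ℝ) + 1)) atTop (𝓝 0) := by
    simpa [div_eq_mul_inv] using tendsto_one_div_add_atTop_nhds_zero_nat.const_mul (2 : ℝ)
  filter_upwards [h2.eventually_lt_const hη] with k hk
  refine lintegral_kernel_mul_le hδ k (by simp [ha.ne]) ?_
  have hae' := (ae_restrict_iff' measurableSet_Ioo).1 hae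
  filter_upwards [ae_restrict_of_ae hae', ae_restrict_mem measurableSet_Ioo] with τ hτ hτm hle
  exact (hτ ⟨hτm.1, hle.trans_lt hk⟩).le

end Profile

/-! ### Cost of the cut-off in one chart -/

namespace BoundaryChart

variable {m : ℕ} {Ω : Set (EuclideanSpace ℝ (Fin (m + 1)))} (c : BoundaryChart Ω)
  {v : EuclideanSpace ℝ (Fin (m + 1)) → ℝ} {T : EuclideanSpace ℝ (Fin m) → ℝ}

/-- The cut-off function which vanishes below height `1 / (k + 1)` and is `1` above height
`2 / (k + 1)`. -/
noncomputable def heightCutoff (k : ℕ) (x : EuclideanSpace ℝ (Fin (m + 1))) : ℝ :=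
  profile (((k : ℝ) + 1) * c.height x)

lemma contDiff_heightCutoff (k : ℕ) : ContDiff ℝ 1 (c.heightCutoff k) :=
  contDiff_profile.comp (contDiff_const.mul c.contDiff_height)

lemma norm_fderiv_heightCutoff_le (k : ℕ) (x : EuclideanSpace ℝ (Fin (m + 1))) :
    ‖fderiv ℝ (c.heightCutoff k) x‖ ≤ kernel k (c.height x) * c.slope (c.base x) := by
  have h1 : HasFDerivAt (c.heightCutoff k) (kernel k (c.height x) • fderiv ℝ c.height x) x :=
    (hasDerivAt_profile_mul k (c.height x)).comp_hasFDerivAt x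
      (c.contDiff_height.differentiable (by norm_num) x).hasFDerivAt
  rw [h1.fderiv, norm_smul, Real.norm_of_nonneg (kernel_nonneg _ _)]
  exact mul_le_mul_of_nonneg_left (c.norm_fderiv_height_le x) (kernel_nonneg _ _)

lemma tendsto_heightCutoff {x : EuclideanSpace ℝ (Fin (m + 1))} (hx : 0 < c.height x) :
    Tendsto (fun k => c.heightCutoff k x) atTop (𝓝 1) := by
  refine tendsto_const_nhds.congr' ?_
  have h1 : Tendsto (fun k : ℕ => ((k : ℝ) + 1) * c.height x) atTop atTop :=
    (tendsto_atTop_add_const_right _ _ tendsto_natCast_atTop_atTop).atTop_mul_const hx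
  filter_upwards [h1.eventually_ge_atTop 2] with k hk
  exact (profile_of_two_le hk).symm

/-- The weight `ζ` confines the integral to the chart, where `Ω` is the region of positive height;
the gradient is at most kernel times slope, and Fubini applies. -/
lemma lintegral_cutoff_le (hv : Measurable v) {ζ : EuclideanSpace ℝ (Fin (m + 1)) → ℝ}
    (hζ : Continuous ζ) (hζs : Function.support ζ ⊆ c.domain) (hΩm : MeasurableSet Ω) (k : ℕ) :
    ∫⁻ x in Ω, ‖v x‖ₑ * (ENNReal.ofReal (ζ x) * ‖fderiv ℝ (c.heightCutoff k) x‖ₑ)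
      ≤ ∫⁻ w in c.ball, ENNReal.ofReal (c.slope w) * ∫⁻ τ in Set.Ioo 0 c.δ,
        ENNReal.ofReal (kernel k τ) *
          (‖v (c.point w τ)‖ₑ * ENNReal.ofReal (ζ (c.point w τ))) := by
  set D : Set (EuclideanSpace ℝ (Fin (m + 1))) :=
    {x | c.base x ∈ c.ball ∧ c.height x ∈ Set.Ioo 0 c.δ} with hD
  have hDm : MeasurableSet D := ((c.isOpen_ball.preimage c.base.continuous).inter
    (isOpen_Ioo.preimage c.contDiff_height.continuous)).measurableSet
  set g : EuclideanSpace ℝ (Fin (m + 1)) → ℝ≥0∞ := fun x => ENNReal.ofReal (c.slope (c.base x)) *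
    (ENNReal.ofReal (kernel k (c.height x)) * (‖v x‖ₑ * ENNReal.ofReal (ζ x))) with hg
  have hgm : Measurable g := by
    have h1 : Measurable fun x => c.slope (c.base x) :=
      (c.continuous_slope.comp c.base.continuous).measurable
    have h2 : Measurable fun x => kernel k (c.height x) :=
      ((continuous_kernel k).comp c.contDiff_height.continuous).measurable
    exact h1.ennreal_ofReal.mul (h2.ennreal_ofReal.mul (hv.enorm.mul hζ.measurable.ennreal_ofReal))
  have hle : ∀ x ∈ Ω, ‖v x‖ₑ * (ENNReal.ofReal (ζ x) * ‖fderiv ℝ (c.heightCutoff k) x‖ₑ)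
      ≤ D.indicator g x := by
    intro x hx
    by_cases hz : ζ x = 0
    · simp [hz]
    · have hxd : x ∈ c.domain := hζs hz
      have hxD : x ∈ D := ⟨hxd.1, (c.mem_iff_of_mem_domain hxd).1 hx, (abs_lt.1 hxd.2).2⟩
      rw [Set.indicator_of_mem hxD]
      have h1 : ‖fderiv ℝ (c.heightCutoff k) x‖ₑ
          ≤ ENNReal.ofReal (kernel k (c.height x)) * ENNReal.ofReal (c.slope (c.base x)) := by
        rw [← ENNReal.ofReal_mul (kernel_nonneg _ _), ← ofReal_norm]
        exact ENNReal.ofReal_le_ofReal (c.norm_fderiv_heightCutoff_le k x)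
      calc _ ≤ ‖v x‖ₑ * (ENNReal.ofReal (ζ x) * (ENNReal.ofReal (kernel k (c.height x)) *
            ENNReal.ofReal (c.slope (c.base x)))) := by gcongr
        _ = g x := by simp only [hg]; ring
  calc _ ≤ ∫⁻ x in Ω, D.indicator g x := setLIntegral_mono' hΩm hle
    _ ≤ ∫⁻ x, D.indicator g x := setLIntegral_le_lintegral _ _
    _ = ∫⁻ x in D, g x := lintegral_indicator hDm g
    _ = ∫⁻ w in c.ball, ∫⁻ τ in Set.Ioo 0 c.δ, g (c.point w τ) := c.setLIntegral_point hgm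
    _ = _ := by
        simp only [hg, c.base_point, c.height_point]
        refine lintegral_congr fun w => ?_
        rw [lintegral_const_mul' _ _ ENNReal.ofReal_ne_top]

/-- Reverse Fatou over the base. On each fibre the kernels concentrate at height zero, where `|v| ζ`
has essential limit `|T| ζ`; the dominating function is a bound for the slope times `|T|` plus the
fibre variation. -/
lemma IsFibreTrace.limsup_cutoff_le {c : BoundaryChart Ω} (h : c.IsFibreTrace v T)
    (hv : Measurable v) (hV : ∫⁻ w in c.ball, c.fibreVariation v w ≠ ∞)
    {ζ : EuclideanSpace ℝ (Fin (m + 1)) → ℝ} (hζ : Continuous ζ)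
    (hζs : Function.support ζ ⊆ c.domain) (hζ1 : ∀ x, ζ x ≤ 1) (hΩm : MeasurableSet Ω) :
    limsup (fun k => ∫⁻ x in Ω, ‖v x‖ₑ *
        (ENNReal.ofReal (ζ x) * ‖fderiv ℝ (c.heightCutoff k) x‖ₑ)) atTop
      ≤ ∫⁻ w in c.ball, ‖T w‖ₑ * ENNReal.ofReal (ζ (c.point w 0))
        ∂(volume.withDensity fun w => ENNReal.ofReal (c.slope w)) := by
  have hsm : Measurable fun w => ENNReal.ofReal (c.slope w) :=
    c.continuous_slope.measurable.ennreal_ofReal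
  have hζ0 : Continuous fun w => ζ (c.point w 0) :=
    hζ.comp (c.continuous_point.comp (Continuous.prodMk_left 0))
  obtain ⟨S, hS⟩ := (isCompact_closedBall c.center c.ρ).bddAbove_image
    c.continuous_slope.continuousOn
  set I : ℕ → EuclideanSpace ℝ (Fin m) → ℝ≥0∞ := fun k w =>
    ENNReal.ofReal (c.slope w) * ∫⁻ τ in Set.Ioo 0 c.δ, ENNReal.ofReal (kernel k τ) *
      (‖v (c.point w τ)‖ₑ * ENNReal.ofReal (ζ (c.point w τ))) with hI
  have hIm : ∀ k, Measurable (I k) := by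
    intro k
    refine hsm.mul (Measurable.lintegral_prod_right'
      (f := fun x : EuclideanSpace ℝ (Fin m) × ℝ => ENNReal.ofReal (kernel k x.2) *
      (‖v (c.point x.1 x.2)‖ₑ * ENNReal.ofReal (ζ (c.point x.1 x.2)))) ?_)
    have h1 : Measurable fun x : EuclideanSpace ℝ (Fin m) × ℝ => kernel k x.2 :=
      (continuous_kernel k).measurable.comp measurable_snd
    exact h1.ennreal_ofReal.mul ((hv.comp c.continuous_point.measurable).enorm.mul
      (hζ.comp c.continuous_point).measurable.ennreal_ofReal)
  have hbound : ∀ k, I k ≤ᵐ[volume.restrict c.ball]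
      fun w => ENNReal.ofReal S * (‖T w‖ₑ + c.fibreVariation v w) := by
    intro k
    filter_upwards [h.enorm_sub_le, ae_lt_top (c.measurable_fibreVariation hv) hV,
      ae_restrict_mem c.measurableSet_ball] with w hw hwt hwb
    simp only [hI]
    gcongr
    · exact hS ⟨w, Metric.ball_subset_closedBall hwb, rfl⟩
    · refine lintegral_kernel_mul_le c.δ_pos k (by simp [hwt.ne]) ?_
      filter_upwards [hw] with τ hτ _
      have h1 : ENNReal.ofReal (ζ (c.point w τ)) ≤ 1 := by
        rw [← ENNReal.ofReal_one]; exact ENNReal.ofReal_le_ofReal (hζ1 _)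
      calc ‖v (c.point w τ)‖ₑ * ENNReal.ofReal (ζ (c.point w τ))
          ≤ ‖v (c.point w τ)‖ₑ * 1 := by gcongr
        _ = ‖T w + (v (c.point w τ) - T w)‖ₑ := by rw [mul_one]; congr 1; ring
        _ ≤ ‖T w‖ₑ + ‖v (c.point w τ) - T w‖ₑ := enorm_add_le _ _
        _ ≤ _ := by gcongr
  have hfin : ∫⁻ w in c.ball, ENNReal.ofReal S * (‖T w‖ₑ + c.fibreVariation v w) ≠ ∞ := by
    rw [lintegral_const_mul' _ _ ENNReal.ofReal_ne_top,
      lintegral_add_right _ (c.measurable_fibreVariation hv)]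
    exact ENNReal.mul_ne_top ENNReal.ofReal_ne_top
      (ENNReal.add_ne_top.2 ⟨h.integrableOn.2.ne, hV⟩)
  have hlim : ∀ᵐ w ∂(volume.restrict c.ball), limsup (fun k => I k w) atTop
      ≤ ENNReal.ofReal (c.slope w) * (‖T w‖ₑ * ENNReal.ofReal (ζ (c.point w 0))) := by
    filter_upwards [h.tendsto] with w hw
    simp only [hI]
    rw [ENNReal.limsup_const_mul_of_ne_top ENNReal.ofReal_ne_top]
    gcongr
    refine limsup_lintegral_kernel_le c.δ_pos ?_
    refine ENNReal.Tendsto.mul (continuous_enorm.continuousAt.tendsto.comp hw)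
      (Or.inr ENNReal.ofReal_ne_top) ?_ (Or.inr enorm_ne_top)
    have h2 : Continuous fun τ => ENNReal.ofReal (ζ (c.point w τ)) :=
      ENNReal.continuous_ofReal.comp
        (hζ.comp (c.continuous_point.comp (Continuous.prodMk_right w)))
    exact (h2.tendsto 0).mono_left (inf_le_left.trans nhdsWithin_le_nhds)
  calc _ ≤ limsup (fun k => ∫⁻ w in c.ball, I k w) atTop :=
        limsup_le_limsup (Eventually.of_forall fun k => c.lintegral_cutoff_le hv hζ hζs hΩm k)
    _ ≤ ∫⁻ w in c.ball, limsup (fun k => I k w) atTop :=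
        limsup_lintegral_le _ hIm hbound hfin
    _ ≤ ∫⁻ w in c.ball, ENNReal.ofReal (c.slope w) *
          (‖T w‖ₑ * ENNReal.ofReal (ζ (c.point w 0))) := lintegral_mono_ae hlim
    _ = _ := by
        rw [restrict_withDensity c.measurableSet_ball]
        exact (lintegral_withDensity_eq_lintegral_mul _ hsm
          (h.measurable.enorm.mul hζ0.measurable.ennreal_ofReal)).symm

end BoundaryChart

end MeanCurvature

/-! ### The trace on the whole boundary -/

namespace MeanCurvature

variable {m : ℕ} {Ω : Set (EuclideanSpace ℝ (Fin (m + 1)))}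
  {v : EuclideanSpace ℝ (Fin (m + 1)) → ℝ}

lemma surfaceMeasure_eq (Ω : Set (EuclideanSpace ℝ (Fin (m + 1)))) :
    surfaceMeasure Ω = (Measure.euclideanHausdorffMeasure m).restrict (frontier Ω) := rfl

lemma HasC1Boundary.exists_finite_charts (hΩo : IsOpen Ω) (hΩb : Bornology.IsBounded Ω)
    (hΩ : HasC1Boundary Ω) :
    ∃ (ι : Type) (_ : Fintype ι) (c : ι → BoundaryChart Ω), frontier Ω ⊆ ⋃ i, (c i).domain := by
  have hK : IsCompact (frontier Ω) := hΩb.isCompact_closure.of_isClosed_subset isClosed_frontier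
    frontier_subset_closure
  choose c hc using fun x : frontier Ω => hΩ.exists_chart hΩo x.2
  obtain ⟨t, ht⟩ := hK.elim_finite_subcover (fun x => (c x).domain)
    (fun x => (c x).isOpen_domain) fun x hx => Set.mem_iUnion.2 ⟨⟨x, hx⟩, hc ⟨x, hx⟩⟩
  refine ⟨Fin t.card, inferInstance, fun i => c (t.equivFin.symm i), fun x hx => ?_⟩
  obtain ⟨y, hy, hxy⟩ := Set.mem_iUnion₂.1 (ht hx)
  exact Set.mem_iUnion.2 ⟨t.equivFin ⟨y, hy⟩, by simpa using hxy⟩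

open Classical in
/-- The trace, chosen pointwise. -/
noncomputable def trace (Ω : Set (EuclideanSpace ℝ (Fin (m + 1))))
    (v : EuclideanSpace ℝ (Fin (m + 1)) → ℝ) (x : EuclideanSpace ℝ (Fin (m + 1))) : ℝ :=
  if h : ∃ a, HasTraceAt Ω v x a then h.choose else 0

lemma HasTraceAt.trace_eq (hΩo : IsOpen Ω) (hΩ : HasC1Boundary Ω) (hv : IntegrableOn v Ω)
    {x : EuclideanSpace ℝ (Fin (m + 1))} (hx : x ∈ frontier Ω) {a : ℝ}
    (h : HasTraceAt Ω v x a) : trace Ω v x = a := by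
  have hex : ∃ a, HasTraceAt Ω v x a := ⟨a, h⟩
  rw [trace, dif_pos hex]
  exact hex.choose_spec.unique hΩo hΩ hv hx h

namespace BoundaryChart

variable {c : BoundaryChart Ω} {T : EuclideanSpace ℝ (Fin m) → ℝ}

lemma point_zero_mem_frontier (c : BoundaryChart Ω) (hΩo : IsOpen Ω)
    {w : EuclideanSpace ℝ (Fin m)} (hw : w ∈ c.ball) : c.point w 0 ∈ frontier Ω := by
  have : c.point w 0 ∈ frontier Ω ∩ c.domain := by
    rw [c.frontier_inter_domain hΩo]; exact ⟨w, hw, rfl⟩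
  exact this.1

lemma IsFibreTrace.trace_point (h : c.IsFibreTrace v T) (hΩo : IsOpen Ω) (hΩ : HasC1Boundary Ω)
    (hv : Measurable v) (hvi : Integrable v) (hV : ∫⁻ w in c.ball, c.fibreVariation v w ≠ ∞) :
    ∀ᵐ w ∂(volume.restrict c.ball),
      HasTraceAt Ω v (c.point w 0) (T w) ∧ trace Ω v (c.point w 0) = T w := by
  filter_upwards [h.hasTraceAt hv hvi hV, ae_restrict_mem c.measurableSet_ball] with w h1 hw
  exact ⟨h1, h1.trace_eq hΩo hΩ hvi.integrableOn (c.point_zero_mem_frontier hΩo hw)⟩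

/-- Projected to the base, the Hausdorff measure of the graph is at most a multiple of Lebesgue
measure, so null sets and integrability transfer from the base to the graph. -/
lemma IsFibreTrace.ae_graph (h : c.IsFibreTrace v T) (hΩo : IsOpen Ω) (hΩ : HasC1Boundary Ω)
    (hv : Measurable v) (hvi : Integrable v) (hV : ∫⁻ w in c.ball, c.fibreVariation v w ≠ ∞) :
    (∀ᵐ x ∂((Measure.euclideanHausdorffMeasure m).restrict ((fun w => c.point w 0) '' c.ball)),
      HasTraceAt Ω v x (trace Ω v x)) ∧
    IntegrableOn (trace Ω v) ((fun w => c.point w 0) '' c.ball)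
      (Measure.euclideanHausdorffMeasure m) := by
  obtain ⟨C, hC, hle⟩ := c.exists_map_base_le c.center c.ρ
  change ((Measure.euclideanHausdorffMeasure m).restrict
    ((fun w => c.point w 0) '' c.ball)).map c.base ≤ C • volume.restrict c.ball at hle
  set ν := (Measure.euclideanHausdorffMeasure m).restrict
    ((fun w => c.point w 0) '' c.ball) with hν
  have hbm : Measurable c.base := c.base.continuous.measurable
  have hac : ν.map c.base ≪ volume.restrict c.ball :=
    (Measure.absolutelyContinuous_of_le hle).trans
      (Measure.smul_absolutelyContinuous (c := C))
  have hgm : MeasurableSet ((fun w => c.point w 0) '' c.ball) :=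
    c.measurableEmbedding_graph.measurableSet_image.2 c.measurableSet_ball
  have hmem : ∀ᵐ x ∂ν, c.point (c.base x) 0 = x := by
    filter_upwards [ae_restrict_mem hgm] with x hx
    obtain ⟨w, _, rfl⟩ := hx
    simp
  have hae := ae_of_ae_map hbm.aemeasurable
    (hac.ae_le (h.trace_point hΩo hΩ hv hvi hV))
  have hae' : ∀ᵐ x ∂ν, HasTraceAt Ω v x (T (c.base x)) ∧ trace Ω v x = T (c.base x) := by
    filter_upwards [hae, hmem] with x hx h2
    rwa [h2] at hx
  refine ⟨hae'.mono fun x hx => by rw [hx.2]; exact hx.1, ?_⟩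
  have hint : Integrable (fun x => T (c.base x)) ν := by
    refine ⟨(h.measurable.comp hbm).aestronglyMeasurable, ?_⟩
    calc ∫⁻ x, ‖T (c.base x)‖ₑ ∂ν = ∫⁻ w, ‖T w‖ₑ ∂(ν.map c.base) :=
          (lintegral_map h.measurable.enorm hbm).symm
      _ ≤ ∫⁻ w, ‖T w‖ₑ ∂(C • volume.restrict c.ball) := lintegral_mono' hle le_rfl
      _ = C * ∫⁻ w in c.ball, ‖T w‖ₑ := by rw [lintegral_smul_measure, smul_eq_mul]
      _ < ∞ := ENNReal.mul_lt_top hC.lt_top h.integrableOn.2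
  exact hint.congr (hae'.mono fun x hx => hx.2.symm)

lemma lintegral_slope_le_surface (c : BoundaryChart Ω) (hΩo : IsOpen Ω)
    (g : EuclideanSpace ℝ (Fin (m + 1)) → ℝ≥0∞) :
    ∫⁻ w in c.ball, g (c.point w 0) ∂(volume.withDensity fun w => ENNReal.ofReal (c.slope w))
      ≤ ∫⁻ x, g x ∂(surfaceMeasure Ω) := by
  refine (c.setLIntegral_slope_le c.ball g).trans ?_
  rw [surfaceMeasure_eq]
  refine lintegral_mono_set ?_
  rintro _ ⟨w, hw, rfl⟩
  exact c.point_zero_mem_frontier hΩo hw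

end BoundaryChart

/-- A `BV` function has a trace on the boundary. -/
lemma hasTrace_trace (hΩo : IsOpen Ω) (hΩb : Bornology.IsBounded Ω) (hΩ : HasC1Boundary Ω)
    (hv : Measurable v) (hvi : Integrable v) (hbv : IsBV Ω v) : HasTrace Ω v (trace Ω v) := by
  obtain ⟨ι, _, c, hcov⟩ := hΩ.exists_finite_charts hΩo hΩb
  obtain ⟨M, -, hM⟩ := hbv.exists_abs_le
  have hV : ∀ i, ∫⁻ w in (c i).ball, (c i).fibreVariation v w ≠ ∞ := fun i =>
    (c i).lintegral_fibreVariation_ne_top hv hvi hM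
  choose T hT using fun i => (c i).exists_isFibreTrace hv hvi (hV i)
  have hsub : frontier Ω ⊆ ⋃ i, (fun w => (c i).point w 0) '' (c i).ball := by
    intro x hx
    obtain ⟨i, hi⟩ := Set.mem_iUnion.1 (hcov hx)
    refine Set.mem_iUnion.2 ⟨i, ?_⟩
    rw [← (c i).frontier_inter_domain hΩo]
    exact ⟨hx, hi⟩
  have h := fun i => (hT i).ae_graph hΩo hΩ hv hvi (hV i)
  constructor
  · exact ((integrableOn_finite_iUnion (f := trace Ω v)).2 fun i => (h i).2).mono_set hsub
  · exact ae_restrict_of_ae_restrict_of_subset hsub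
      ((ae_restrict_iUnion_iff _ _).2 fun i => (h i).1)

end MeanCurvature

/-! ### Partition of unity and the global cut-off -/

namespace MeanCurvature

variable {m : ℕ} {Ω : Set (EuclideanSpace ℝ (Fin (m + 1)))}
  {v : EuclideanSpace ℝ (Fin (m + 1)) → ℝ}

lemma eventually_sum_le_add {ι : Type*} (s : Finset ι) {f : ι → ℕ → ℝ≥0∞} {a : ι → ℝ≥0∞}
    (h : ∀ i, ∀ ε > 0, ∀ᶠ k in atTop, f i k ≤ a i + ε) :
    ∀ ε > 0, ∀ᶠ k in atTop, ∑ i ∈ s, f i k ≤ ∑ i ∈ s, a i + ε := by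
  classical
  induction s using Finset.induction_on with
  | empty => intro ε hε; simp
  | insert j s hj ih =>
    intro ε hε
    have hε2 : 0 < ε / 2 := ENNReal.half_pos hε.ne'
    filter_upwards [ih _ hε2, h j _ hε2] with k h1 h2
    rw [Finset.sum_insert hj, Finset.sum_insert hj]
    calc f j k + ∑ i ∈ s, f i k ≤ (a j + ε / 2) + (∑ i ∈ s, a i + ε / 2) := add_le_add h2 h1
      _ = a j + ∑ i ∈ s, a i + (ε / 2 + ε / 2) := by ring
      _ = _ := by rw [ENNReal.add_halves]

lemma eventually_le_add_of_limsup_le {f : ℕ → ℝ≥0∞} {a : ℝ≥0∞} (h : limsup f atTop ≤ a)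
    {ε : ℝ≥0∞} (hε : 0 < ε) : ∀ᶠ k in atTop, f k ≤ a + ε := by
  rcases eq_or_ne a ∞ with rfl | ha
  · simp
  · exact (eventually_lt_of_limsup_lt (h.trans_lt (ENNReal.lt_add_right ha hε.ne'))).mono
      fun k hk => hk.le

/-- A partition of unity on the closure of `Ω` which is subordinate to `Ω` and to finitely many
boundary charts. -/
structure ChartPartition (Ω : Set (EuclideanSpace ℝ (Fin (m + 1)))) where
  ι : Type
  fintype : Fintype ι
  chart : ι → BoundaryChart Ω
  inner : EuclideanSpace ℝ (Fin (m + 1)) → ℝ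
  outer : ι → EuclideanSpace ℝ (Fin (m + 1)) → ℝ
  contDiff_inner : ContDiff ℝ 1 inner
  contDiff_outer : ∀ i, ContDiff ℝ 1 (outer i)
  tsupport_inner : tsupport inner ⊆ Ω
  tsupport_outer : ∀ i, tsupport (outer i) ⊆ (chart i).domain
  inner_nonneg : ∀ x, 0 ≤ inner x
  outer_nonneg : ∀ i x, 0 ≤ outer i x
  sum_le_one : ∀ x, inner x + ∑ i, outer i x ≤ 1
  sum_eq_one : ∀ x ∈ Ω, inner x + ∑ i, outer i x = 1

open scoped Manifold in
lemma HasC1Boundary.nonempty_chartPartition (hΩo : IsOpen Ω) (hΩb : Bornology.IsBounded Ω)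
    (hΩ : HasC1Boundary Ω) : Nonempty (ChartPartition Ω) := by
  obtain ⟨ι, hι, c, hcov⟩ := hΩ.exists_finite_charts hΩo hΩb
  let U : Option ι → Set (EuclideanSpace ℝ (Fin (m + 1))) := fun o =>
    o.elim Ω fun i => (c i).domain
  have hUo : ∀ o, IsOpen (U o) := by
    rintro (_ | i)
    · exact hΩo
    · exact (c i).isOpen_domain
  have hUcov : closure Ω ⊆ ⋃ o, U o := by
    intro x hx
    by_cases hxΩ : x ∈ Ω
    · exact Set.mem_iUnion.2 ⟨none, hxΩ⟩
    · have : x ∈ frontier Ω := by rw [hΩo.frontier_eq]; exact ⟨hx, hxΩ⟩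
      obtain ⟨i, hi⟩ := Set.mem_iUnion.1 (hcov this)
      exact Set.mem_iUnion.2 ⟨some i, hi⟩
  obtain ⟨φ, hφ⟩ := SmoothPartitionOfUnity.exists_isSubordinate
    𝓘(ℝ, EuclideanSpace ℝ (Fin (m + 1))) isClosed_closure U hUo hUcov
  have hsum : ∀ x, ∑ᶠ o, φ o x = φ none x + ∑ i, φ (some i) x := fun x => by
    rw [finsum_eq_sum_of_fintype, Fintype.sum_option]
  have hsmooth : ∀ o, ContDiff ℝ 1 (φ o) := fun o =>
    (φ o).contMDiff.contDiff.of_le (by norm_cast)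
  exact ⟨{ ι := ι, fintype := hι, chart := c, inner := φ none, outer := fun i => φ (some i)
           contDiff_inner := hsmooth none
           contDiff_outer := fun i => hsmooth (some i)
           tsupport_inner := hφ none
           tsupport_outer := fun i => hφ (some i)
           inner_nonneg := φ.nonneg none
           outer_nonneg := fun i => φ.nonneg (some i)
           sum_le_one := fun x => by rw [← hsum]; exact φ.sum_le_one x
           sum_eq_one := fun x hx => by rw [← hsum]; exact φ.sum_eq_one (subset_closure hx) }⟩

namespace ChartPartition

variable (P : ChartPartition Ω)

instance : Fintype P.ι := P.fintype

/-- The global cut-off function at scale `1 / (k + 1)`. -/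
noncomputable def cutoff (k : ℕ) (x : EuclideanSpace ℝ (Fin (m + 1))) : ℝ :=
  P.inner x + ∑ i, P.outer i x * (P.chart i).heightCutoff k x

lemma contDiff_cutoff (k : ℕ) : ContDiff ℝ 1 (P.cutoff k) := by
  unfold cutoff
  exact P.contDiff_inner.add (ContDiff.sum fun i _ =>
    (P.contDiff_outer i).mul ((P.chart i).contDiff_heightCutoff k))

lemma cutoff_mem_Icc (k : ℕ) (x : EuclideanSpace ℝ (Fin (m + 1))) :
    P.cutoff k x ∈ Set.Icc (0 : ℝ) 1 := by
  constructor
  · exact add_nonneg (P.inner_nonneg x) (Finset.sum_nonneg fun i _ =>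
      mul_nonneg (P.outer_nonneg i x) (profile_mem_Icc _).1)
  · refine le_trans ?_ (P.sum_le_one x)
    unfold cutoff
    gcongr with i
    exact mul_le_of_le_one_right (P.outer_nonneg i x) (profile_mem_Icc _).2

/-- Off `Ω` the inner function vanishes locally. Where an outer one may survive, the height is at
most `0`, so the argument of the profile stays below `1` in a neighbourhood. -/
lemma notMem_tsupport_cutoff (k : ℕ) {x : EuclideanSpace ℝ (Fin (m + 1))} (hx : x ∉ Ω) :
    x ∉ tsupport (P.cutoff k) := by
  rw [notMem_tsupport_iff_eventuallyEq]
  have h1 : P.inner =ᶠ[𝓝 x] 0 :=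
    notMem_tsupport_iff_eventuallyEq.1 fun h => hx (P.tsupport_inner h)
  have h2 : ∀ i, ∀ᶠ y in 𝓝 x, P.outer i y * (P.chart i).heightCutoff k y = 0 := by
    intro i
    by_cases hi : x ∈ tsupport (P.outer i)
    · have hd := P.tsupport_outer i hi
      have hle : (P.chart i).height x ≤ 0 := by
        rw [← not_lt, ← (P.chart i).mem_iff_of_mem_domain hd]; exact hx
      have hlt : ((k : ℝ) + 1) * (P.chart i).height x < 1 :=
        lt_of_le_of_lt (mul_nonpos_of_nonneg_of_nonpos (by positivity) hle) one_pos
      have hc : Continuous fun y => ((k : ℝ) + 1) * (P.chart i).height y :=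
        continuous_const.mul (P.chart i).contDiff_height.continuous
      filter_upwards [(isOpen_lt hc continuous_const).mem_nhds hlt] with y hy
      rw [BoundaryChart.heightCutoff, profile_of_le_one (le_of_lt hy), mul_zero]
    · filter_upwards [notMem_tsupport_iff_eventuallyEq.1 hi] with y hy
      simp [hy]
  filter_upwards [h1, eventually_all.2 h2] with y hy1 hy2
  simp [cutoff, hy1, hy2]

lemma isTest_cutoff (hΩb : Bornology.IsBounded Ω) (k : ℕ) : IsTest Ω (P.cutoff k) := by
  have hsub : tsupport (P.cutoff k) ⊆ Ω := fun x hx => by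
    by_contra h
    exact P.notMem_tsupport_cutoff k h hx
  refine ⟨P.contDiff_cutoff k, ?_, hsub⟩
  exact hΩb.isCompact_closure.of_isClosed_subset (isClosed_tsupport _)
    (hsub.trans subset_closure)

lemma height_pos {i : P.ι} {x : EuclideanSpace ℝ (Fin (m + 1))} (hx : x ∈ Ω)
    (hi : x ∈ tsupport (P.outer i)) : 0 < (P.chart i).height x :=
  ((P.chart i).mem_iff_of_mem_domain (P.tsupport_outer i hi)).1 hx

lemma tendsto_cutoff {x : EuclideanSpace ℝ (Fin (m + 1))} (hx : x ∈ Ω) :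
    Tendsto (fun k => P.cutoff k x) atTop (𝓝 1) := by
  rw [← P.sum_eq_one x hx]
  refine tendsto_const_nhds.add (tendsto_finsetSum _ fun i _ => ?_)
  by_cases hi : x ∈ tsupport (P.outer i)
  · simpa using ((P.chart i).tendsto_heightCutoff (P.height_pos hx hi)).const_mul (P.outer i x)
  · simp [image_eq_zero_of_notMem_tsupport hi]

/-- In `Ω` the partition sums to one, so the inner gradient cancels against the outer ones. This
separates terms with the factor `heightCutoff - 1`, which tend to zero, from those that carry the
boundary cost. -/
lemma fderiv_cutoff (hΩo : IsOpen Ω) (k : ℕ) {x : EuclideanSpace ℝ (Fin (m + 1))} (hx : x ∈ Ω) :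
    fderiv ℝ (P.cutoff k) x = ∑ i, (((P.chart i).heightCutoff k x - 1) • fderiv ℝ (P.outer i) x
      + P.outer i x • fderiv ℝ ((P.chart i).heightCutoff k) x) := by
  have d0 := (P.contDiff_inner.differentiable (by norm_num) x).hasFDerivAt
  have d1 := fun i => ((P.contDiff_outer i).differentiable (by norm_num) x).hasFDerivAt
  have d2 := fun i => (((P.chart i).contDiff_heightCutoff k).differentiable
    (by norm_num) x).hasFDerivAt
  have h1 : HasFDerivAt (fun y => P.inner y + ∑ i, P.outer i y)
      (fderiv ℝ P.inner x + ∑ i, fderiv ℝ (P.outer i) x) x :=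
    d0.add (HasFDerivAt.fun_sum fun i _ => d1 i)
  have h2 : HasFDerivAt (fun y => P.inner y + ∑ i, P.outer i y)
      (0 : EuclideanSpace ℝ (Fin (m + 1)) →L[ℝ] ℝ) x := by
    refine (hasFDerivAt_const (1 : ℝ) x).congr_of_eventuallyEq ?_
    filter_upwards [hΩo.mem_nhds hx] with y hy using P.sum_eq_one y hy
  have h3 : fderiv ℝ P.inner x = -∑ i, fderiv ℝ (P.outer i) x :=
    eq_neg_of_add_eq_zero_left (h1.unique h2)
  have h4 : HasFDerivAt (P.cutoff k) (fderiv ℝ P.inner x + ∑ i,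
      (P.outer i x • fderiv ℝ ((P.chart i).heightCutoff k) x
        + (P.chart i).heightCutoff k x • fderiv ℝ (P.outer i) x)) x :=
    d0.add (HasFDerivAt.fun_sum fun i _ => (d1 i).mul (d2 i))
  rw [h4.fderiv, h3, ← Finset.sum_neg_distrib, ← Finset.sum_add_distrib]
  refine Finset.sum_congr rfl fun i _ => ?_
  rw [sub_smul, one_smul]
  abel

lemma tendsto_lintegral_cutoff_sub (hΩo : IsOpen Ω) (hΩb : Bornology.IsBounded Ω)
    (hv : Measurable v) (hvi : Integrable v) (i : P.ι) :
    Tendsto (fun k => ∫⁻ x in Ω, ‖v x‖ₑ *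
      (‖(P.chart i).heightCutoff k x - 1‖ₑ * ‖fderiv ℝ (P.outer i) x‖ₑ)) atTop (𝓝 0) := by
  have hfc : Continuous fun x => fderiv ℝ (P.outer i) x :=
    (P.contDiff_outer i).continuous_fderiv (by norm_num)
  obtain ⟨C, hC⟩ := hΩb.isCompact_closure.exists_bound_of_continuousOn hfc.continuousOn
  have h0 : ∫⁻ _ in Ω, (0 : ℝ≥0∞) = 0 := by simp
  rw [← h0]
  refine tendsto_lintegral_of_dominated_convergence (fun x => ‖v x‖ₑ * ENNReal.ofReal C)
    (fun k => ?_) (fun k => ?_) ?_ ?_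
  · exact hv.enorm.mul ((((P.chart i).contDiff_heightCutoff k).continuous.sub
      continuous_const).measurable.enorm.mul hfc.measurable.enorm)
  · filter_upwards [ae_restrict_mem hΩo.measurableSet] with x hx
    gcongr
    have h1 : ‖(P.chart i).heightCutoff k x - 1‖ₑ ≤ 1 := by
      rw [← ofReal_norm, ← ENNReal.ofReal_one]
      refine ENNReal.ofReal_le_ofReal ?_
      have := profile_mem_Icc (((k : ℝ) + 1) * (P.chart i).height x)
      rw [Real.norm_eq_abs, abs_le]
      constructor <;> simp only [BoundaryChart.heightCutoff] <;> linarith [this.1, this.2]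
    have h2 : ‖fderiv ℝ (P.outer i) x‖ₑ ≤ ENNReal.ofReal C := by
      rw [← ofReal_norm]; exact ENNReal.ofReal_le_ofReal (hC x (subset_closure hx))
    calc _ ≤ 1 * ENNReal.ofReal C := mul_le_mul' h1 h2
      _ = _ := one_mul _
  · rw [lintegral_mul_const' _ _ ENNReal.ofReal_ne_top]
    exact ENNReal.mul_ne_top hvi.integrableOn.2.ne ENNReal.ofReal_ne_top
  · filter_upwards [ae_restrict_mem hΩo.measurableSet] with x hx
    by_cases hi : x ∈ tsupport (P.outer i)
    · have h1 : Tendsto (fun k => ‖(P.chart i).heightCutoff k x - 1‖ₑ) atTop (𝓝 0) := by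
        have := (P.chart i).tendsto_heightCutoff (P.height_pos hx hi)
        simpa [edist_eq_enorm_sub] using tendsto_iff_edist_tendsto_0.1 this
      have h2 := ENNReal.Tendsto.const_mul (a := ‖v x‖ₑ)
        (ENNReal.Tendsto.mul_const (b := ‖fderiv ℝ (P.outer i) x‖ₑ) h1 (Or.inr enorm_ne_top))
        (Or.inr enorm_ne_top)
      simpa using h2
    · have : fderiv ℝ (P.outer i) x = 0 := by
        by_contra h
        exact hi (support_fderiv_subset ℝ h)
      have h0 : ‖fderiv ℝ (P.outer i) x‖ₑ = 0 := by
        rw [← ofReal_norm, this, norm_zero, ENNReal.ofReal_zero]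
      simp only [h0, mul_zero]
      exact tendsto_const_nhds

/-- The cost of the cut-off is asymptotically at most the boundary integral of the trace. -/
lemma eventually_lintegral_fderiv_cutoff_le (hΩo : IsOpen Ω) (hΩb : Bornology.IsBounded Ω)
    (hΩ : HasC1Boundary Ω) (hv : Measurable v) (hvi : Integrable v) (hbv : IsBV Ω v)
    {ε : ℝ≥0∞} (hε : 0 < ε) :
    ∀ᶠ k in atTop, ∫⁻ x in Ω, ‖v x‖ₑ * ‖fderiv ℝ (P.cutoff k) x‖ₑ
      ≤ (∫⁻ x, ‖trace Ω v x‖ₑ ∂(surfaceMeasure Ω)) + ε := by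
  obtain ⟨M, -, hM⟩ := hbv.exists_abs_le
  have hV : ∀ i, ∫⁻ w in (P.chart i).ball, (P.chart i).fibreVariation v w ≠ ∞ := fun i =>
    (P.chart i).lintegral_fibreVariation_ne_top hv hvi hM
  choose T hT using fun i => (P.chart i).exists_isFibreTrace hv hvi (hV i)
  set a : P.ι → ℝ≥0∞ := fun i =>
    ∫⁻ x, ‖trace Ω v x‖ₑ * ENNReal.ofReal (P.outer i x) ∂(surfaceMeasure Ω) with ha
  have htr := hasTrace_trace hΩo hΩb hΩ hv hvi hbv
  have hasum : ∑ i, a i ≤ ∫⁻ x, ‖trace Ω v x‖ₑ ∂(surfaceMeasure Ω) := by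
    have hm : ∀ i, AEMeasurable (fun x => ‖trace Ω v x‖ₑ * ENNReal.ofReal (P.outer i x))
        (surfaceMeasure Ω) := fun i => htr.1.1.enorm.mul
      (P.contDiff_outer i).continuous.measurable.ennreal_ofReal.aemeasurable
    simp only [ha]
    rw [← lintegral_finsetSum' _ fun i _ => hm i]
    refine lintegral_mono fun x => ?_
    rw [← Finset.mul_sum, ← ENNReal.ofReal_sum_of_nonneg fun i _ => P.outer_nonneg i x]
    have : ENNReal.ofReal (∑ i, P.outer i x) ≤ 1 := by
      rw [← ENNReal.ofReal_one]
      exact ENNReal.ofReal_le_ofReal (by linarith [P.sum_le_one x, P.inner_nonneg x])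
    calc _ ≤ ‖trace Ω v x‖ₑ * 1 := by gcongr
      _ = _ := mul_one _
  set b : P.ι → ℕ → ℝ≥0∞ := fun i k => ∫⁻ x in Ω, ‖v x‖ₑ *
    (ENNReal.ofReal (P.outer i x) * ‖fderiv ℝ ((P.chart i).heightCutoff k) x‖ₑ) with hb
  set d : P.ι → ℕ → ℝ≥0∞ := fun i k => ∫⁻ x in Ω, ‖v x‖ₑ *
    (‖(P.chart i).heightCutoff k x - 1‖ₑ * ‖fderiv ℝ (P.outer i) x‖ₑ) with hd
  -- Chart by chart: the limit is bounded by a slope integral of `|T|`, where `T` is the trace on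
  -- the graph, and the slope integral is at most the surface integral.
  have hb' : ∀ i, ∀ ε > 0, ∀ᶠ k in atTop, b i k ≤ a i + ε := by
    intro i ε hε
    refine eventually_le_add_of_limsup_le (le_trans ((hT i).limsup_cutoff_le hv (hV i)
      (P.contDiff_outer i).continuous ((subset_tsupport _).trans (P.tsupport_outer i))
      (fun x => ?_) hΩo.measurableSet) ?_) hε
    · refine le_trans ?_ (P.sum_le_one x)
      have := Finset.single_le_sum (f := fun i => P.outer i x) (fun i _ => P.outer_nonneg i x)
        (Finset.mem_univ i)
      linarith [P.inner_nonneg x]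
    · refine le_trans (le_of_eq ?_) ((P.chart i).lintegral_slope_le_surface hΩo
        fun x => ‖trace Ω v x‖ₑ * ENNReal.ofReal (P.outer i x))
      have hac : (volume.withDensity fun w => ENNReal.ofReal ((P.chart i).slope w)).restrict
          (P.chart i).ball ≪ volume.restrict (P.chart i).ball :=
        (withDensity_absolutelyContinuous _ _).restrict _
      refine lintegral_congr_ae (hac.ae_le ?_)
      filter_upwards [(hT i).trace_point hΩo hΩ hv hvi (hV i)] with w hw
      rw [hw.2]
  have hd' : ∀ i, ∀ ε > 0, ∀ᶠ k in atTop, d i k ≤ 0 + ε := by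
    intro i ε hε
    simpa using ENNReal.tendsto_nhds_zero.1
      (P.tendsto_lintegral_cutoff_sub hΩo hΩb hv hvi i) ε hε
  have hε2 : 0 < ε / 2 := ENNReal.half_pos hε.ne'
  filter_upwards [eventually_sum_le_add Finset.univ hb' _ hε2,
    eventually_sum_le_add Finset.univ hd' _ hε2] with k h1 h2
  have h3 : ∫⁻ x in Ω, ‖v x‖ₑ * ‖fderiv ℝ (P.cutoff k) x‖ₑ ≤ ∑ i, d i k + ∑ i, b i k := by
    rw [← Finset.sum_add_distrib]
    have hm1 : ∀ i, Measurable fun x => ‖v x‖ₑ *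
        (‖(P.chart i).heightCutoff k x - 1‖ₑ * ‖fderiv ℝ (P.outer i) x‖ₑ) := fun i =>
      hv.enorm.mul ((((P.chart i).contDiff_heightCutoff k).continuous.sub
        continuous_const).measurable.enorm.mul
        ((P.contDiff_outer i).continuous_fderiv (by norm_num)).measurable.enorm)
    have hm2 : ∀ i, Measurable fun x => ‖v x‖ₑ * (ENNReal.ofReal (P.outer i x) *
        ‖fderiv ℝ ((P.chart i).heightCutoff k) x‖ₑ) := fun i =>
      hv.enorm.mul ((P.contDiff_outer i).continuous.measurable.ennreal_ofReal.mul
        (((P.chart i).contDiff_heightCutoff k).continuous_fderiv (by norm_num)).measurable.enorm)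
    simp only [hb, hd, ← lintegral_add_left (hm1 _)]
    have hm3 : ∀ i, Measurable fun x => ‖v x‖ₑ *
        (‖(P.chart i).heightCutoff k x - 1‖ₑ * ‖fderiv ℝ (P.outer i) x‖ₑ) +
        ‖v x‖ₑ * (ENNReal.ofReal (P.outer i x) * ‖fderiv ℝ ((P.chart i).heightCutoff k) x‖ₑ) :=
      fun i => (hm1 i).add (hm2 i)
    rw [← lintegral_finsetSum _ fun i _ => hm3 i]
    refine setLIntegral_mono' hΩo.measurableSet fun x hx => ?_
    simp only [← mul_add]
    rw [← Finset.mul_sum, P.fderiv_cutoff hΩo k hx]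
    gcongr
    rw [← ofReal_norm]
    refine (ENNReal.ofReal_le_ofReal (norm_sum_le _ _)).trans ?_
    rw [ENNReal.ofReal_sum_of_nonneg fun i _ => norm_nonneg _]
    refine Finset.sum_le_sum fun i _ => ?_
    refine (ENNReal.ofReal_le_ofReal (norm_add_le _ _)).trans (le_of_eq ?_)
    rw [ENNReal.ofReal_add (norm_nonneg _) (norm_nonneg _), norm_smul, norm_smul,
      Real.norm_of_nonneg (P.outer_nonneg i x), ENNReal.ofReal_mul (norm_nonneg _),
      ENNReal.ofReal_mul (P.outer_nonneg i x), ofReal_norm, ofReal_norm, ofReal_norm]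
  calc _ ≤ ∑ i, d i k + ∑ i, b i k := h3
    _ ≤ (∑ i : P.ι, (0 : ℝ≥0∞) + ε / 2) + (∑ i, a i + ε / 2) := add_le_add h2 h1
    _ = ∑ i, a i + (ε / 2 + ε / 2) := by
      rw [Finset.sum_const_zero, zero_add, add_comm, add_assoc]
    _ = ∑ i, a i + ε := by rw [ENNReal.add_halves]
    _ ≤ _ := by gcongr

end ChartPartition

end MeanCurvature

namespace MeanCurvature

/-! ### Minimality and the equivalences -/

section Minimality

variable {m : ℕ} {Ω : Set (EuclideanSpace ℝ (Fin (m + 1)))}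
  {H u v : EuclideanSpace ℝ (Fin (m + 1)) → ℝ} {p lam : ℝ}

lemma HasTrace.congr {T : EuclideanSpace ℝ (Fin (m + 1)) → ℝ} (h : HasTrace Ω u T)
    (huv : u =ᵐ[volume.restrict Ω] v) : HasTrace Ω v T :=
  ⟨h.1, h.2.mono fun _ hx => HasTraceAt.congr hx huv⟩

/-- An admissible function agrees a.e. in `Ω` with a measurable function which is integrable on
the whole space. -/
lemma IsAdmissible.exists_representative (hΩo : IsOpen Ω) (hv : IsAdmissible Ω p v) :
    ∃ w, Measurable w ∧ Integrable w ∧ v =ᵐ[volume.restrict Ω] w := by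
  have hm : AEStronglyMeasurable v (volume.restrict Ω) := hv.1.1
  have h : v =ᵐ[volume.restrict Ω] Ω.indicator (hm.mk v) := by
    filter_upwards [hm.ae_eq_mk, ae_restrict_mem hΩo.measurableSet] with x hx hxΩ
    rw [Set.indicator_of_mem hxΩ, hx]
  refine ⟨_, hm.stronglyMeasurable_mk.measurable.indicator hΩo.measurableSet, ?_, h⟩
  rw [integrable_indicator_iff hΩo.measurableSet]
  exact hv.2.1.congr hm.ae_eq_mk

/-- If `u` minimises the linearised functional among functions with zero trace, it minimises the
relaxed functional among all admissible functions. -/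
lemma exists_hasTrace_and_le (hΩo : IsOpen Ω) (hΩb : Bornology.IsBounded Ω)
    (hΩ : HasC1Boundary Ω) (hp : 1 ≤ p) (hH : MemLp H ∞ (volume.restrict Ω))
    (hu : IsAdmissible Ω p u) {c : ℝ}
    (hc : ∀ w, IsAdmissible Ω p w → VanishesOnBoundary Ω w →
      c ≤ area Ω w - ∫ x in Ω, (H x + lam * f p (u x)) * w x)
    (hv : IsAdmissible Ω p v) :
    ∃ T : EuclideanSpace ℝ (Fin (m + 1)) → ℝ, HasTrace Ω v T ∧
      c ≤ area Ω v - (∫ x in Ω, (H x + lam * f p (u x)) * v x)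
        + ∫ x, |T x| ∂(surfaceMeasure Ω) := by
  obtain ⟨w, hwm, hwi, hvw⟩ := hv.exists_representative hΩo
  have hw : IsAdmissible Ω p w := hv.congr hvw
  have hT := hasTrace_trace hΩo hΩb hΩ hwm hwi hw.2
  refine ⟨trace Ω w, hT.congr hvw.symm, ?_⟩
  have hcongr : ∫ x in Ω, (H x + lam * f p (u x)) * v x
      = ∫ x in Ω, (H x + lam * f p (u x)) * w x :=
    integral_congr_ae (hvw.mono fun x hx => by simp only [hx])
  rw [area_congr hvw, hcongr]
  obtain ⟨P⟩ := hΩ.nonempty_chartPartition hΩo hΩb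
  have hsrc : IntegrableOn (fun x => (H x + lam * f p (u x)) * w x) Ω :=
    hu.integrable_source_mul hp hH hw
  have hlim : Tendsto (fun k => ∫ x in Ω, (H x + lam * f p (u x)) * (P.cutoff k x * w x)) atTop
      (𝓝 (∫ x in Ω, (H x + lam * f p (u x)) * w x)) := by
    refine tendsto_integral_of_dominated_convergence
      (fun x => ‖(H x + lam * f p (u x)) * w x‖) (fun k => ?_) hsrc.norm
      (fun k => Eventually.of_forall fun x => ?_) ?_
    · exact (hu.integrable_source_mul hp hH
        (hw.cutoff (P.isTest_cutoff hΩb k) (P.cutoff_mem_Icc k))).1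
    · rw [mul_left_comm, norm_mul, Real.norm_of_nonneg (P.cutoff_mem_Icc k x).1]
      exact mul_le_of_le_one_left (norm_nonneg _) (P.cutoff_mem_Icc k x).2
    · filter_upwards [ae_restrict_mem hΩo.measurableSet] with x hx
      simpa using ((P.tendsto_cutoff hx).mul_const (w x)).const_mul (H x + lam * f p (u x))
  refine le_of_forall_pos_le_add fun ε hε => ?_
  -- The product of the cut-off and `w` has zero trace, hence competes in `hc`; its area exceeds
  -- that of `w` by at most the boundary integral plus `ε`.
  have hbound : ∀ᶠ k in atTop, c ≤ area Ω w + ((∫ x, |trace Ω w x| ∂(surfaceMeasure Ω)) + ε)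
      - ∫ x in Ω, (H x + lam * f p (u x)) * (P.cutoff k x * w x) := by
    filter_upwards [P.eventually_lintegral_fderiv_cutoff_le hΩo hΩb hΩ hwm hwi hw.2
      (ENNReal.ofReal_pos.2 hε)] with k hk
    have hη := P.isTest_cutoff hΩb k
    have h1 := hc _ (hw.cutoff hη (P.cutoff_mem_Icc k)) (hη.vanishesOnBoundary_mul hΩo w)
    have h2 := area_cutoff_le hΩb hw.2 hη (P.cutoff_mem_Icc k)
    have h3 : ∫ x in Ω, |w x| * ‖fderiv ℝ (P.cutoff k) x‖
        ≤ (∫ x, |trace Ω w x| ∂(surfaceMeasure Ω)) + ε := by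
      have hT' : ∫ x, |trace Ω w x| ∂(surfaceMeasure Ω)
          = (∫⁻ x, ‖trace Ω w x‖ₑ ∂(surfaceMeasure Ω)).toReal :=
        integral_norm_eq_lintegral_enorm hT.1.1
      have hfd : Measurable fun x => ‖fderiv ℝ (P.cutoff k) x‖ :=
        (hη.1.continuous_fderiv (by norm_num)).norm.measurable
      rw [integral_eq_lintegral_of_nonneg_ae
        (Eventually.of_forall fun x => mul_nonneg (abs_nonneg _) (norm_nonneg _))
        (hwm.norm.mul hfd).aestronglyMeasurable, hT', ← ENNReal.toReal_ofReal hε.le,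
        ← ENNReal.toReal_add hT.1.2.ne ENNReal.ofReal_ne_top]
      refine ENNReal.toReal_mono
        (ENNReal.add_ne_top.2 ⟨hT.1.2.ne, ENNReal.ofReal_ne_top⟩) (le_trans (le_of_eq ?_) hk)
      refine lintegral_congr fun x => ?_
      rw [ENNReal.ofReal_mul (abs_nonneg _), ofReal_norm, ← Real.norm_eq_abs, ofReal_norm]
    linarith
  have := ge_of_tendsto (hlim.const_sub
    (area Ω w + ((∫ x, |trace Ω w x| ∂(surfaceMeasure Ω)) + ε))) hbound
  linarith

/-- A weak solution minimises the linearised functional among functions with zero trace. -/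
lemma IsWeakSolution.le_of_vanishesOnBoundary (hΩb : Bornology.IsBounded Ω) (hp : 1 ≤ p)
    (hH : MemLp H ∞ (volume.restrict Ω)) (h : IsWeakSolution Ω H p lam u)
    (hw : IsAdmissible Ω p v) (hw0 : VanishesOnBoundary Ω v) :
    area Ω u - ∫ x in Ω, (H x + lam * f p (u x)) * u x
      ≤ area Ω v - ∫ x in Ω, (H x + lam * f p (u x)) * v x := by
  obtain ⟨hu, hvar, -, hb⟩ := h
  have hφ : IsAdmissible Ω p (fun x => v x + (-1) * u x) := hw.add (hu.const_mul (-1))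
  obtain ⟨ℓ, hℓ, hle⟩ := hvar _ hφ (hw0.add_const_mul hw.2.1 hu.2.1 hb (-1))
  have h1 := hℓ.le hΩb hu.2 hφ.2
  have h2 : (fun x => u x + (v x + (-1) * u x)) = v := by ext x; ring
  rw [h2] at h1
  have h3 := integral_sub (hu.integrable_source_mul hp hH hw (lam := lam))
    (hu.integrable_source_mul hp hH hu (lam := lam))
  have h4 : ∀ x, (H x + lam * f p (u x)) * (v x + (-1) * u x)
      = (H x + lam * f p (u x)) * v x - (H x + lam * f p (u x)) * u x := fun x => by ring
  simp only [h4, h3] at hle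
  linarith

/-- A minimiser of the relaxed linearised functional is a weak solution. -/
lemma isWeakSolution_of_forall_le (hΩo : IsOpen Ω) (hΩb : Bornology.IsBounded Ω)
    (hΩ : HasC1Boundary Ω) (hp : 1 ≤ p) (hH : MemLp H ∞ (volume.restrict Ω))
    (hu : IsAdmissible Ω p u) (hu0 : ∀ᵐ x ∂(volume.restrict Ω), 0 ≤ u x)
    (hb : VanishesOnBoundary Ω u)
    (hmin : ∀ v, IsAdmissible Ω p v → ∃ T : EuclideanSpace ℝ (Fin (m + 1)) → ℝ, HasTrace Ω v T ∧
      area Ω u - ∫ x in Ω, (H x + lam * f p (u x)) * u x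
        ≤ area Ω v - (∫ x in Ω, (H x + lam * f p (u x)) * v x)
          + ∫ x, |T x| ∂(surfaceMeasure Ω)) :
    IsWeakSolution Ω H p lam u := by
  refine ⟨hu, fun φ hφ hφ0 => exists_hasAreaDeriv hΩb hu.2 hφ.2 fun t _ => ?_, hu0, hb⟩
  have hv : IsAdmissible Ω p (fun x => u x + t * φ x) := hu.add (hφ.const_mul t)
  obtain ⟨T, hT, hle⟩ := hmin _ hv
  -- The hypothesis provides some trace `T` of `u + t φ`; zero is also one, and traces are unique
  -- a.e.
  have hT0 : ∫ x, |T x| ∂(surfaceMeasure Ω) = 0 := by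
    refine integral_eq_zero_of_ae ?_
    filter_upwards [hT.ae_eq_zero hΩo hΩ hv.2.1 (hb.add_const_mul hu.2.1 hφ.2.1 hφ0 t)]
      with x hx
    simp [hx]
  have h3 := integral_add (hu.integrable_source_mul hp hH hu (lam := lam))
    ((hu.integrable_source_mul hp hH hφ (lam := lam)).const_mul t)
  have h4 : ∀ x, (H x + lam * f p (u x)) * (u x + t * φ x)
      = (H x + lam * f p (u x)) * u x + t * ((H x + lam * f p (u x)) * φ x) := fun x => by ring
  rw [integral_const_mul] at h3
  simp only [h4, h3, hT0] at hle
  linarith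

end Minimality

end MeanCurvature

theorem mainTheorem8 (n : ℕ) (hn : 1 ≤ n) (Ω : Set (EuclideanSpace ℝ (Fin n)))
    (hΩo : IsOpen Ω) (hΩb : Bornology.IsBounded Ω) (hΩ : MeanCurvature.HasC1Boundary Ω)
    (H : EuclideanSpace ℝ (Fin n) → ℝ) (hH : MemLp H ∞ (volume.restrict Ω))
    (p : ℝ) (hp : 1 ≤ p) (lam : ℝ)
    (u : EuclideanSpace ℝ (Fin n) → ℝ) (hu : MeanCurvature.IsAdmissible Ω p u)
    (hu0 : ∀ᵐ x ∂(volume.restrict Ω), 0 ≤ u x) :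
    (∀ s t : ℝ, 0 ≤ MeanCurvature.G p s t) ∧
    List.TFAE [
      MeanCurvature.IsWeakSolution Ω H p lam u,
      MeanCurvature.VanishesOnBoundary Ω u ∧
        ∀ v : EuclideanSpace ℝ (Fin n) → ℝ, MeanCurvature.IsAdmissible Ω p v →
          ∃ T : EuclideanSpace ℝ (Fin n) → ℝ, MeanCurvature.HasTrace Ω v T ∧
            MeanCurvature.area Ω u - ∫ x in Ω, (H x + lam * MeanCurvature.f p (u x)) * u x
              ≤ MeanCurvature.area Ω v
                - (∫ x in Ω, (H x + lam * MeanCurvature.f p (u x)) * v x)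
                + ∫ x, |T x| ∂(MeanCurvature.surfaceMeasure Ω),
      MeanCurvature.VanishesOnBoundary Ω u ∧
        ∀ v : EuclideanSpace ℝ (Fin n) → ℝ, MeanCurvature.IsAdmissible Ω p v →
          ∃ T : EuclideanSpace ℝ (Fin n) → ℝ, MeanCurvature.HasTrace Ω v T ∧
            MeanCurvature.energy Ω H p lam u
              ≤ MeanCurvature.energy Ω H p lam v
                + (∫ x in Ω, lam * MeanCurvature.G p (u x) (v x))
                + ∫ x, |T x| ∂(MeanCurvature.surfaceMeasure Ω)] := by
  -- Charts split off one direction, so the boundary has dimension `m`.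
  obtain ⟨m, rfl⟩ : ∃ m, n = m + 1 := ⟨n - 1, by omega⟩
  refine ⟨MeanCurvature.G_nonneg hp, ?_⟩
  tfae_have 1 → 2 := fun h => ⟨h.2.2.2, fun v hv =>
    MeanCurvature.exists_hasTrace_and_le hΩo hΩb hΩ hp hH hu
      (fun w hw hw0 => h.le_of_vanishesOnBoundary hΩb hp hH hw hw0) hv⟩
  tfae_have 2 → 1 := fun h =>
    MeanCurvature.isWeakSolution_of_forall_le hΩo hΩb hΩ hp hH hu hu0 h.1 h.2
  -- Both sides are shifted by the same constant `∫ λ (f(u) u - F(u))`, so the inequalities are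
  -- equivalent for each `v` with the same trace.
  tfae_have 2 → 3 := by
    refine fun h => ⟨h.1, fun v hv => ?_⟩
    obtain ⟨T, hT, hle⟩ := h.2 v hv
    refine ⟨T, hT, ?_⟩
    rw [MeanCurvature.energy_self hp hH hu, MeanCurvature.energy_add_integral_G hp hH hu hv]
    linarith
  tfae_have 3 → 2 := by
    refine fun h => ⟨h.1, fun v hv => ?_⟩
    obtain ⟨T, hT, hle⟩ := h.2 v hv
    refine ⟨T, hT, ?_⟩
    rw [MeanCurvature.energy_self hp hH hu, MeanCurvature.energy_add_integral_G hp hH hu hv]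
      at hle
    linarith
  tfae_finish
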